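/- **Setting.** Let $\mathsf K$ be a field, $A$ a $\mathsf K$-algebra and $Q$ a finite poset with a least element $0$. Let $\mathcal R=\{\mathcal R_{y,x}\subseteq A : y\le x\}$ be a $Q$-multiplicative system: $\mathsf K$-subspaces with $\mathcal R_{z,y}\mathcal R_{y,x}\subseteq \mathcal R_{z,x}$ for $z\le y\le x$, such that each $\mathcal R_x:=\mathcal R_{x,x}$ is an algebra with a unit $1_x$, where $1_y r=r=r1_x$ for $r\in\mathcal R_{y,x}$. Assume that every $\mathcal R_x$ is a division ring (e.g. a field) and that every $\mathcal R_{0,x}$ is one-dimensional as a left $\mathcal R_0$-vector space; choose $v_{0,x}$ with $\mathcal R_{0,x}=\mathcal R_0v_{0,x}$. Let $\phi_x:\mathcal R_x\to\mathcal R_0$ and $\chi_{y,x}:\mathcal R_{y,x}\to\mathcal R_0$ $(0<y<x)$ be given by $$v_{0,x}z=\phi_x(z)\,v_{0,x},\qquad v_{0,y}r=\chi_{y,x}(r)\,v_{0,x}.$$ Let $\Lambda=\bigoplus_{y\le x}e_{y,x}\mathcal R_{y,x}$ be the incidence algebra (a matrix algebra), $S=\bigoplus_x e_{x,x}\mathcal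 R_x$, $J=\bigoplus_{y<x}e_{y,x}\mathcal R_{y,x}$, so $\Lambda=S\oplus J$, and let $e_x=e_{x,x}1_x$. Let ${}^*J=\mathrm{Hom}_S({}_SJ,S)$, with $(a\gamma s)(j)=\gamma(ja)s$, and suppose that ${}_SJ$ has a finite dual basis $\{p_i,\gamma_i\}$, that is $j=\sum_i\gamma_i(j)p_i$ for all $j\in J$. Put $\mu(\gamma)=\sum_{i,j}\gamma_i\otimes\gamma_j\,\gamma(p_jp_i)$. Let $\hat u_{0,x}\in{}^*J$ be the element dual to $e_{0,x}v_{0,x}$: $\hat u_{0,x}(e_{0,x}rv_{0,x})=e_{0,0}r$ for $r\in\mathcal R_0$, and $\hat u_{0,x}$ vanishes on the other summands $e_{y,z}\mathcal R_{y,z}$ of $J$; then $z\,\hat u_{0,x}=\hat u_{0,x}\,\phi_x(z)$ for $z\in\mathcal R_x$. *The Drozd ditalgebra.* Let $$R=\begin{pmatrix}S&0\\0&S\end{pmatrix},\quad W_0=\begin{pmatrix}0&{}^*J\\0&0\end{pmatrix},\quad W_1=\begin{pmatrix}{}^*J&0\\0&{}^*J\end{pmatrix},\quad W=W_0\oplus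 W_1,$$ let $w_1,w_2,w_{1,2}$ be the matrix units at the places $(1,1),(2,2),(1,2)$, and let $\mathcal D=(T_R(W),d)$ be the ditalgebra (graded tensor algebra with $R,W_0$ in degree $0$ and $W_1$ in degree $1$) whose differential $d$ has degree $1$, vanishes on $R$, satisfies $d(ab)=d(a)b+(-1)^{\deg a}a\,d(b)$, and is given on $W$ by $$d(w_{1,2}\gamma)=(w_{1,2}\otimes w_2-w_1\otimes w_{1,2})*\mu(\gamma),\quad d(w_1\gamma)=-(w_1\otimes w_1)*\mu(\gamma),\quad d(w_2\gamma)=-(w_2\otimes w_2)*\mu(\gamma),$$ where $(u\otimes u')*\sum_k\alpha_k\otimes\beta_k=\sum_k u\alpha_k\otimes u'\beta_k$. The objects of $\mathrm{Mod}\,\mathcal D$ are the right $T_R(W)_0$-modules. A morphism $M\to N$ is a pair $(f^0,f^1)$, where $f^0:M\to N$ is a morphism of right $R$-modules and $f^1:T_R(W)_1\to\mathrm{Hom}_{\mathsf K}(M,N)$ is a morphism of $T_R(W)_0$-bimodules (where $f^1(at)(m)=f^1(t)(ma)$ and $f^1(ta)(m)=f^1(t)(m)a$), such that $f^0(m)a=f^0(ma)+f^1(d(a))(m)$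 for all $m\in M$ and $a\in T_R(W)_0$. Composition is $(gf)^0=g^0f^0$ and $(gf)^1(t)=g^1(t)f^0+g^0f^1(t)-\sum_i g^1(t_i'')f^1(t_i')$ if $d(t)=\sum_i t_i't_i''$ with $t_i',t_i''\in T_R(W)_1$; the identities are $(\mathrm{id},0)$. Let $e=\sum_{x\ne0}w_1e_x+w_2e_0$, and let $\mathrm{mod}\,\mathcal D^e$ be the full subcategory of $\mathrm{Mod}\,\mathcal D$ of the objects $M$ with $M(1-e)=0$ and $\dim_{\mathsf K}M<\infty$. For such an $M$ put $M_x=Mw_1e_x$ $(x\neq0)$ and $M_0=Mw_2e_0$. A local basis of $M$ consists of an $\mathcal R_x$-basis $m^x_1,\dots,m^x_{d_x}$ of the right $\mathcal R_x$-space $M_x$ for each $x\in Q$; it yields, for $x>0$, the matrix $\mathscr M(M)_x=(g^x_{j,i})$ of size $d_0\times d_x$ over $\mathcal R_0$ with $$m^x_i\,w_{1,2}\hat u_{0,x}=\sum_{j=1}^{d_0}m^0_j\,g^x_{j,i}.$$ **Theorem.** Let $M,N$ be two objects of $\mathrm{mod}\,\mathcal D^e$ with given local bases. Then $M\cong N$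 in $\mathrm{mod}\,\mathcal D^e$ if and only if $M$ and $N$ have the same dimensions $d_x$ $(x\in Q)$ and there are nonsingular matrices $T_0\in\mathscr M_{d_0}(\mathcal R_0)$ and $T_x\in\mathscr M_{d_x}(\mathcal R_x)$ for $x>0$, and matrices $T_{yx}\in\mathscr M_{d_y\times d_x}(\mathcal R_{y,x})$ for $0<y<x$, such that for every $x>0$ $$\mathscr M(M)_x=T_0\,\mathscr M(N)_x\,\phi_x(T_x)+\sum_{0<y<x}T_0\,\mathscr M(N)_y\,\chi_{y,x}(T_{yx}),$$ where $\phi_x$ and $\chi_{y,x}$ are applied to the entries. **Corollary.** Let $p$ be a prime number, and let $\mathsf G=\mathsf F(\xi)$ be a field extension of degree $p$. Let $\mathscr P_0$ be a finite $p$-equipped poset: each relation $x\le y$ has a value $\ell\in\{1,\dots,p\}$, written $x\le^\ell y$, such that $x\le^\ell y\le^m z$ and $x\le^n z$ imply $n\ge\min\{\ell+m-1,p\}$. Let $\mathscr P$ be obtained from $\mathscr P_0$ by adding a least point $0$ and a greatest point $\mathsf m$, where every relation involving a new point has value $p$. A point $x$ is strong if $x\le^p x$, and weak if $x\le^1x$.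 Put $\mathcal Q_{x,y}=\mathsf F\langle1,\xi,\dots,\xi^{\ell-1}\rangle$ for $x\le^\ell y$ in $\mathscr P$; this is a $\mathscr P$-multiplicative system over the $\mathsf F$-algebra $\mathsf G$, with $\mathcal Q_{0,x}=\mathcal Q_0=\mathsf G$. Construct $\mathrm{mod}\,\mathcal D^e$ and the matrices as above for this system, with $v_{0,x}=1$. Then two objects $M,N$ of $\mathrm{mod}\,\mathcal D^e$ with given local bases are isomorphic if and only if they have the same dimensions $d_x$ and there are a nonsingular $T_0\in\mathscr M_{d_0}(\mathsf G)$; for each $x>0$ a nonsingular $T_x$ in $\mathscr M_{d_x}(\mathsf G)$ if $x$ is strong, and in $\mathscr M_{d_x}(\mathsf F)$ if $x$ is weak; and for $0<y<^\ell x$ a $d_y\times d_x$ matrix $T_{yx}$ over $\mathsf F\langle1,\xi,\dots,\xi^{\ell-1}\rangle$, such that for every $x>0$ in $\mathscr P$ $$\mathscr M(M)_x=T_0\,\mathscr M(N)_x\,T_x+\sum_{0<y<x}T_0\,\mathscr M(N)_y\,T_{yx}.$$ -/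

import Mathlib

open MulOpposite (op)

namespace EqPoset

/-! ## Tensor algebras of bimodules and ditalgebras -/

section Tensor

universe u v w w'

/-- The defining relations of the tensor algebra `T_R(W)` of an `R`-`R`-bimodule `W`. -/
inductive TensorRel (K : Type u) (R : Type v) (W : Type w) [Field K] [Ring R] [Algebra K R]
    [AddCommGroup W] [Module R W] [Module Rᵐᵒᵖ W] :
    FreeAlgebra K (R ⊕ W) → FreeAlgebra K (R ⊕ W) → Prop
  | addR (r s : R) : TensorRel K R W (FreeAlgebra.ι K (Sum.inl (r + s)))
      (FreeAlgebra.ι K (Sum.inl r) + FreeAlgebra.ι K (Sum.inl s))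
  | mulR (r s : R) : TensorRel K R W (FreeAlgebra.ι K (Sum.inl (r * s)))
      (FreeAlgebra.ι K (Sum.inl r) * FreeAlgebra.ι K (Sum.inl s))
  | scalar (k : K) : TensorRel K R W (FreeAlgebra.ι K (Sum.inl (algebraMap K R k)))
      (algebraMap K (FreeAlgebra K (R ⊕ W)) k)
  | addW (x y : W) : TensorRel K R W (FreeAlgebra.ι K (Sum.inr (x + y)))
      (FreeAlgebra.ι K (Sum.inr x) + FreeAlgebra.ι K (Sum.inr y))
  | left (r : R) (x : W) : TensorRel K R W (FreeAlgebra.ι K (Sum.inr (r • x)))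
      (FreeAlgebra.ι K (Sum.inl r) * FreeAlgebra.ι K (Sum.inr x))
  | right (x : W) (r : R) : TensorRel K R W (FreeAlgebra.ι K (Sum.inr (op r • x)))
      (FreeAlgebra.ι K (Sum.inr x) * FreeAlgebra.ι K (Sum.inl r))

/-- The tensor algebra `T_R(W)` of an `R`-`R`-bimodule `W`: the `K`-algebra generated by `R` and `W`,
subject to the relations saying that `R → T_R(W)` is a morphism of `K`-algebras and that
`W → T_R(W)` is a morphism of `R`-`R`-bimodules. -/
def TensorAlg (K : Type u) (R : Type v) (W : Type w) [Field K] [Ring R] [Algebra K R]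
    [AddCommGroup W] [Module R W] [Module Rᵐᵒᵖ W] : Type (max u v w) :=
  RingQuot (TensorRel K R W)

namespace TensorAlg

variable (K : Type u) (R : Type v) (W : Type w) [Field K] [Ring R] [Algebra K R]
    [AddCommGroup W] [Module R W] [Module Rᵐᵒᵖ W]

noncomputable instance : Ring (TensorAlg K R W) :=
  inferInstanceAs (Ring (RingQuot (TensorRel K R W)))

noncomputable instance : Algebra K (TensorAlg K R W) :=
  inferInstanceAs (Algebra K (RingQuot (TensorRel K R W)))

/-- The quotient map from the free algebra. -/
noncomputable def mk : FreeAlgebra K (R ⊕ W) →ₐ[K] TensorAlg K R W :=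
  RingQuot.mkAlgHom K (TensorRel K R W)

variable {K R W} in
theorem mk_rel {x y : FreeAlgebra K (R ⊕ W)} (h : TensorRel K R W x y) :
    mk K R W x = mk K R W y :=
  RingQuot.mkAlgHom_rel K h

/-- The canonical map `R → T_R(W)`. -/
noncomputable def ofR : R →ₐ[K] TensorAlg K R W where
  toFun r := mk K R W (FreeAlgebra.ι K (Sum.inl r))
  map_add' r s := by rw [mk_rel (TensorRel.addR r s), map_add]
  map_mul' r s := by rw [mk_rel (TensorRel.mulR r s), map_mul]
  map_one' := by
    have h := mk_rel (TensorRel.scalar (R := R) (W := W) (1 : K))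
    simpa only [map_one] using h
  map_zero' := by
    have h := mk_rel (TensorRel.scalar (R := R) (W := W) (0 : K))
    simpa only [map_zero] using h
  commutes' k := by rw [mk_rel (TensorRel.scalar k), AlgHom.commutes]

/-- The canonical map `W → T_R(W)`. -/
noncomputable def ofW : W →+ TensorAlg K R W :=
  AddMonoidHom.mk' (fun x => mk K R W (FreeAlgebra.ι K (Sum.inr x)))
    (fun x y => by rw [mk_rel (TensorRel.addW x y), map_add])

variable {K R W}

theorem ofW_left (r : R) (x : W) : ofW K R W (r • x) = ofR K R W r * ofW K R W x := by
  change mk K R W _ = mk K R W _ * mk K R W _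
  rw [mk_rel (TensorRel.left r x), map_mul]

theorem ofW_right (x : W) (r : R) : ofW K R W (op r • x) = ofW K R W x * ofR K R W r := by
  change mk K R W _ = mk K R W _ * mk K R W _
  rw [mk_rel (TensorRel.right x r), map_mul]

/-- The universal property of `T_R(W)`. -/
noncomputable def lift {B : Type w'} [Ring B] [Algebra K B] (f : R →ₐ[K] B) (g : W →+ B)
    (hl : ∀ r x, g (r • x) = f r * g x) (hr : ∀ x r, g (op r • x) = g x * f r) :
    TensorAlg K R W →ₐ[K] B :=
  RingQuot.liftAlgHom K ⟨FreeAlgebra.lift K (Sum.elim f g), by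
    intro x y h
    induction h <;> simp [hl, hr]⟩

section
variable {B : Type w'} [Ring B] [Algebra K B] (f : R →ₐ[K] B) (g : W →+ B)
    (hl : ∀ r x, g (r • x) = f r * g x) (hr : ∀ x r, g (op r • x) = g x * f r)

theorem lift_ofR (r : R) : lift f g hl hr (ofR K R W r) = f r := by
  change RingQuot.liftAlgHom K _ (RingQuot.mkAlgHom K _ _) = _
  rw [RingQuot.liftAlgHom_mkAlgHom_apply]; simp

theorem lift_ofW (x : W) : lift f g hl hr (ofW K R W x) = g x := by
  change RingQuot.liftAlgHom K _ (RingQuot.mkAlgHom K _ _) = _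
  rw [RingQuot.liftAlgHom_mkAlgHom_apply]; simp

end

theorem algHom_ext {B : Type w'} [Ring B] [Algebra K B] {F G : TensorAlg K R W →ₐ[K] B}
    (hR : ∀ r, F (ofR K R W r) = G (ofR K R W r))
    (hW : ∀ x, F (ofW K R W x) = G (ofW K R W x)) : F = G := by
  apply RingQuot.ringQuot_ext' K
  apply FreeAlgebra.hom_ext
  funext x
  rcases x with r | x
  · exact hR r
  · exact hW x

end TensorAlg

end Tensor

/-! ### Graded tensor algebras `T_R(W₀ ⊕ W₁)` and differentials -/

section Dit

universe u v w w'

variable (K : Type u) (R : Type v) (W₀ : Type w) (W₁ : Type w') [Field K] [Ring R] [Algebra K R]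
    [AddCommGroup W₀] [Module R W₀] [Module Rᵐᵒᵖ W₀]
    [AddCommGroup W₁] [Module R W₁] [Module Rᵐᵒᵖ W₁]

/-- The tensor algebra of the graded bimodule `W = W₀ ⊕ W₁`. -/
abbrev GrTensor : Type (max u v w w') := TensorAlg K R (W₀ × W₁)

namespace GrTensor

/-- The inclusion of the degree zero generators. -/
noncomputable def of₀ : W₀ →+ GrTensor K R W₀ W₁ :=
  (TensorAlg.ofW K R (W₀ × W₁)).comp (AddMonoidHom.inl W₀ W₁)

/-- The inclusion of the degree one generators. -/
noncomputable def of₁ : W₁ →+ GrTensor K R W₀ W₁ :=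
  (TensorAlg.ofW K R (W₀ × W₁)).comp (AddMonoidHom.inr W₀ W₁)

/-- The subalgebra `T_R(W)_0` of elements of degree zero. -/
noncomputable def degZero : Subalgebra K (GrTensor K R W₀ W₁) :=
  Algebra.adjoin K (Set.range (TensorAlg.ofR K R (W₀ × W₁)) ∪ Set.range (of₀ K R W₀ W₁))

/-- `T_R(W)_n`: the subspace spanned by the products of homogeneous generators with exactly `n`
factors in `W₁` (and any number of factors in `R` and `W₀`). -/
noncomputable def deg : ℕ → Submodule K (GrTensor K R W₀ W₁)
  | 0 => Subalgebra.toSubmodule (degZero K R W₀ W₁)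
  | n + 1 => deg n * Submodule.span K (Set.range (of₁ K R W₀ W₁)) *
      Subalgebra.toSubmodule (degZero K R W₀ W₁)

variable {K R W₀ W₁}

theorem ofR_mem (r : R) : TensorAlg.ofR K R (W₀ × W₁) r ∈ degZero K R W₀ W₁ :=
  Algebra.subset_adjoin (Or.inl ⟨r, rfl⟩)

theorem of₀_mem (x : W₀) : of₀ K R W₀ W₁ x ∈ degZero K R W₀ W₁ :=
  Algebra.subset_adjoin (Or.inr ⟨x, rfl⟩)

theorem mul_mem_deg {a t : GrTensor K R W₀ W₁} (ha : a ∈ degZero K R W₀ W₁) {n : ℕ}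
    (ht : t ∈ deg K R W₀ W₁ n) : a * t ∈ deg K R W₀ W₁ n := by
  induction n generalizing t with
  | zero => exact (degZero K R W₀ W₁).mul_mem ha ht
  | succ n ih =>
    change a * t ∈ deg K R W₀ W₁ n * _ * _
    induction ht using Submodule.mul_induction_on' with
    | mem_mul_mem x hx y hy =>
      induction hx using Submodule.mul_induction_on' with
      | mem_mul_mem x' hx' z hz =>
        rw [mul_assoc x', ← mul_assoc a, ← mul_assoc (a * x')]
        exact Submodule.mul_mem_mul (Submodule.mul_mem_mul (ih hx') hz) hy
      | add x₁ _ x₂ _ h₁ h₂ => rw [add_mul, mul_add]; exact Submodule.add_mem _ h₁ h₂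
    | add x₁ _ x₂ _ h₁ h₂ => rw [mul_add]; exact Submodule.add_mem _ h₁ h₂

theorem deg_mul_mem {a t : GrTensor K R W₀ W₁} (ha : a ∈ degZero K R W₀ W₁) {n : ℕ}
    (ht : t ∈ deg K R W₀ W₁ n) : t * a ∈ deg K R W₀ W₁ n := by
  cases n with
  | zero => exact (degZero K R W₀ W₁).mul_mem ht ha
  | succ n =>
    change t * a ∈ deg K R W₀ W₁ n * _ * _
    induction ht using Submodule.mul_induction_on' with
    | mem_mul_mem x hx y hy =>
      have h : x * (y * a) ∈ (deg K R W₀ W₁ n * Submodule.span K (Set.range (of₁ K R W₀ W₁))) *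
          Subalgebra.toSubmodule (degZero K R W₀ W₁) :=
        Submodule.mul_mem_mul hx ((degZero K R W₀ W₁).mul_mem hy ha)
      rwa [← mul_assoc] at h
    | add x₁ _ x₂ _ h₁ h₂ => rw [add_mul]; exact Submodule.add_mem _ h₁ h₂

theorem of₁_mem (x : W₁) : of₁ K R W₀ W₁ x ∈ deg K R W₀ W₁ 1 := by
  have h := Submodule.mul_mem_mul (Submodule.mul_mem_mul
    (show (1 : GrTensor K R W₀ W₁) ∈ deg K R W₀ W₁ 0 from (degZero K R W₀ W₁).one_mem)
    (Submodule.subset_span (R := K) (Set.mem_range_self (f := of₁ K R W₀ W₁) x)))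
    (show (1 : GrTensor K R W₀ W₁) ∈ Subalgebra.toSubmodule (degZero K R W₀ W₁) from
      (degZero K R W₀ W₁).one_mem)
  rwa [one_mul, mul_one] at h

theorem mul_of₁_mem {t : GrTensor K R W₀ W₁} {n : ℕ} (ht : t ∈ deg K R W₀ W₁ n) (x : W₁) :
    t * of₁ K R W₀ W₁ x ∈ deg K R W₀ W₁ (n + 1) := by
  have h := Submodule.mul_mem_mul (Submodule.mul_mem_mul ht
    (Submodule.subset_span (R := K) (Set.mem_range_self (f := of₁ K R W₀ W₁) x)))
    (show (1 : GrTensor K R W₀ W₁) ∈ Subalgebra.toSubmodule (degZero K R W₀ W₁) from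
      (degZero K R W₀ W₁).one_mem)
  rwa [mul_one] at h

variable (K R W₀ W₁) in
/-- The automorphism of `T_R(W)` which multiplies the elements of degree `n` by `(-1)^n`. -/
noncomputable def sgn : GrTensor K R W₀ W₁ →ₐ[K] GrTensor K R W₀ W₁ :=
  TensorAlg.lift (TensorAlg.ofR K R (W₀ × W₁))
    ((of₀ K R W₀ W₁).comp (AddMonoidHom.fst W₀ W₁) - (of₁ K R W₀ W₁).comp (AddMonoidHom.snd W₀ W₁))
    (fun r x => by
      have h₀ := TensorAlg.ofW_left (K := K) r ((x.1, 0) : W₀ × W₁)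
      have h₁ := TensorAlg.ofW_left (K := K) r ((0, x.2) : W₀ × W₁)
      simp only [Prod.smul_mk, smul_zero] at h₀ h₁
      simp [of₀, of₁, mul_sub, h₀, h₁])
    (fun x r => by
      have h₀ := TensorAlg.ofW_right (K := K) ((x.1, 0) : W₀ × W₁) r
      have h₁ := TensorAlg.ofW_right (K := K) ((0, x.2) : W₀ × W₁) r
      simp only [Prod.smul_mk, smul_zero] at h₀ h₁
      simp [of₀, of₁, sub_mul, h₀, h₁])

theorem sgn_ofR (r : R) : sgn K R W₀ W₁ (TensorAlg.ofR K R (W₀ × W₁) r) =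
    TensorAlg.ofR K R (W₀ × W₁) r := by
  simp [sgn, TensorAlg.lift_ofR]

theorem sgn_of₀ (x : W₀) : sgn K R W₀ W₁ (of₀ K R W₀ W₁ x) = of₀ K R W₀ W₁ x := by
  change sgn K R W₀ W₁ (TensorAlg.ofW K R (W₀ × W₁) (x, 0)) = _
  simp [sgn, TensorAlg.lift_ofW]

theorem sgn_of₁ (x : W₁) : sgn K R W₀ W₁ (of₁ K R W₀ W₁ x) = - of₁ K R W₀ W₁ x := by
  change sgn K R W₀ W₁ (TensorAlg.ofW K R (W₀ × W₁) (0, x)) = _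
  simp [sgn, TensorAlg.lift_ofW]

/-- Auxiliary algebra morphism `t ↦ (sgn t, d t; 0, t)` encoding the graded Leibniz rule. -/
noncomputable def extAux (δ : W₀ × W₁ →+ GrTensor K R W₀ W₁)
    (hl : ∀ r x, δ (r • x) = TensorAlg.ofR K R (W₀ × W₁) r * δ x)
    (hr : ∀ x r, δ (op r • x) = δ x * TensorAlg.ofR K R (W₀ × W₁) r) :
    GrTensor K R W₀ W₁ →ₐ[K] Matrix (Fin 2) (Fin 2) (GrTensor K R W₀ W₁) :=
  TensorAlg.lift
    ((Matrix.scalarAlgHom (Fin 2) K).comp (TensorAlg.ofR K R (W₀ × W₁)))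
    (AddMonoidHom.mk' (fun x => !![sgn K R W₀ W₁ (TensorAlg.ofW K R (W₀ × W₁) x), δ x;
      0, TensorAlg.ofW K R (W₀ × W₁) x]) (fun x y => by
        ext i j; fin_cases i <;> fin_cases j <;> simp))
    (fun r x => by
      ext i j; fin_cases i <;> fin_cases j <;>
        simp [Matrix.mul_apply, hl, TensorAlg.ofW_left, sgn_ofR, Matrix.diagonal])
    (fun x r => by
      ext i j; fin_cases i <;> fin_cases j <;>
        simp [Matrix.mul_apply, hr, TensorAlg.ofW_right, sgn_ofR, Matrix.diagonal])

section
variable (δ : W₀ × W₁ →+ GrTensor K R W₀ W₁)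
    (hl : ∀ r x, δ (r • x) = TensorAlg.ofR K R (W₀ × W₁) r * δ x)
    (hr : ∀ x r, δ (op r • x) = δ x * TensorAlg.ofR K R (W₀ × W₁) r)

theorem extAux_ofR (r : R) : extAux δ hl hr (TensorAlg.ofR K R (W₀ × W₁) r) =
    Matrix.scalar (Fin 2) (TensorAlg.ofR K R (W₀ × W₁) r) := by
  rw [extAux, TensorAlg.lift_ofR]; rfl

theorem extAux_ofW (x : W₀ × W₁) : extAux δ hl hr (TensorAlg.ofW K R (W₀ × W₁) x) =
    !![sgn K R W₀ W₁ (TensorAlg.ofW K R (W₀ × W₁) x), δ x; 0, TensorAlg.ofW K R (W₀ × W₁) x] := by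
  rw [extAux, TensorAlg.lift_ofW]; rfl

theorem extAux_apply (t : GrTensor K R W₀ W₁) :
    extAux δ hl hr t = !![sgn K R W₀ W₁ t, extAux δ hl hr t 0 1; 0, t] := by
  let f : FreeAlgebra K (R ⊕ (W₀ × W₁)) → Prop := fun z =>
    extAux δ hl hr (TensorAlg.mk K R _ z) 0 0 = sgn K R W₀ W₁ (TensorAlg.mk K R _ z) ∧
    extAux δ hl hr (TensorAlg.mk K R _ z) 1 0 = 0 ∧
    extAux δ hl hr (TensorAlg.mk K R _ z) 1 1 = TensorAlg.mk K R _ z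
  have key : ∀ z, f z := by
    intro z
    induction z using FreeAlgebra.induction with
    | grade0 k =>
      simp only [f, AlgHom.commutes]
      simp [Matrix.algebraMap_matrix_apply]
    | grade1 x =>
      rcases x with r | x
      · have h := extAux_ofR δ hl hr r
        change extAux δ hl hr (TensorAlg.mk K R _ (FreeAlgebra.ι K (Sum.inl r))) = _ at h
        have hs := sgn_ofR (K := K) (W₀ := W₀) (W₁ := W₁) r
        change sgn K R W₀ W₁ (TensorAlg.mk K R _ (FreeAlgebra.ι K (Sum.inl r))) = _ at hs
        refine ⟨?_, ?_, ?_⟩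
        · rw [h, hs]; simp
        · rw [h]; simp
        · rw [h]; simp; rfl
      · have h := extAux_ofW δ hl hr x
        change extAux δ hl hr (TensorAlg.mk K R _ (FreeAlgebra.ι K (Sum.inr x))) = _ at h
        refine ⟨?_, ?_, ?_⟩ <;> (rw [h]; rfl)
    | mul a b ha hb =>
      obtain ⟨a1, a2, a3⟩ := ha
      obtain ⟨b1, b2, b3⟩ := hb
      refine ⟨?_, ?_, ?_⟩ <;>
        simp [map_mul, Matrix.mul_apply, Fin.sum_univ_two, a1, a2, a3, b1, b2, b3]
    | add a b ha hb =>
      obtain ⟨a1, a2, a3⟩ := ha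
      obtain ⟨b1, b2, b3⟩ := hb
      refine ⟨?_, ?_, ?_⟩ <;> simp [map_add, a1, a2, a3, b1, b2, b3]
  obtain ⟨z, rfl⟩ : ∃ z, TensorAlg.mk K R _ z = t := RingQuot.mkAlgHom_surjective K _ t
  obtain ⟨h1, h2, h3⟩ := key z
  ext i j
  fin_cases i <;> fin_cases j
  · exact h1
  · rfl
  · exact h2
  · exact h3

end

end GrTensor

/-- A bimodule morphism `W → T_R(W)`, the datum from which a differential is built. -/
structure PreDifferential where
  /-- the morphism -/
  δ : W₀ × W₁ →+ GrTensor K R W₀ W₁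
  left : ∀ r x, δ (r • x) = TensorAlg.ofR K R (W₀ × W₁) r * δ x
  right : ∀ x r, δ (op r • x) = δ x * TensorAlg.ofR K R (W₀ × W₁) r

namespace PreDifferential

variable {K R W₀ W₁} (D : PreDifferential K R W₀ W₁)

open GrTensor

/-- The extension of `δ : W → T_R(W)` to `T_R(W)` which vanishes on `R` and satisfies the graded
Leibniz rule. -/
noncomputable def d : GrTensor K R W₀ W₁ →ₗ[K] GrTensor K R W₀ W₁ where
  toFun t := extAux D.δ D.left D.right t 0 1
  map_add' s t := by simp [map_add]
  map_smul' k t := by simp [map_smul]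

theorem d_ofR (r : R) : D.d (TensorAlg.ofR K R (W₀ × W₁) r) = 0 := by
  change extAux D.δ D.left D.right _ 0 1 = 0
  rw [extAux, TensorAlg.lift_ofR]; simp

theorem d_ofW (x : W₀ × W₁) : D.d (TensorAlg.ofW K R (W₀ × W₁) x) = D.δ x := by
  change extAux D.δ D.left D.right _ 0 1 = _
  rw [extAux, TensorAlg.lift_ofW]; rfl

/-- The graded Leibniz rule. -/
theorem d_mul (a b : GrTensor K R W₀ W₁) :
    D.d (a * b) = D.d a * b + sgn K R W₀ W₁ a * D.d b := by
  change extAux D.δ D.left D.right (a * b) 0 1 = extAux D.δ D.left D.right a 0 1 * b +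
    sgn K R W₀ W₁ a * extAux D.δ D.left D.right b 0 1
  rw [map_mul, extAux_apply D.δ D.left D.right a, extAux_apply D.δ D.left D.right b]
  simp [Matrix.mul_apply, Fin.sum_univ_two, add_comm]

theorem d_of₀ (x : W₀) : D.d (of₀ K R W₀ W₁ x) = D.δ (x, 0) := D.d_ofW (x, 0)

theorem d_of₁ (x : W₁) : D.d (of₁ K R W₀ W₁ x) = D.δ (0, x) := D.d_ofW (0, x)

end PreDifferential

/-- A ditalgebra `(T_R(W), d)` with `W = W₀ ⊕ W₁`: the differential `d` raises the degree by one,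
vanishes on `R`, satisfies the graded Leibniz rule and `d² = 0`.  (The map `d` on `T_R(W)` is
`toPreDifferential.d`, determined by its restriction `δ` to `W`; it is enough to require
the degree condition and `d² = 0` on the generators.) -/
structure Ditalgebra extends PreDifferential K R W₀ W₁ where
  deg_zero : ∀ x, δ (x, 0) ∈ GrTensor.deg K R W₀ W₁ 1
  deg_one : ∀ x, δ (0, x) ∈ GrTensor.deg K R W₀ W₁ 2
  sq : ∀ x, toPreDifferential.d (δ x) = 0

namespace Ditalgebra

open GrTensor

variable {K R W₀ W₁} (D : Ditalgebra K R W₀ W₁)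

theorem sgn_degZero {a : GrTensor K R W₀ W₁} (ha : a ∈ degZero K R W₀ W₁) :
    sgn K R W₀ W₁ a = a := by
  induction ha using Algebra.adjoin_induction with
  | mem x hx =>
    rcases hx with ⟨r, rfl⟩ | ⟨x, rfl⟩
    · exact sgn_ofR r
    · exact sgn_of₀ x
  | algebraMap k => exact AlgHom.commutes _ k
  | add x y _ _ hx hy => rw [map_add, hx, hy]
  | mul x y _ _ hx hy => rw [map_mul, hx, hy]

theorem d_degZero_mem {a : GrTensor K R W₀ W₁} (ha : a ∈ degZero K R W₀ W₁) :
    D.d a ∈ deg K R W₀ W₁ 1 := by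
  induction ha using Algebra.adjoin_induction with
  | mem x hx =>
    rcases hx with ⟨r, rfl⟩ | ⟨x, rfl⟩
    · rw [D.d_ofR]; exact Submodule.zero_mem _
    · rw [D.d_of₀]; exact D.deg_zero x
  | algebraMap k =>
    rw [← AlgHom.commutes (TensorAlg.ofR K R (W₀ × W₁)), D.d_ofR]; exact Submodule.zero_mem _
  | add x y _ _ hx hy => rw [map_add]; exact Submodule.add_mem _ hx hy
  | mul x y hx hy hdx hdy =>
    rw [D.d_mul, sgn_degZero hx]
    exact Submodule.add_mem _ (deg_mul_mem hy hdx) (mul_mem_deg hx hdy)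

universe x

/-- A representation of a ditalgebra (an object of `Mod 𝒟`): a right `T_R(W)_0`-module.  Right
modules are modules over the opposite ring; the `K`-vector space structure is the induced one. -/
structure Rep (D : Ditalgebra K R W₀ W₁) : Type (max u v w w' (x + 1)) where
  /-- the underlying space -/
  V : Type x
  [grp : AddCommGroup V]
  [modK : Module K V]
  [mod : Module (degZero K R W₀ W₁)ᵐᵒᵖ V]
  [tower : IsScalarTower K (degZero K R W₀ W₁)ᵐᵒᵖ V]

attribute [instance] Rep.grp Rep.modK Rep.mod Rep.tower

variable {D}

/-- The right action `m · a` of an element `a` of degree zero. -/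
noncomputable def Rep.act {M : D.Rep} (m : M.V) (a : degZero K R W₀ W₁) : M.V := op a • m

/-- The right action of an element of `R`. -/
noncomputable def Rep.actR {M : D.Rep} (m : M.V) (r : R) : M.V :=
  Rep.act m ⟨TensorAlg.ofR K R (W₀ × W₁) r, ofR_mem r⟩

/-- The right action of an element of `W₀`. -/
noncomputable def Rep.act₀ {M : D.Rep} (m : M.V) (x : W₀) : M.V :=
  Rep.act m ⟨of₀ K R W₀ W₁ x, of₀_mem x⟩

/-- A morphism `f = (f⁰, f¹) : M → N` in `Mod 𝒟`: `f⁰` is a morphism of right `R`-modules and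
`f¹ : T_R(W)_1 → Hom_K(M, N)` is a morphism of `T_R(W)_0`-bimodules, such that
`f⁰(m) a = f⁰(m a) + f¹(d a)(m)` for `a` of degree zero. -/
@[ext] structure Hom (M N : D.Rep) where
  /-- the component `f⁰` -/
  f₀ : M.V →ₗ[K] N.V
  /-- the component `f¹` -/
  f₁ : deg K R W₀ W₁ 1 →ₗ[K] (M.V →ₗ[K] N.V)
  map_actR : ∀ m r, f₀ (Rep.actR m r) = Rep.actR (f₀ m) r
  left : ∀ (a : degZero K R W₀ W₁) (t : deg K R W₀ W₁ 1) (m : M.V),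
    f₁ ⟨a * t, mul_mem_deg a.2 t.2⟩ m = f₁ t (Rep.act m a)
  right : ∀ (a : degZero K R W₀ W₁) (t : deg K R W₀ W₁ 1) (m : M.V),
    f₁ ⟨t * a, deg_mul_mem a.2 t.2⟩ m = Rep.act (f₁ t m) a
  comm : ∀ (a : degZero K R W₀ W₁) (m : M.V),
    Rep.act (f₀ m) a = f₀ (Rep.act m a) + f₁ ⟨D.d a, D.d_degZero_mem a.2⟩ m

/-- The identity morphism `(id, 0)`. -/
noncomputable def Hom.id (M : D.Rep) : Hom M M where
  f₀ := LinearMap.id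
  f₁ := 0
  map_actR _ _ := rfl
  left _ _ _ := rfl
  right _ _ _ := by simp [Rep.act]
  comm _ _ := by simp

/-- `h` is the composite `g ∘ f` in `Mod 𝒟`: `h⁰ = g⁰ f⁰` and, for `t` of degree one with
`d t = ∑ tᵢ tᵢ'` where `tᵢ, tᵢ'` are of degree one,
`h¹(t) = g¹(t) f⁰ + g⁰ f¹(t) - ∑ g¹(tᵢ') f¹(tᵢ)`. -/
def Hom.IsComp {M N L : D.Rep} (f : Hom M N) (g : Hom N L) (h : Hom M L) : Prop :=
  h.f₀ = g.f₀ ∘ₗ f.f₀ ∧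
  ∀ (t : deg K R W₀ W₁ 1) (n : ℕ) (s s' : Fin n → deg K R W₀ W₁ 1),
    D.d t = ∑ i, (s i : GrTensor K R W₀ W₁) * (s' i : GrTensor K R W₀ W₁) →
      h.f₁ t = g.f₁ t ∘ₗ f.f₀ + g.f₀ ∘ₗ f.f₁ t - ∑ i, g.f₁ (s' i) ∘ₗ f.f₁ (s i)

/-- Two representations are isomorphic in `Mod 𝒟`. -/
def Rep.Iso (M N : D.Rep) : Prop :=
  ∃ (f : Hom M N) (g : Hom N M), f.IsComp g (Hom.id M) ∧ g.IsComp f (Hom.id N)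

end Ditalgebra

end Dit

/-! ## The Drozd ditalgebra of `Λ = S ⊕ J` -/

section Drozd

universe u v

/-- A decomposition `Λ = S ⊕ J` of a `K`-algebra into a subalgebra `S` and a two-sided ideal `J`
(viewed as a left `S`-submodule). -/
structure Decomp (K : Type u) (Λ : Type v) [Field K] [Ring Λ] [Algebra K Λ] where
  /-- the subalgebra -/
  S : Subalgebra K Λ
  /-- the ideal -/
  J : Submodule S Λ
  mul_left : ∀ (a : Λ) {j : Λ}, j ∈ J → a * j ∈ J
  mul_right : ∀ {j : Λ} (a : Λ), j ∈ J → j * a ∈ J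
  isCompl : IsCompl (Subalgebra.toSubmodule S) (J.restrictScalars K)

variable {K : Type u} {Λ : Type v} [Field K] [Ring Λ] [Algebra K Λ]

namespace Decomp

/-- The left dual `*J = Hom_S(_S J, S)`. -/
def LDual (Δ : Decomp K Λ) : Type v := Δ.J →ₗ[Δ.S] Δ.S

variable {Δ : Decomp K Λ}

instance : AddCommGroup Δ.LDual := inferInstanceAs (AddCommGroup (Δ.J →ₗ[Δ.S] Δ.S))

/-- The value `γ(j)`. -/
def LDual.ev (γ : Δ.LDual) (j : Δ.J) : Δ.S := (id γ : Δ.J →ₗ[Δ.S] Δ.S) j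

@[ext] theorem LDual.ext {γ η : Δ.LDual} (h : ∀ j, γ.ev j = η.ev j) : γ = η :=
  LinearMap.ext h

theorem LDual.ev_add (γ : Δ.LDual) (i j : Δ.J) : γ.ev (i + j) = γ.ev i + γ.ev j :=
  LinearMap.map_add γ i j

theorem LDual.ev_smul (γ : Δ.LDual) (s : Δ.S) (j : Δ.J) : γ.ev (s • j) = s * γ.ev j :=
  LinearMap.map_smul γ s j

@[simp] theorem LDual.add_ev (γ η : Δ.LDual) (j : Δ.J) : (γ + η).ev j = γ.ev j + η.ev j := rfl

@[simp] theorem LDual.zero_ev (j : Δ.J) : (0 : Δ.LDual).ev j = 0 := rfl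

/-- Evaluation at `j` as an additive map. -/
def evHom (j : Δ.J) : Δ.LDual →+ Δ.S := AddMonoidHom.mk' (fun γ => γ.ev j) (fun _ _ => rfl)

theorem LDual.sum_ev {ι : Type*} (s : Finset ι) (f : ι → Δ.LDual) (j : Δ.J) :
    (∑ i ∈ s, f i).ev j = ∑ i ∈ s, (f i).ev j := map_sum (evHom j) f s

theorem LDual.ev_sum {ι : Type*} (s : Finset ι) (γ : Δ.LDual) (f : ι → Δ.J) :
    γ.ev (∑ i ∈ s, f i) = ∑ i ∈ s, γ.ev (f i) := map_sum (AddMonoidHom.mk' γ.ev γ.ev_add) f s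

/-- Right multiplication `j ↦ j a` on `J`. -/
def rmul (j : Δ.J) (a : Λ) : Δ.J := ⟨j * a, Δ.mul_right a j.2⟩

/-- Left action on `*J`: `(a γ)(j) = γ(j a)`. -/
instance : Module Λ Δ.LDual where
  smul a γ := (
    { toFun := fun j => γ.ev (rmul j a)
      map_add' := fun i j => by
        rw [← γ.ev_add]; congr 1; ext; simp [rmul, add_mul]
      map_smul' := fun s j => by
        rw [RingHom.id_apply, smul_eq_mul, ← γ.ev_smul]; congr 1; ext
        simp [rmul, Subalgebra.smul_def, mul_assoc] } : Δ.J →ₗ[Δ.S] Δ.S)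
  one_smul γ := LDual.ext fun j => congrArg γ.ev (Subtype.ext (mul_one _))
  mul_smul a b γ := LDual.ext fun j => congrArg γ.ev (Subtype.ext (mul_assoc _ _ _).symm)
  smul_zero a := rfl
  smul_add a γ η := rfl
  add_smul a b γ := LDual.ext fun j => by
    change γ.ev (rmul j (a + b)) = γ.ev (rmul j a) + γ.ev (rmul j b)
    rw [← γ.ev_add]; congr 1; ext; simp [rmul, mul_add]
  zero_smul γ := LDual.ext fun j => by
    change γ.ev (rmul j 0) = 0
    have h : rmul j 0 = (0 : Δ.J) := by ext; simp [rmul]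
    rw [h]; exact LinearMap.map_zero γ

theorem LDual.smul_ev (a : Λ) (γ : Δ.LDual) (j : Δ.J) : (a • γ).ev j = γ.ev (rmul j a) := rfl

/-- Right action of `S` on `*J`: `(γ s)(j) = γ(j) s`. -/
instance : Module (Δ.S)ᵐᵒᵖ Δ.LDual where
  smul s γ := (
    { toFun := fun j => γ.ev j * s.unop
      map_add' := fun i j => by rw [γ.ev_add, add_mul]
      map_smul' := fun t j => by
        rw [RingHom.id_apply, smul_eq_mul, γ.ev_smul, mul_assoc] } : Δ.J →ₗ[Δ.S] Δ.S)
  one_smul γ := LDual.ext fun j => mul_one _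
  mul_smul s t γ := LDual.ext fun j => (mul_assoc (γ.ev j) t.unop s.unop).symm
  smul_zero s := LDual.ext fun j => zero_mul _
  smul_add s γ η := LDual.ext fun j => add_mul _ _ _
  add_smul s t γ := LDual.ext fun j => mul_add _ _ _
  zero_smul γ := LDual.ext fun j => mul_zero _

theorem LDual.op_smul_ev (s : Δ.S) (γ : Δ.LDual) (j : Δ.J) : (op s • γ).ev j = γ.ev j * s := rfl

theorem smul_op_smul (a : Λ) (s : Δ.S) (γ : Δ.LDual) : a • (op s • γ) = op s • (a • γ) := rfl

/-- The algebra `R` of diagonal `2 × 2` matrices over `S`; the index `0` corresponds to the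
idempotent `w₁` and the index `1` to `w₂`. -/
abbrev RR (Δ : Decomp K Λ) : Type v := Fin 2 → Δ.S

/-- The `R`-`R`-bimodule `w_{a,b} *J`: the matrices with an entry of `*J` at the place `(a, b)`. -/
def Blk (Δ : Decomp K Λ) (_ _ : Fin 2) : Type v := Δ.LDual

instance (a b : Fin 2) : AddCommGroup (Δ.Blk a b) := inferInstanceAs (AddCommGroup Δ.LDual)

instance (a b : Fin 2) : Module Δ.RR (Δ.Blk a b) :=
  Module.compHom Δ.LDual ((Δ.S.val : Δ.S →+* Λ).comp (Pi.evalRingHom (fun _ : Fin 2 => ↥Δ.S) a))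

instance (a b : Fin 2) : Module (Δ.RR)ᵐᵒᵖ (Δ.Blk a b) :=
  Module.compHom Δ.LDual (Pi.evalRingHom (fun _ : Fin 2 => ↥Δ.S) b).op

theorem blk_smul {a b : Fin 2} (r : Δ.RR) (γ : Δ.LDual) :
    ((r • (show Δ.Blk a b from γ) : Δ.Blk a b) : Δ.LDual) = (r a : Λ) • γ := rfl

theorem blk_op_smul {a b : Fin 2} (r : Δ.RR) (γ : Δ.LDual) :
    ((op r • (show Δ.Blk a b from γ) : Δ.Blk a b) : Δ.LDual) = op (r b) • γ := rfl

/-- The tensor algebra `T_R(W)` of the Drozd ditalgebra: `W₀` is `*J` at the place `(1, 2)` and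
`W₁` is `*J` at the places `(1, 1)` and `(2, 2)`. -/
abbrev TT (Δ : Decomp K Λ) : Type (max u v) :=
  GrTensor K Δ.RR (Δ.Blk 0 1) (Δ.Blk 0 0 × Δ.Blk 1 1)

/-- `γ ↦ w_{1,2} γ` -/
noncomputable def w12 (Δ : Decomp K Λ) : Δ.LDual →+ Δ.TT :=
  GrTensor.of₀ K Δ.RR (Δ.Blk 0 1) (Δ.Blk 0 0 × Δ.Blk 1 1)

/-- `γ ↦ w₁ γ` -/
noncomputable def w1 (Δ : Decomp K Λ) : Δ.LDual →+ Δ.TT :=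
  (GrTensor.of₁ K Δ.RR (Δ.Blk 0 1) (Δ.Blk 0 0 × Δ.Blk 1 1)).comp
    (AddMonoidHom.inl (Δ.Blk 0 0) (Δ.Blk 1 1))

/-- `γ ↦ w₂ γ` -/
noncomputable def w2 (Δ : Decomp K Λ) : Δ.LDual →+ Δ.TT :=
  (GrTensor.of₁ K Δ.RR (Δ.Blk 0 1) (Δ.Blk 0 0 × Δ.Blk 1 1)).comp
    (AddMonoidHom.inr (Δ.Blk 0 0) (Δ.Blk 1 1))

/-- `R → T_R(W)` -/
noncomputable def ofR (Δ : Decomp K Λ) : Δ.RR →ₐ[K] Δ.TT :=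
  TensorAlg.ofR K Δ.RR (Δ.Blk 0 1 × (Δ.Blk 0 0 × Δ.Blk 1 1))

theorem w12_left (r : Δ.RR) (γ : Δ.LDual) : Δ.w12 ((r 0 : Λ) • γ) = Δ.ofR r * Δ.w12 γ := by
  have h := TensorAlg.ofW_left (K := K) r
    (((show Δ.Blk 0 1 from γ), (0 : Δ.Blk 0 0 × Δ.Blk 1 1)))
  rw [Prod.smul_mk, smul_zero] at h; exact h

theorem w12_right (r : Δ.RR) (γ : Δ.LDual) : Δ.w12 (op (r 1) • γ) = Δ.w12 γ * Δ.ofR r := by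
  have h := TensorAlg.ofW_right (K := K)
    (((show Δ.Blk 0 1 from γ), (0 : Δ.Blk 0 0 × Δ.Blk 1 1))) r
  rw [Prod.smul_mk, smul_zero] at h; exact h

theorem w1_left (r : Δ.RR) (γ : Δ.LDual) : Δ.w1 ((r 0 : Λ) • γ) = Δ.ofR r * Δ.w1 γ := by
  have h := TensorAlg.ofW_left (K := K) r
    (((0 : Δ.Blk 0 1), ((show Δ.Blk 0 0 from γ), (0 : Δ.Blk 1 1))))
  rw [Prod.smul_mk, Prod.smul_mk, smul_zero, smul_zero] at h; exact h

theorem w1_right (r : Δ.RR) (γ : Δ.LDual) : Δ.w1 (op (r 0) • γ) = Δ.w1 γ * Δ.ofR r := by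
  have h := TensorAlg.ofW_right (K := K)
    (((0 : Δ.Blk 0 1), ((show Δ.Blk 0 0 from γ), (0 : Δ.Blk 1 1)))) r
  rw [Prod.smul_mk, Prod.smul_mk, smul_zero, smul_zero] at h; exact h

theorem w2_left (r : Δ.RR) (γ : Δ.LDual) : Δ.w2 ((r 1 : Λ) • γ) = Δ.ofR r * Δ.w2 γ := by
  have h := TensorAlg.ofW_left (K := K) r
    (((0 : Δ.Blk 0 1), ((0 : Δ.Blk 0 0), (show Δ.Blk 1 1 from γ))))
  rw [Prod.smul_mk, Prod.smul_mk, smul_zero, smul_zero] at h; exact h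

theorem w2_right (r : Δ.RR) (γ : Δ.LDual) : Δ.w2 (op (r 1) • γ) = Δ.w2 γ * Δ.ofR r := by
  have h := TensorAlg.ofW_right (K := K)
    (((0 : Δ.Blk 0 1), ((0 : Δ.Blk 0 0), (show Δ.Blk 1 1 from γ)))) r
  rw [Prod.smul_mk, Prod.smul_mk, smul_zero, smul_zero] at h; exact h

/-- A finite dual basis `{pᵢ, γᵢ}` of the left `S`-module `J`: `j = ∑ γᵢ(j) pᵢ` for all `j ∈ J`. -/
structure DualBasis (Δ : Decomp K Λ) where
  /-- the number of elements -/
  n : ℕ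
  /-- the elements `pᵢ` -/
  p : Fin n → Δ.J
  /-- the elements `γᵢ` -/
  γ : Fin n → Δ.LDual
  sum_eq : ∀ j : Δ.J, ∑ i, (γ i).ev j • p i = j

namespace DualBasis

variable (B : Δ.DualBasis)

/-- Given two maps `z, z'` from `*J`, the image of the comultiplication
`μ(γ) = ∑ᵢⱼ γᵢ ⊗ γⱼ γ(pⱼ pᵢ)` under `z ⊗ z'`, that is `∑ᵢⱼ z(γᵢ) z'(γⱼ γ(pⱼ pᵢ))`. -/
noncomputable def comul {X : Type*} [Ring X] (z z' : Δ.LDual →+ X) : Δ.LDual →+ X :=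
  AddMonoidHom.mk' (fun γ => ∑ i, ∑ j, z (B.γ i) *
      z' (op (γ.ev (rmul (B.p j) (B.p i : Λ))) • B.γ j))
    (fun γ η => by
      simp only [LDual.add_ev, ← Finset.sum_add_distrib, ← mul_add, ← map_add, MulOpposite.op_add,
        add_smul])

theorem expand (η : Δ.LDual) : ∑ j, op (η.ev (B.p j)) • B.γ j = η := by
  ext1 w
  rw [LDual.sum_ev]
  simp only [LDual.op_smul_ev, ← LDual.ev_smul]
  rw [← LDual.ev_sum, B.sum_eq]

theorem comul_apply {X : Type*} [Ring X] (z z' : Δ.LDual →+ X) (γ : Δ.LDual) :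
    B.comul z z' γ = ∑ i, z (B.γ i) * z' ((B.p i : Λ) • γ) := by
  change ∑ i, ∑ j, z (B.γ i) * z' (op (γ.ev (rmul (B.p j) (B.p i : Λ))) • B.γ j) = _
  refine Finset.sum_congr rfl fun i _ => ?_
  rw [← Finset.mul_sum, ← map_sum]
  congr 2
  exact B.expand ((B.p i : Λ) • γ)

/-- `z` and `z'` can be multiplied over `S`: `z(γ s) z'(η) = z(γ) z'(s η)`. -/
def Balanced {X : Type*} [Ring X] (z z' : Δ.LDual →+ X) : Prop :=
  ∀ (γ η : Δ.LDual) (s : Δ.S), z (op s • γ) * z' η = z γ * z' ((s : Λ) • η)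

theorem move {X : Type*} [Ring X] {z z' : Δ.LDual →+ X} (h : Balanced z z') (a : Λ)
    (η : Δ.LDual) :
    ∑ i, z (B.γ i) * z' (((B.p i : Λ) * a) • η) =
      ∑ i, z (a • B.γ i) * z' ((B.p i : Λ) • η) := by
  have h1 : ∀ i, (B.p i : Λ) * a =
      ∑ c, (((B.γ c).ev (rmul (B.p i) a) : Δ.S) : Λ) * (B.p c : Λ) := by
    intro i
    have := congrArg (Subtype.val) (B.sum_eq (rmul (B.p i) a))
    rw [Submodule.coe_sum] at this
    exact this.symm
  have h2 : ∀ c, a • B.γ c = ∑ i, op ((B.γ c).ev (rmul (B.p i) a)) • B.γ i := fun c =>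
    (B.expand (a • B.γ c)).symm
  simp_rw [h2, map_sum, Finset.sum_mul, h _ _ _]
  rw [Finset.sum_comm]
  refine Finset.sum_congr rfl fun i _ => ?_
  rw [h1 i, Finset.sum_smul, map_sum, Finset.mul_sum]
  simp_rw [mul_smul]

theorem comul_left {X : Type*} [Ring X] {z z' : Δ.LDual →+ X} (h : Balanced z z') (s : Δ.S)
    (t : X) (hz : ∀ γ, z ((s : Λ) • γ) = t * z γ) (γ : Δ.LDual) :
    B.comul z z' ((s : Λ) • γ) = t * B.comul z z' γ := by
  simp only [comul_apply, ← mul_smul]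
  rw [B.move h, Finset.mul_sum]
  simp only [hz, mul_assoc]

theorem comul_right {X : Type*} [Ring X] {z z' : Δ.LDual →+ X} (s : Δ.S)
    (t : X) (hz : ∀ γ, z' (op s • γ) = z' γ * t) (γ : Δ.LDual) :
    B.comul z z' (op s • γ) = B.comul z z' γ * t := by
  simp only [comul_apply, smul_op_smul, hz, Finset.sum_mul, mul_assoc]

/-- Coassociativity of the comultiplication. -/
theorem coassoc {X : Type*} [Ring X] {z z' z'' : Δ.LDual →+ X} (h : Balanced z' z'')
    (γ : Δ.LDual) :
    ∑ i, B.comul z z' (B.γ i) * z'' ((B.p i : Λ) • γ) =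
      ∑ i, z (B.γ i) * B.comul z' z'' ((B.p i : Λ) • γ) := by
  simp only [comul_apply, Finset.sum_mul, Finset.mul_sum, ← mul_smul, mul_assoc]
  rw [Finset.sum_comm]
  refine Finset.sum_congr rfl fun r _ => ?_
  rw [← Finset.mul_sum, ← Finset.mul_sum]
  congr 1
  exact (B.move h (B.p r : Λ) γ).symm

end DualBasis

theorem balanced_1_12 : DualBasis.Balanced Δ.w1 Δ.w12 := fun γ η s => by
  have h1 := w1_right (fun _ => s) γ
  have h2 := w12_left (fun _ => s) η
  rw [h1, h2, mul_assoc]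

theorem balanced_1_1 : DualBasis.Balanced Δ.w1 Δ.w1 := fun γ η s => by
  have h1 := w1_right (fun _ => s) γ
  have h2 := w1_left (fun _ => s) η
  rw [h1, h2, mul_assoc]

theorem balanced_12_2 : DualBasis.Balanced Δ.w12 Δ.w2 := fun γ η s => by
  have h1 := w12_right (fun _ => s) γ
  have h2 := w2_left (fun _ => s) η
  rw [h1, h2, mul_assoc]

theorem balanced_2_2 : DualBasis.Balanced Δ.w2 Δ.w2 := fun γ η s => by
  have h1 := w2_right (fun _ => s) γ
  have h2 := w2_left (fun _ => s) η
  rw [h1, h2, mul_assoc]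

/-- The restriction to `W` of the differential of the Drozd ditalgebra:
`d(w_{1,2} γ) = (w_{1,2} ⊗ w₂ - w₁ ⊗ w_{1,2}) * μ(γ)`, `d(w₁ γ) = -(w₁ ⊗ w₁) * μ(γ)`,
`d(w₂ γ) = -(w₂ ⊗ w₂) * μ(γ)`. -/
noncomputable def drozdPre (B : Δ.DualBasis) :
    PreDifferential K Δ.RR (Δ.Blk 0 1) (Δ.Blk 0 0 × Δ.Blk 1 1) where
  δ := AddMonoidHom.coprod
    ((B.comul Δ.w12 Δ.w2 - B.comul Δ.w1 Δ.w12 : Δ.LDual →+ Δ.TT) : Δ.Blk 0 1 →+ Δ.TT)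
    (AddMonoidHom.coprod
      ((-B.comul Δ.w1 Δ.w1 : Δ.LDual →+ Δ.TT) : Δ.Blk 0 0 →+ Δ.TT)
      ((-B.comul Δ.w2 Δ.w2 : Δ.LDual →+ Δ.TT) : Δ.Blk 1 1 →+ Δ.TT))
  left r x := by
    obtain ⟨a, b, c⟩ := x
    have h1 := B.comul_left balanced_12_2 (r 0) (Δ.ofR r) (w12_left r) a
    have h2 := B.comul_left balanced_1_12 (r 0) (Δ.ofR r) (w1_left r) a
    have h3 := B.comul_left balanced_1_1 (r 0) (Δ.ofR r) (w1_left r) b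
    have h4 := B.comul_left balanced_2_2 (r 1) (Δ.ofR r) (w2_left r) c
    change (B.comul Δ.w12 Δ.w2 ((r 0 : Λ) • _) - B.comul Δ.w1 Δ.w12 ((r 0 : Λ) • _)) +
      (-B.comul Δ.w1 Δ.w1 ((r 0 : Λ) • _) + -B.comul Δ.w2 Δ.w2 ((r 1 : Λ) • _)) =
      Δ.ofR r * ((B.comul Δ.w12 Δ.w2 _ - B.comul Δ.w1 Δ.w12 _) +
      (-B.comul Δ.w1 Δ.w1 _ + -B.comul Δ.w2 Δ.w2 _))
    rw [h1, h2, h3, h4]; noncomm_ring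
  right x r := by
    obtain ⟨a, b, c⟩ := x
    have h1 := B.comul_right (z := Δ.w12) (r 1) (Δ.ofR r) (w2_right r) a
    have h2 := B.comul_right (z := Δ.w1) (r 1) (Δ.ofR r) (w12_right r) a
    have h3 := B.comul_right (z := Δ.w1) (r 0) (Δ.ofR r) (w1_right r) b
    have h4 := B.comul_right (z := Δ.w2) (r 1) (Δ.ofR r) (w2_right r) c
    change (B.comul Δ.w12 Δ.w2 (op (r 1) • _) - B.comul Δ.w1 Δ.w12 (op (r 1) • _)) +
      (-B.comul Δ.w1 Δ.w1 (op (r 0) • _) + -B.comul Δ.w2 Δ.w2 (op (r 1) • _)) =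
      ((B.comul Δ.w12 Δ.w2 _ - B.comul Δ.w1 Δ.w12 _) +
      (-B.comul Δ.w1 Δ.w1 _ + -B.comul Δ.w2 Δ.w2 _)) * Δ.ofR r
    rw [h1, h2, h3, h4]; noncomm_ring

theorem d_w12 (B : Δ.DualBasis) (γ : Δ.LDual) :
    (drozdPre B).d (Δ.w12 γ) = B.comul Δ.w12 Δ.w2 γ - B.comul Δ.w1 Δ.w12 γ := by
  have h := (drozdPre B).d_of₀ γ
  change (drozdPre B).d (Δ.w12 γ) = (B.comul Δ.w12 Δ.w2 γ - B.comul Δ.w1 Δ.w12 γ) +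
    (-B.comul Δ.w1 Δ.w1 0 + -B.comul Δ.w2 Δ.w2 0) at h
  rw [h]; simp

theorem d_w1 (B : Δ.DualBasis) (γ : Δ.LDual) :
    (drozdPre B).d (Δ.w1 γ) = -B.comul Δ.w1 Δ.w1 γ := by
  have h := (drozdPre B).d_of₁ (γ, (0 : Δ.LDual))
  change (drozdPre B).d (Δ.w1 γ) = (B.comul Δ.w12 Δ.w2 0 - B.comul Δ.w1 Δ.w12 0) +
    (-B.comul Δ.w1 Δ.w1 γ + -B.comul Δ.w2 Δ.w2 0) at h
  rw [h]; simp

theorem d_w2 (B : Δ.DualBasis) (γ : Δ.LDual) :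
    (drozdPre B).d (Δ.w2 γ) = -B.comul Δ.w2 Δ.w2 γ := by
  have h := (drozdPre B).d_of₁ ((0 : Δ.LDual), γ)
  change (drozdPre B).d (Δ.w2 γ) = (B.comul Δ.w12 Δ.w2 0 - B.comul Δ.w1 Δ.w12 0) +
    (-B.comul Δ.w1 Δ.w1 0 + -B.comul Δ.w2 Δ.w2 γ) at h
  rw [h]; simp

theorem w12_mem (γ : Δ.LDual) :
    Δ.w12 γ ∈ GrTensor.degZero K Δ.RR (Δ.Blk 0 1) (Δ.Blk 0 0 × Δ.Blk 1 1) := GrTensor.of₀_mem _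

theorem w1_mem (γ : Δ.LDual) :
    Δ.w1 γ ∈ GrTensor.deg K Δ.RR (Δ.Blk 0 1) (Δ.Blk 0 0 × Δ.Blk 1 1) 1 := GrTensor.of₁_mem _

theorem w2_mem (γ : Δ.LDual) :
    Δ.w2 γ ∈ GrTensor.deg K Δ.RR (Δ.Blk 0 1) (Δ.Blk 0 0 × Δ.Blk 1 1) 1 := GrTensor.of₁_mem _

theorem d_w12_mem (B : Δ.DualBasis) (γ : Δ.LDual) : (drozdPre B).d (Δ.w12 γ) ∈
    GrTensor.deg K Δ.RR (Δ.Blk 0 1) (Δ.Blk 0 0 × Δ.Blk 1 1) 1 := by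
  rw [d_w12, B.comul_apply, B.comul_apply]
  refine Submodule.sub_mem _ (Submodule.sum_mem _ fun i _ => ?_)
    (Submodule.sum_mem _ fun i _ => ?_)
  · exact GrTensor.mul_mem_deg (w12_mem _) (w2_mem _)
  · exact GrTensor.deg_mul_mem (w12_mem _) (w1_mem _)

theorem d_w1_mem (B : Δ.DualBasis) (γ : Δ.LDual) : (drozdPre B).d (Δ.w1 γ) ∈
    GrTensor.deg K Δ.RR (Δ.Blk 0 1) (Δ.Blk 0 0 × Δ.Blk 1 1) 2 := by
  rw [d_w1, B.comul_apply]
  exact Submodule.neg_mem _ (Submodule.sum_mem _ fun i _ => GrTensor.mul_of₁_mem (w1_mem _) _)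

theorem d_w2_mem (B : Δ.DualBasis) (γ : Δ.LDual) : (drozdPre B).d (Δ.w2 γ) ∈
    GrTensor.deg K Δ.RR (Δ.Blk 0 1) (Δ.Blk 0 0 × Δ.Blk 1 1) 2 := by
  rw [d_w2, B.comul_apply]
  exact Submodule.neg_mem _ (Submodule.sum_mem _ fun i _ => GrTensor.mul_of₁_mem (w2_mem _) _)

theorem sgn_w12 (γ : Δ.LDual) :
    GrTensor.sgn K Δ.RR (Δ.Blk 0 1) (Δ.Blk 0 0 × Δ.Blk 1 1) (Δ.w12 γ) = Δ.w12 γ :=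
  GrTensor.sgn_of₀ _

theorem sgn_w1 (γ : Δ.LDual) :
    GrTensor.sgn K Δ.RR (Δ.Blk 0 1) (Δ.Blk 0 0 × Δ.Blk 1 1) (Δ.w1 γ) = -Δ.w1 γ :=
  GrTensor.sgn_of₁ _

theorem sgn_w2 (γ : Δ.LDual) :
    GrTensor.sgn K Δ.RR (Δ.Blk 0 1) (Δ.Blk 0 0 × Δ.Blk 1 1) (Δ.w2 γ) = -Δ.w2 γ :=
  GrTensor.sgn_of₁ _

theorem d_d_w12 (B : Δ.DualBasis) (γ : Δ.LDual) :
    (drozdPre B).d ((drozdPre B).d (Δ.w12 γ)) = 0 := by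
  have e1 := B.coassoc (z := Δ.w1) (z' := Δ.w1) (z'' := Δ.w12) balanced_1_12 γ
  have e2 := B.coassoc (z := Δ.w1) (z' := Δ.w12) (z'' := Δ.w2) balanced_12_2 γ
  have e3 := B.coassoc (z := Δ.w12) (z' := Δ.w2) (z'' := Δ.w2) balanced_2_2 γ
  rw [d_w12, map_sub, B.comul_apply, B.comul_apply, map_sum, map_sum]
  simp only [PreDifferential.d_mul, d_w12, d_w1, d_w2, sgn_w12, sgn_w1, sub_mul, mul_sub, neg_mul,
    mul_neg, Finset.sum_add_distrib, Finset.sum_sub_distrib, Finset.sum_neg_distrib]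
  rw [e1, e2, e3]; abel

theorem d_d_w1 (B : Δ.DualBasis) (γ : Δ.LDual) :
    (drozdPre B).d ((drozdPre B).d (Δ.w1 γ)) = 0 := by
  have e := B.coassoc (z := Δ.w1) (z' := Δ.w1) (z'' := Δ.w1) balanced_1_1 γ
  rw [d_w1, map_neg, B.comul_apply, map_sum]
  simp only [PreDifferential.d_mul, d_w1, sgn_w1, neg_mul,
    mul_neg, neg_neg, Finset.sum_add_distrib, Finset.sum_neg_distrib]
  rw [e]; abel

theorem d_d_w2 (B : Δ.DualBasis) (γ : Δ.LDual) :
    (drozdPre B).d ((drozdPre B).d (Δ.w2 γ)) = 0 := by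
  have e := B.coassoc (z := Δ.w2) (z' := Δ.w2) (z'' := Δ.w2) balanced_2_2 γ
  rw [d_w2, map_neg, B.comul_apply, map_sum]
  simp only [PreDifferential.d_mul, d_w2, sgn_w2, neg_mul,
    mul_neg, neg_neg, Finset.sum_add_distrib, Finset.sum_neg_distrib]
  rw [e]; abel

/-- The Drozd ditalgebra `𝒟 = (T_R(W), d)` of `Λ = S ⊕ J`. -/
noncomputable def drozd (B : Δ.DualBasis) :
    Ditalgebra K Δ.RR (Δ.Blk 0 1) (Δ.Blk 0 0 × Δ.Blk 1 1) where
  toPreDifferential := drozdPre B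
  deg_zero x := by
    rw [← PreDifferential.d_of₀]; exact d_w12_mem B x
  deg_one x := by
    obtain ⟨b, c⟩ := x
    rw [show ((0 : Δ.Blk 0 1), (b, c)) = ((0 : Δ.Blk 0 1), (b, (0 : Δ.Blk 1 1))) +
      ((0 : Δ.Blk 0 1), ((0 : Δ.Blk 0 0), c)) by simp, map_add, ← PreDifferential.d_of₁,
      ← PreDifferential.d_of₁]
    exact Submodule.add_mem _ (d_w1_mem B b) (d_w2_mem B c)
  sq x := by
    obtain ⟨a, b, c⟩ := x
    rw [show (a, (b, c)) = (a, (0 : Δ.Blk 0 0 × Δ.Blk 1 1)) +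
      (((0 : Δ.Blk 0 1), (b, (0 : Δ.Blk 1 1))) +
      ((0 : Δ.Blk 0 1), ((0 : Δ.Blk 0 0), c))) by simp,
      map_add (drozdPre B).δ, map_add (drozdPre B).δ, ← PreDifferential.d_of₀,
      ← PreDifferential.d_of₁, ← PreDifferential.d_of₁, map_add, map_add]
    have h1 := d_d_w12 B a
    have h2 := d_d_w1 B b
    have h3 := d_d_w2 B c
    exact (congrArg₂ (· + ·) h1 (congrArg₂ (· + ·) h2 h3)).trans (by simp)

end Decomp

end Drozd

/-! ## Algebraically equipped posets and their incidence algebras -/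

section Equipped

universe u v w x

/-- A `Q`-multiplicative system `ℛ = {ℛ_{i,j} ⊆ A | i ≤ j}` of `K`-subspaces of a `K`-algebra `A`,
so that `(Q, A, ℛ)` is an algebraically equipped poset.  For convenience `ℛ_{i,j}` is
defined for all pairs, with the convention `ℛ_{i,j} = 0` if `i ≰ j`. -/
structure MultSystem (K : Type u) (A : Type v) (Q : Type w) [Field K] [Ring A] [Algebra K A]
    [PartialOrder Q] where
  /-- the subspaces `ℛ_{i,j}` -/
  R : Q → Q → Submodule K A
  eq_bot : ∀ {i j}, ¬ i ≤ j → R i j = ⊥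
  mul_mem : ∀ {i j l}, i ≤ j → j ≤ l → ∀ {r s : A}, r ∈ R i j → s ∈ R j l → r * s ∈ R i l
  /-- the units `1_i` of the algebras `ℛ_i = ℛ_{i,i}` -/
  one : Q → A
  one_mem : ∀ i, one i ∈ R i i
  one_mul : ∀ {i j}, i ≤ j → ∀ {r : A}, r ∈ R i j → one i * r = r
  mul_one : ∀ {i j}, i ≤ j → ∀ {r : A}, r ∈ R i j → r * one j = r

/-- A ring is a division ring: it is nontrivial and its nonzero elements are invertible. -/
def IsDivRing (D : Type*) [Ring D] : Prop := Nontrivial D ∧ ∀ a : D, a ≠ 0 → IsUnit a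

namespace MultSystem

variable {K : Type u} {A : Type v} {Q : Type w} [Field K] [Ring A] [Algebra K A] [PartialOrder Q]
  (ℛ : MultSystem K A Q)

theorem mul_mem' {i j l : Q} {r s : A} (hr : r ∈ ℛ.R i j) (hs : s ∈ ℛ.R j l) :
    r * s ∈ ℛ.R i l := by
  by_cases h1 : i ≤ j
  · by_cases h2 : j ≤ l
    · exact ℛ.mul_mem h1 h2 hr hs
    · rw [ℛ.eq_bot h2, Submodule.mem_bot] at hs
      rw [hs, mul_zero]; exact Submodule.zero_mem _
  · rw [ℛ.eq_bot h1, Submodule.mem_bot] at hr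
    rw [hr, zero_mul]; exact Submodule.zero_mem _

theorem one_mul' {i j : Q} {r : A} (hr : r ∈ ℛ.R i j) : ℛ.one i * r = r := by
  by_cases h : i ≤ j
  · exact ℛ.one_mul h hr
  · rw [ℛ.eq_bot h, Submodule.mem_bot] at hr; rw [hr, mul_zero]

theorem mul_one' {i j : Q} {r : A} (hr : r ∈ ℛ.R i j) : r * ℛ.one j = r := by
  by_cases h : i ≤ j
  · exact ℛ.mul_one h hr
  · rw [ℛ.eq_bot h, Submodule.mem_bot] at hr; rw [hr, zero_mul]

/-- The algebra `ℛ_i = ℛ_{i,i}`, with unit `1_i`. -/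
def Pt (i : Q) : Type v := ℛ.R i i

/-- `ℛ_i` as a (non unital) subalgebra of `A`. -/
def ptSub (i : Q) : NonUnitalSubalgebra K A :=
  { ℛ.R i i with mul_mem' := fun hr hs => ℛ.mul_mem' hr hs }

instance (i : Q) : NonUnitalRing (ℛ.Pt i) := inferInstanceAs (NonUnitalRing (ℛ.ptSub i))

instance (i : Q) : Ring (ℛ.Pt i) :=
  { (inferInstance : NonUnitalRing (ℛ.Pt i)) with
    one := ⟨ℛ.one i, ℛ.one_mem i⟩
    one_mul := fun a => Subtype.ext (ℛ.one_mul' a.2)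
    mul_one := fun a => Subtype.ext (ℛ.mul_one' a.2) }

/-- The inclusion `ℛ_i ⊆ A`. -/
def Pt.val {ℛ : MultSystem K A Q} {i : Q} (r : ℛ.Pt i) : A := Subtype.val r

/-- An element of the subspace `ℛ_{i,i}` of `A` as an element of the algebra `ℛ_i`. -/
def Pt.mk {ℛ : MultSystem K A Q} {i : Q} (a : A) (h : a ∈ ℛ.R i i) : ℛ.Pt i := ⟨a, h⟩

@[simp] theorem Pt.val_mk {i : Q} (a : A) (h : a ∈ ℛ.R i i) : (Pt.mk (ℛ := ℛ) a h).val = a := rfl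

@[ext] theorem Pt.ext {ℛ : MultSystem K A Q} {i : Q} {r s : ℛ.Pt i} (h : r.val = s.val) : r = s :=
  Subtype.ext h

theorem Pt.val_mem {ℛ : MultSystem K A Q} {i : Q} (r : ℛ.Pt i) : r.val ∈ ℛ.R i i := r.2

@[simp] theorem Pt.val_add {i : Q} (r s : ℛ.Pt i) : (r + s).val = r.val + s.val := rfl

@[simp] theorem Pt.val_mul {i : Q} (r s : ℛ.Pt i) : (r * s).val = r.val * s.val := rfl

@[simp] theorem Pt.val_zero {i : Q} : (0 : ℛ.Pt i).val = 0 := rfl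

@[simp] theorem Pt.val_one {i : Q} : (1 : ℛ.Pt i).val = ℛ.one i := rfl

/-- A choice of elements `v_{0,x} ∈ ℛ_{0,x}` such that `ℛ_{0,x} = ℛ_0 v_{0,x}` is
one-dimensional over `ℛ_0` with basis `v_{0,x}`. -/
structure Gens [OrderBot Q] where
  /-- the elements `v_{0,x}` -/
  v : Q → A
  mem : ∀ y, v y ∈ ℛ.R ⊥ y
  basis : ∀ y, ∀ a ∈ ℛ.R ⊥ y, ∃! r : ℛ.Pt ⊥, a = r.val * v y

namespace Gens

variable {ℛ} [OrderBot Q] (g : ℛ.Gens)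

/-- The coefficient `r ∈ ℛ_0` of `r v_{0,x} ∈ ℛ_{0,x}`. -/
noncomputable def coeff (y : Q) (a : ℛ.R ⊥ y) : ℛ.Pt ⊥ := (g.basis y a a.2).choose

theorem coeff_spec (y : Q) (a : ℛ.R ⊥ y) : (a : A) = (g.coeff y a).val * g.v y :=
  (g.basis y a a.2).choose_spec.1

theorem coeff_unique (y : Q) (a : ℛ.R ⊥ y) (r : ℛ.Pt ⊥) (h : (a : A) = r.val * g.v y) :
    g.coeff y a = r :=
  ((g.basis y a a.2).choose_spec.2 r h).symm

theorem coeff_add (y : Q) (a b : ℛ.R ⊥ y) : g.coeff y (a + b) = g.coeff y a + g.coeff y b := by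
  apply g.coeff_unique
  rw [Submodule.coe_add, Pt.val_add, add_mul, ← g.coeff_spec, ← g.coeff_spec]

theorem coeff_mul (y : Q) (r : ℛ.Pt ⊥) (a : ℛ.R ⊥ y) :
    g.coeff y ⟨r.val * a, ℛ.mul_mem' r.2 a.2⟩ = r * g.coeff y a := by
  apply g.coeff_unique
  rw [Pt.val_mul, mul_assoc, ← g.coeff_spec]

/-- The function `φ_x : ℛ_x → ℛ_0` with `v_{0,x} z = φ_x(z) v_{0,x}`. -/
noncomputable def phi (y : Q) (z : ℛ.Pt y) : ℛ.Pt ⊥ :=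
  g.coeff y ⟨g.v y * z.val, ℛ.mul_mem' (g.mem y) z.2⟩

theorem phi_spec (y : Q) (z : ℛ.Pt y) : (g.phi y z).val * g.v y = g.v y * z.val :=
  (g.coeff_spec y _).symm

/-- The function `χ_{y,x} : ℛ_{y,x} → ℛ_0` with `v_{0,y} r = χ_{y,x}(r) v_{0,x}`. -/
noncomputable def chi (y z : Q) (r : ℛ.R y z) : ℛ.Pt ⊥ :=
  g.coeff z ⟨g.v y * r, ℛ.mul_mem' (g.mem y) r.2⟩

end Gens

variable [Fintype Q]

/-- The matrices `(a_{i,j})` with `a_{i,j} ∈ ℛ_{i,j}`, as a (non unital) subalgebra of the algebra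
of matrices over `A`. -/
def incSub : NonUnitalSubalgebra K (Matrix Q Q A) where
  carrier := {a | ∀ i j, a i j ∈ ℛ.R i j}
  add_mem' ha hb i j := Submodule.add_mem _ (ha i j) (hb i j)
  zero_mem' _ _ := Submodule.zero_mem _
  smul_mem' k _ ha i j := Submodule.smul_mem _ k (ha i j)
  mul_mem' ha hb i l := by
    rw [Matrix.mul_apply]
    exact Submodule.sum_mem _ fun j _ => ℛ.mul_mem' (ha i j) (hb j l)

/-- The incidence algebra `Λ(ℛ) = ⨁_{i ≤ j} e_{i,j} ℛ_{i,j}`. -/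
def Inc : Type (max v w) := ℛ.incSub

instance : NonUnitalRing ℛ.Inc := inferInstanceAs (NonUnitalRing ℛ.incSub)
instance : Module K ℛ.Inc := inferInstanceAs (Module K ℛ.incSub)
instance : IsScalarTower K ℛ.Inc ℛ.Inc := inferInstanceAs (IsScalarTower K ℛ.incSub ℛ.incSub)
instance : SMulCommClass K ℛ.Inc ℛ.Inc := inferInstanceAs (SMulCommClass K ℛ.incSub ℛ.incSub)

variable {ℛ}

/-- The entry of an element of `Λ(ℛ)` at the place `(i, j)`. -/
def Inc.entry (a : ℛ.Inc) (i j : Q) : A := Subtype.val a i j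

theorem Inc.entry_mem (a : ℛ.Inc) (i j : Q) : a.entry i j ∈ ℛ.R i j := a.2 i j

@[ext] theorem Inc.ext {a b : ℛ.Inc} (h : ∀ i j, a.entry i j = b.entry i j) : a = b :=
  Subtype.ext (Matrix.ext h)

theorem Inc.mul_entry (a b : ℛ.Inc) (i l : Q) :
    (a * b).entry i l = ∑ j, a.entry i j * b.entry j l := rfl

theorem Inc.add_entry (a b : ℛ.Inc) (i l : Q) :
    (a + b).entry i l = a.entry i l + b.entry i l := rfl

theorem Inc.sub_entry (a b : ℛ.Inc) (i l : Q) :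
    (a - b).entry i l = a.entry i l - b.entry i l := rfl

theorem Inc.zero_entry (i l : Q) : (0 : ℛ.Inc).entry i l = 0 := rfl

theorem Inc.smul_entry (k : K) (a : ℛ.Inc) (i l : Q) :
    (k • a).entry i l = k • a.entry i l := rfl

theorem Inc.entry_eq_zero (a : ℛ.Inc) {i j : Q} (h : ¬ i ≤ j) : a.entry i j = 0 := by
  have := a.entry_mem i j
  rwa [ℛ.eq_bot h, Submodule.mem_bot] at this

open scoped Classical in
/-- The element of `Λ(ℛ)` with prescribed diagonal `∑ e_{i,i} r_i`. -/
noncomputable def dg (r : ∀ i, ℛ.Pt i) : ℛ.Inc :=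
  ⟨Matrix.diagonal fun i => (r i).val, fun i j => by
    by_cases h : i = j
    · subst h; rw [Matrix.diagonal_apply_eq]; exact (r i).2
    · rw [Matrix.diagonal_apply_ne _ h]; exact Submodule.zero_mem _⟩

theorem dg_entry_self (r : ∀ i, ℛ.Pt i) (i : Q) : (dg r).entry i i = (r i).val := by
  classical
  change Matrix.diagonal (fun i => (r i).val) i i = _
  rw [Matrix.diagonal_apply_eq]

theorem dg_entry_ne (r : ∀ i, ℛ.Pt i) {i j : Q} (h : i ≠ j) : (dg r).entry i j = 0 := by
  classical
  change Matrix.diagonal (fun i => (r i).val) i j = _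
  rw [Matrix.diagonal_apply_ne _ h]

theorem dg_mul_entry (r : ∀ i, ℛ.Pt i) (a : ℛ.Inc) (i l : Q) :
    (dg r * a).entry i l = (r i).val * a.entry i l := by
  rw [Inc.mul_entry, Finset.sum_eq_single i, dg_entry_self]
  · intro j _ h; rw [dg_entry_ne r h.symm, zero_mul]
  · simp

theorem mul_dg_entry (r : ∀ i, ℛ.Pt i) (a : ℛ.Inc) (i l : Q) :
    (a * dg r).entry i l = a.entry i l * (r l).val := by
  rw [Inc.mul_entry, Finset.sum_eq_single l, dg_entry_self]
  · intro j _ h; rw [dg_entry_ne r h, mul_zero]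
  · simp

noncomputable instance : Ring ℛ.Inc :=
  { (inferInstance : NonUnitalRing ℛ.Inc) with
    one := dg fun _ => 1
    one_mul := fun a => Inc.ext fun i j =>
      (dg_mul_entry (fun _ => 1) a i j).trans (ℛ.one_mul' (a.entry_mem i j))
    mul_one := fun a => Inc.ext fun i j =>
      (mul_dg_entry (fun _ => 1) a i j).trans (ℛ.mul_one' (a.entry_mem i j)) }

noncomputable instance : Algebra K ℛ.Inc :=
  Algebra.ofModule (fun r x y => smul_mul_assoc r x y) (fun r x y => mul_smul_comm r x y)

theorem Inc.one_eq : (1 : ℛ.Inc) = dg fun _ => 1 := rfl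

theorem Inc.mul_entry_self (a b : ℛ.Inc) (i : Q) :
    (a * b).entry i i = a.entry i i * b.entry i i := by
  rw [Inc.mul_entry, Finset.sum_eq_single i]
  · intro j _ h
    by_cases h1 : i ≤ j
    · rw [b.entry_eq_zero (fun h2 => h (le_antisymm h2 h1)), mul_zero]
    · rw [a.entry_eq_zero h1, zero_mul]
  · simp

variable (ℛ) in
/-- The subalgebra `S = ∑ e_{i,i} ℛ_i` of `Λ(ℛ)`. -/
noncomputable def diagSub : Subalgebra K ℛ.Inc where
  carrier := {a | ∀ i j, i ≠ j → a.entry i j = 0}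
  mul_mem' {a b} ha hb i l h := by
    rw [Inc.mul_entry]
    refine Finset.sum_eq_zero fun j _ => ?_
    by_cases hj : i = j
    · subst hj; rw [hb i l h, mul_zero]
    · rw [ha i j hj, zero_mul]
  add_mem' {a b} ha hb i j h := by rw [Inc.add_entry, ha i j h, hb i j h, add_zero]
  algebraMap_mem' k i j h := by
    rw [Algebra.algebraMap_eq_smul_one, Inc.smul_entry, Inc.one_eq, dg_entry_ne _ h, smul_zero]

variable (ℛ) in
/-- The decomposition `Λ(ℛ) = S ⊕ J`, where `J = ⨁_{i < j} e_{i,j} ℛ_{i,j}`. -/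
noncomputable def decomp : Decomp K ℛ.Inc where
  S := ℛ.diagSub
  J :=
    { carrier := {a | ∀ i, a.entry i i = 0}
      add_mem' := fun {a b} ha hb i => by rw [Inc.add_entry, ha i, hb i, add_zero]
      zero_mem' := fun i => rfl
      smul_mem' := fun s a ha i => by
        change ((s : ℛ.Inc) * a).entry i i = 0
        rw [Inc.mul_entry_self, ha i, mul_zero] }
  mul_left a j hj i := by rw [Inc.mul_entry_self, hj i, mul_zero]
  mul_right {j} a hj i := by rw [Inc.mul_entry_self, hj i, zero_mul]
  isCompl := by
    rw [isCompl_iff, disjoint_iff, codisjoint_iff]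
    constructor
    · rw [eq_bot_iff]
      rintro a ⟨h1, h2⟩
      rw [Submodule.mem_bot]
      refine Inc.ext fun i j => ?_
      by_cases h : i = j
      · subst h; exact h2 i
      · exact h1 i j h
    · rw [eq_top_iff]
      intro a _
      set b : ℛ.Inc := dg (fun i => Pt.mk (a.entry i i) (a.entry_mem i i)) with hb
      rw [← add_sub_cancel b a]
      refine Submodule.add_mem_sup (fun i j hij => dg_entry_ne _ hij) (fun i => ?_)
      rw [Inc.sub_entry, hb, dg_entry_self, Pt.val_mk, sub_self]

open scoped Classical in
/-- The element `e_{i,i} r` of `S`, for `r ∈ ℛ_i`. -/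
noncomputable def eS (i : Q) (r : ℛ.Pt i) : ℛ.decomp.S :=
  ⟨dg (Pi.single i r), show ∀ j l, j ≠ l → (dg (Pi.single i r)).entry j l = 0 from
    fun _ _ h => dg_entry_ne _ h⟩

theorem eS_entry_self (i : Q) (r : ℛ.Pt i) : (eS i r : ℛ.Inc).entry i i = r.val := by
  classical
  refine (dg_entry_self _ i).trans ?_
  rw [Pi.single_eq_same]

theorem eS_entry_of_ne (i : Q) (r : ℛ.Pt i) {j l : Q} (h : j ≠ i) :
    (eS i r : ℛ.Inc).entry j l = 0 := by
  by_cases hl : j = l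
  · subst hl
    classical
    refine (dg_entry_self _ j).trans ?_
    rw [Pi.single_eq_of_ne h, Pt.val_zero]
  · exact (eS i r).2 j l hl

theorem diag_ext {s t : ℛ.decomp.S} (h : ∀ i, (s : ℛ.Inc).entry i i = (t : ℛ.Inc).entry i i) :
    s = t := by
  refine Subtype.ext (Inc.ext fun i j => ?_)
  by_cases hij : i = j
  · subst hij; exact h i
  · exact (s.2 i j hij).trans (t.2 i j hij).symm

theorem diag_mul_entry (s : ℛ.decomp.S) (a : ℛ.Inc) (i j : Q) :
    ((s : ℛ.Inc) * a).entry i j = (s : ℛ.Inc).entry i i * a.entry i j := by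
  rw [Inc.mul_entry, Finset.sum_eq_single i]
  · intro l _ h; rw [show (s : ℛ.Inc).entry i l = 0 from s.2 i l h.symm, zero_mul]
  · simp

theorem mul_diag_entry (a : ℛ.Inc) (s : ℛ.decomp.S) (i j : Q) :
    (a * (s : ℛ.Inc)).entry i j = a.entry i j * (s : ℛ.Inc).entry j j := by
  rw [Inc.mul_entry, Finset.sum_eq_single j]
  · intro l _ h; rw [show (s : ℛ.Inc).entry l j = 0 from s.2 l j h, mul_zero]
  · simp

theorem eS_add (i : Q) (r s : ℛ.Pt i) : eS i (r + s) = eS i r + eS i s := by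
  refine diag_ext fun j => ?_
  rw [Subalgebra.coe_add, Inc.add_entry]
  by_cases h : j = i
  · subst h; simp only [eS_entry_self, Pt.val_add]
  · simp only [eS_entry_of_ne i _ h, add_zero]

theorem eS_mul (i : Q) (r s : ℛ.Pt i) : eS i (r * s) = eS i r * eS i s := by
  refine diag_ext fun j => ?_
  rw [Subalgebra.coe_mul, diag_mul_entry]
  by_cases h : j = i
  · subst h; simp only [eS_entry_self, Pt.val_mul]
  · simp only [eS_entry_of_ne i _ h, mul_zero]

/-! ### The category `mod 𝒟ᵉ` -/

variable [OrderBot Q]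

variable (ℛ) in
/-- The idempotent `e = w₁ (1 - e₀) + w₂ e₀` of `R`. -/
noncomputable def idemE : ℛ.decomp.RR := ![1 - eS ⊥ 1, eS ⊥ 1]

/-- The objects of `mod 𝒟ᵉ`, the full subcategory of `Mod 𝒟` (where `𝒟` is the Drozd ditalgebra of
`Λ(ℛ) = S ⊕ J`) whose objects are the `M` with `M (1 - e) = 0` that are of finite dimension
over `K`. -/
structure ModDe (B : ℛ.decomp.DualBasis) : Type (max u v w (x + 1)) where
  /-- the underlying object of `Mod 𝒟` -/
  M : Ditalgebra.Rep.{u, max v w, max v w, max v w, x} (Decomp.drozd B)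
  finite : Module.Finite K M.V
  killed : ∀ m : M.V, Ditalgebra.Rep.actR m (1 - ℛ.idemE) = 0

namespace ModDe

variable {B : ℛ.decomp.DualBasis}

/-- Isomorphism in `mod 𝒟ᵉ` (a full subcategory of `Mod 𝒟`). -/
def Iso (M N : ModDe.{u, v, w, x} B) : Prop := M.M.Iso N.M

open scoped Classical in
variable (ℛ) in
/-- The element `w₁ e_x r` of `R` if `x > 0`, and `w₂ e_0 r` if `x = 0`. -/
noncomputable def eR (y : Q) (r : ℛ.Pt y) : ℛ.decomp.RR :=
  if y = ⊥ then ![0, eS y r] else ![eS y r, 0]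

variable (M : ModDe.{u, v, w, x} B)

/-- `M_x = M w₁ e_x` for `x > 0`, and `M_0 = M w₂ e_0`. -/
def comp (y : Q) : Set M.M.V := Set.range fun m : M.M.V => Ditalgebra.Rep.actR m (eR ℛ y 1)

/-- The right action of `ℛ_x` on `M_x`. -/
noncomputable def ract (y : Q) (m : M.M.V) (r : ℛ.Pt y) : M.M.V :=
  Ditalgebra.Rep.actR m (eR ℛ y r)

/-- A local basis of `M`: an `ℛ_x`-basis of the right `ℛ_x`-module `M_x`, for each `x`. -/
structure LocalBasis where
  /-- the dimension vector `d` -/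
  dim : Q → ℕ
  /-- the basis of `M_x` -/
  vec : ∀ y, Fin (dim y) → M.M.V
  mem : ∀ y i, vec y i ∈ M.comp y
  basis : ∀ y, ∀ m ∈ M.comp y, ∃! c : Fin (dim y) → ℛ.Pt y, m = ∑ i, M.ract y (vec y i) (c i)

variable {M} in
/-- The coordinates of an element of `M_x`. -/
noncomputable def LocalBasis.coord (b : M.LocalBasis) (y : Q) (m : M.comp y) :
    Fin (b.dim y) → ℛ.Pt y := (b.basis y m m.2).choose

end ModDe

namespace Gens

variable (g : ℛ.Gens)

/-- The element `û_{0,x}` of `*J` dual to `u_{0,x} = e_{0,x} v_{0,x}`: it takes the value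
`e_{0,0} r` at `e_{0,x} r v_{0,x}`, and vanishes at `e_{i,j} a` if `(i, j) ≠ (0, x)`. -/
noncomputable def uhat (y : Q) : ℛ.decomp.LDual :=
  ({ toFun := fun j => eS ⊥ (g.coeff y ⟨Inc.entry (j : ℛ.Inc) ⊥ y, Inc.entry_mem _ _ _⟩)
     map_add' := fun i j => by
       rw [← eS_add, ← g.coeff_add]; rfl
     map_smul' := fun s j => by
       rw [RingHom.id_apply, smul_eq_mul]
       refine diag_ext fun i => ?_
       rw [Subalgebra.coe_mul, diag_mul_entry]
       by_cases h : i = ⊥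
       · subst h
         have h1 : (⟨Inc.entry ((s • j : ℛ.decomp.J) : ℛ.Inc) ⊥ y, Inc.entry_mem _ _ _⟩ :
             ℛ.R ⊥ y) = ⟨(Pt.mk (ℛ := ℛ) ((s : ℛ.Inc).entry ⊥ ⊥) (Inc.entry_mem _ _ _)).val *
               Inc.entry (j : ℛ.Inc) ⊥ y, ℛ.mul_mem' (Inc.entry_mem _ _ _) (Inc.entry_mem _ _ _)⟩ :=
           Subtype.ext (diag_mul_entry s j ⊥ y)
         rw [h1, eS_entry_self, eS_entry_self]
         exact congrArg Pt.val (g.coeff_mul y (Pt.mk ((s : ℛ.Inc).entry ⊥ ⊥)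
           (Inc.entry_mem _ _ _)) ⟨Inc.entry (j : ℛ.Inc) ⊥ y, Inc.entry_mem _ _ _⟩)
       · rw [eS_entry_of_ne _ _ h, eS_entry_of_ne _ _ h, mul_zero] } : ℛ.decomp.J →ₗ[ℛ.decomp.S] ℛ.decomp.S)

/-- The defining property of `φ_x` in terms of `û_{0,x}`: `z û_{0,x} = û_{0,x} φ_x(z)`. -/
theorem smul_uhat (y : Q) (z : ℛ.Pt y) :
    ((eS y z : ℛ.decomp.S) : ℛ.Inc) • g.uhat y = op (eS ⊥ (g.phi y z)) • g.uhat y := by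
  refine Decomp.LDual.ext fun j => ?_
  rw [Decomp.LDual.smul_ev, Decomp.LDual.op_smul_ev]
  change eS ⊥ (g.coeff y _) = eS ⊥ (g.coeff y _) * eS ⊥ (g.phi y z)
  rw [← eS_mul]
  congr 1
  apply g.coeff_unique
  rw [Pt.val_mul, mul_assoc, g.phi_spec, ← mul_assoc, ← g.coeff_spec]
  change Inc.entry ((j : ℛ.Inc) * ((eS y z : ℛ.decomp.S) : ℛ.Inc)) ⊥ y = _
  rw [mul_diag_entry, eS_entry_self]

theorem act_uhat_mem {B : ℛ.decomp.DualBasis} (M : ModDe.{u, v, w, x} B) (y : Q) (m : M.M.V) :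
    Ditalgebra.Rep.act₀ m (show ℛ.decomp.Blk 0 1 from g.uhat y) ∈ M.comp ⊥ := by
  refine ⟨Ditalgebra.Rep.act₀ m (show ℛ.decomp.Blk 0 1 from g.uhat y), ?_⟩
  have h1 : op (eS ⊥ (1 : ℛ.Pt ⊥)) • g.uhat y = g.uhat y := by
    refine Decomp.LDual.ext fun j => ?_
    rw [Decomp.LDual.op_smul_ev]
    change eS ⊥ (g.coeff y _) * eS ⊥ 1 = eS ⊥ (g.coeff y _)
    rw [← eS_mul]
    exact congrArg (eS ⊥) (_root_.mul_one _)
  have h2 := Decomp.w12_right (ModDe.eR ℛ ⊥ 1) (g.uhat y)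
  rw [show ModDe.eR ℛ ⊥ 1 1 = eS ⊥ (1 : ℛ.Pt ⊥) by simp [ModDe.eR], h1] at h2
  change op _ • op _ • m = op _ • m
  rw [← mul_smul, ← MulOpposite.op_mul]
  congr 2
  exact Subtype.ext h2.symm

end Gens

namespace ModDe

variable {B : ℛ.decomp.DualBasis} {M : ModDe.{u, v, w, x} B}

/-- The matrix `ℳ(M)_x = (g_{j,i})` over `ℛ_0`, where
`m_i^x w_{1,2} û_{0,x} = ∑_j m_j^0 g_{j,i}`. -/
noncomputable def LocalBasis.matrix (b : M.LocalBasis) (g : ℛ.Gens) (y : Q) :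
    Matrix (Fin (b.dim ⊥)) (Fin (b.dim y)) (ℛ.Pt ⊥) :=
  Matrix.of fun j i => b.coord ⊥
    ⟨Ditalgebra.Rep.act₀ (b.vec y i) (show ℛ.decomp.Blk 0 1 from g.uhat y),
      g.act_uhat_mem M y _⟩ j

end ModDe

end MultSystem

variable {Q : Type w} [PartialOrder Q] [Fintype Q] [OrderBot Q] in
/-- The points `y` with `0 < y < x`. -/
noncomputable def below (z : Q) : Finset Q := (Set.toFinite {y : Q | ⊥ < y ∧ y < z}).toFinset

/-! ## `p`-equipped posets -/

/-- A `p`-equipped poset: every relation `x ≤ y` carries a value `ℓ = lev x y ∈ {1, …, p}`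
(written `x ≤^ℓ y`), such that `x ≤^ℓ y ≤^m z` and `x ≤^n z` imply `n ≥ min (ℓ + m - 1) p`. -/
structure PEquipped (p : ℕ) (P : Type w) [PartialOrder P] where
  /-- the value of a relation (irrelevant for unrelated pairs) -/
  lev : P → P → ℕ
  one_le : ∀ {x y}, x ≤ y → 1 ≤ lev x y
  le_p : ∀ {x y}, x ≤ y → lev x y ≤ p
  comp : ∀ {x y z}, x ≤ y → y ≤ z → min (lev x y + lev y z - 1) p ≤ lev x z

namespace PEquipped

variable {p : ℕ} {P : Type w} [PartialOrder P]

/-- The values of the relations of the poset obtained by adding a maximal point and a minimal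
point: all the relations which involve one of the new points are strong. -/
def extLev (E : PEquipped p P) : WithBot (WithTop P) → WithBot (WithTop P) → ℕ
  | ((x : P) : WithTop P), ((y : P) : WithTop P) => E.lev x y
  | _, _ => p

theorem extLev_cases (E : PEquipped p P) (x y : WithBot (WithTop P)) :
    (∃ a b : P, x = ((a : WithTop P) : WithBot (WithTop P)) ∧
      y = ((b : WithTop P) : WithBot (WithTop P))) ∨ E.extLev x y = p := by
  rcases x with _ | _ | x
  · exact Or.inr rfl
  · exact Or.inr rfl
  · rcases y with _ | _ | y
    · exact Or.inr rfl
    · exact Or.inr rfl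
    · exact Or.inl ⟨x, y, rfl, rfl⟩

/-- The `p`-equipped poset obtained by adding a maximal point and a minimal point; all the
relations which involve one of the new points are strong. -/
def extend (hp : 1 ≤ p) (E : PEquipped p P) : PEquipped p (WithBot (WithTop P)) where
  lev := E.extLev
  one_le {x y} h := by
    rcases E.extLev_cases x y with ⟨a, b, rfl, rfl⟩ | h1
    · exact E.one_le (WithTop.coe_le_coe.mp (WithBot.coe_le_coe.mp h))
    · rw [h1]; exact hp
  le_p {x y} h := by
    rcases E.extLev_cases x y with ⟨a, b, rfl, rfl⟩ | h1
    · exact E.le_p (WithTop.coe_le_coe.mp (WithBot.coe_le_coe.mp h))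
    · rw [h1]
  comp {x y z} h h2 := by
    rcases E.extLev_cases x z with ⟨a, b, rfl, rfl⟩ | h1
    · rcases y with _ | _ | y
      · exact absurd (le_bot_iff.mp h) WithBot.coe_ne_bot
      · exact absurd (top_le_iff.mp (WithBot.coe_le_coe.mp h2)) WithTop.coe_ne_top
      · exact E.comp (WithTop.coe_le_coe.mp (WithBot.coe_le_coe.mp h))
          (WithTop.coe_le_coe.mp (WithBot.coe_le_coe.mp h2))
    · rw [h1]; exact min_le_right _ _

theorem extend_lev_bot (hp : 1 ≤ p) (E : PEquipped p P) (y : WithBot (WithTop P)) :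
    (E.extend hp).lev ⊥ y = p := rfl

variable {F : Type u} {G : Type v} [Field F] [Field G] [Algebra F G]

/-- The `F`-subspace `F⟨1, ξ, …, ξ^{ℓ-1}⟩` of `G`. -/
def powSpan (F : Type u) {G : Type v} [Field F] [Field G] [Algebra F G] (ξ : G) (l : ℕ) :
    Submodule F G := Submodule.span F {a | ∃ i < l, a = ξ ^ i}

theorem powSpan_top (ξ : G) (hfin : Module.finrank F G = p) (hp : 1 ≤ p)
    (hξ : IntermediateField.adjoin F {ξ} = ⊤) : powSpan F ξ p = ⊤ := by
  have hf : FiniteDimensional F G := Module.finite_of_finrank_pos (by omega)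
  have hi : IsIntegral F ξ := IsIntegral.of_finite F ξ
  have hd : (minpoly F ξ).natDegree = p := by
    rw [← IntermediateField.adjoin.finrank hi, hξ, IntermediateField.finrank_top', hfin]
  rw [eq_top_iff]
  intro y _
  have hy : y ∈ (IntermediateField.adjoin F {ξ}).toSubalgebra := by rw [hξ]; trivial
  rw [IntermediateField.adjoin_simple_toSubalgebra_of_isAlgebraic hi.isAlgebraic,
    Algebra.adjoin_singleton_eq_range_aeval] at hy
  obtain ⟨f, rfl⟩ := hy
  have hm := minpoly.monic hi
  have h1 : Polynomial.aeval ξ f = Polynomial.aeval ξ (f %ₘ minpoly F ξ) := by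
    conv_lhs => rw [← Polynomial.modByMonic_add_div f (minpoly F ξ)]
    rw [map_add, map_mul, minpoly.aeval, zero_mul, add_zero]
  change Polynomial.aeval ξ f ∈ _
  have h2 : (f %ₘ minpoly F ξ).natDegree < p := by
    rw [← hd]
    refine Polynomial.natDegree_modByMonic_lt f hm fun h => ?_
    rw [h, Polynomial.natDegree_one] at hd
    omega
  rw [h1, Polynomial.aeval_eq_sum_range' h2]
  exact Submodule.sum_mem _ fun i hi => Submodule.smul_mem _ _
    (Submodule.subset_span ⟨i, Finset.mem_range.mp hi, rfl⟩)

theorem powSpan_mono (ξ : G) {a b : ℕ} (h : a ≤ b) : powSpan F ξ a ≤ powSpan F ξ b :=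
  Submodule.span_mono fun _ ⟨i, hi, e⟩ => ⟨i, lt_of_lt_of_le hi h, e⟩

theorem one_mem_powSpan (ξ : G) {a : ℕ} (h : 1 ≤ a) : (1 : G) ∈ powSpan F ξ a :=
  Submodule.subset_span ⟨0, h, (pow_zero ξ).symm⟩

theorem mul_mem_powSpan (ξ : G) {a b : ℕ} {r s : G} (hr : r ∈ powSpan F ξ a)
    (hs : s ∈ powSpan F ξ b) : r * s ∈ powSpan F ξ (a + b - 1) := by
  have h := Submodule.mul_mem_mul hr hs
  rw [powSpan, powSpan, Submodule.span_mul_span] at h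
  refine Submodule.span_mono ?_ h
  rintro _ ⟨_, ⟨i, hi, rfl⟩, _, ⟨j, hj, rfl⟩, rfl⟩
  exact ⟨i + j, by omega, (pow_add ξ i j).symm⟩

open scoped Classical in
/-- The multiplicative system `𝒬_{x,y} = F⟨1, ξ, …, ξ^{ℓ-1}⟩`, for `x ≤^ℓ y`, over `G = F(ξ)`. -/
noncomputable def system (E : PEquipped p P) (ξ : G) (hfin : Module.finrank F G = p) (hp : 1 ≤ p)
    (hξ : IntermediateField.adjoin F {ξ} = ⊤) : MultSystem F G P where
  R x y := if x ≤ y then powSpan F ξ (E.lev x y) else ⊥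
  eq_bot h := if_neg h
  mul_mem {x y z} hxy hyz r s hr hs := by
    rw [if_pos hxy] at hr
    rw [if_pos hyz] at hs
    rw [if_pos (hxy.trans hyz)]
    have h := mul_mem_powSpan ξ hr hs
    have hc := E.comp hxy hyz
    rcases le_total (E.lev x y + E.lev y z - 1) p with h1 | h1
    · rw [min_eq_left h1] at hc; exact powSpan_mono ξ hc h
    · rw [min_eq_right h1] at hc
      refine powSpan_mono ξ hc ?_
      rw [powSpan_top ξ hfin hp hξ]; trivial
  one _ := 1
  one_mem x := by
    rw [if_pos le_rfl]; exact one_mem_powSpan ξ (E.one_le le_rfl)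
  one_mul _ _ _ := one_mul _
  mul_one _ _ _ := mul_one _

theorem system_R (E : PEquipped p P) (ξ : G) (hfin : Module.finrank F G = p) (hp : 1 ≤ p)
    (hξ : IntermediateField.adjoin F {ξ} = ⊤) {x y : P} (h : x ≤ y) :
    (E.system ξ hfin hp hξ).R x y = powSpan F ξ (E.lev x y) := if_pos h

theorem system_R_bot (E : PEquipped p P) (ξ : G) (hfin : Module.finrank F G = p) (hp : 1 ≤ p)
    (hξ : IntermediateField.adjoin F {ξ} = ⊤) (y : WithBot (WithTop P)) :
    ((E.extend hp).system ξ hfin hp hξ).R ⊥ y = ⊤ := by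
  rw [system_R _ _ _ _ _ bot_le, extend_lev_bot, powSpan_top ξ hfin hp hξ]

/-- The choice `v_{0,x} = 1` for the system of the extended poset. -/
noncomputable def gens (E : PEquipped p P) (ξ : G) (hfin : Module.finrank F G = p)
    (hp : 1 ≤ p) (hξ : IntermediateField.adjoin F {ξ} = ⊤) :
    ((E.extend hp).system ξ hfin hp hξ).Gens where
  v _ := 1
  mem y := by rw [system_R_bot]; trivial
  basis y a _ := by
    refine ⟨MultSystem.Pt.mk a ?_, (mul_one a).symm, fun r hr =>
      MultSystem.Pt.ext ((mul_one _).symm.trans hr.symm)⟩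
    rw [system_R_bot]; trivial

end PEquipped

end Equipped

end EqPoset

universe u v w x

set_option linter.unusedSectionVars false

/-! The proof is a dictionary between `mod 𝒟ᵉ` and matrices over `Λ = S ⊕ J`. Because `J` has a
finite dual basis over `S`, a right `S`-linear map `*J → S` is evaluation at a unique element of `J`
(`DualBasis.ev_sum_smul`, `DualBasis.ext_ev`). Hence, in local bases, the action of `w_{1,2} *J` on
an object is a matrix over `J` (`jmat`), and a morphism `(f⁰, f¹)` is a matrix `X` over `Λ`
(`homM`): the `S`-part of `X` records `f⁰`, and applying `γ` to its `J`-part gives `f¹(w₁ γ)`.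

One matrix suffices because of the idempotent `e`. As `0` is least, `J e₀ = 0`. On an object killed
by `1 - e` the algebra `R` acts through `S` (`actR_eq`), every `f¹(w₂ γ)` vanishes
(`homW2_eq_zero`), and `jmat` is concentrated in the rows over the point `0`. The compatibility
condition for `(f⁰, f¹)` then says exactly that `X` intertwines the matrices of `M` and `N`
(`jmat_mul_homM`, `act_matHom₀`), and `Y X = 1` makes the corresponding composite the identity
(`matHom₀_matHom₀`, `matHom₁_comp`).

Reading the intertwining relation at the place `(0, x)` and moving each `v_{0,y}` past an entry of
`X` produces `φ_x` and `χ_{y,x}`: `X_{00} ℳ(M)_x = ℳ(N)_x φ_x(X_{xx}) + ∑ ℳ(N)_y χ_{y,x}(X_{yx})`.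
So `T_x = X_{xx}`, `T_{yx} = X_{yx}` and `T_0 = X_{00}⁻¹` (`gmat_eq`, with converse `jmat_mul_eq`).
In the converse direction the blocks are assembled into a matrix over `Λ`, which is invertible
because its diagonal blocks are and `J` is nilpotent (`isUnit_blockM`). The equality of the
dimensions follows from the invariant basis number of division rings.

A preliminary step, valid for every ditalgebra, is that morphisms and composites may be specified
and checked on the generators in `W` (`Hom.ofGen`, `Hom.isComp_of_gen`). For this, `M ⊕ N` and `M ⊕
N ⊕ L` are turned into right `T_R(W)`-modules on which `W₁` acts by strictly triangular maps; the
required extensions are read off as matrix entries of these actions.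

For the corollary, `v_{0,x} = 1` turns `φ_x` and `χ_{y,x}` into inclusions in `G`, and each `𝒬_x` is
either `G` or `F`. -/

namespace EqPoset

/-! ### Morphisms of representations of a ditalgebra, described on generators -/

section Dit

universe w'

variable {K : Type u} {R : Type v} {W₀ : Type w} {W₁ : Type w'} [Field K] [Ring R] [Algebra K R]
    [AddCommGroup W₀] [Module R W₀] [Module Rᵐᵒᵖ W₀]
    [AddCommGroup W₁] [Module R W₁] [Module Rᵐᵒᵖ W₁]

namespace GrTensor

/-- An element of `R` as an element of degree zero. -/
noncomputable def degR (r : R) : degZero K R W₀ W₁ := ⟨TensorAlg.ofR K R (W₀ × W₁) r, ofR_mem r⟩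

/-- A generator of degree zero as an element of the algebra of elements of degree zero. -/
noncomputable def degW (y : W₀) : degZero K R W₀ W₁ := ⟨of₀ K R W₀ W₁ y, of₀_mem y⟩

variable (K R W₀ W₁) in
/-- `R → T_R(W)_0` as a ring morphism. -/
noncomputable def degRHom : R →+* degZero K R W₀ W₁ where
  toFun := degR
  map_one' := Subtype.ext (map_one (TensorAlg.ofR K R (W₀ × W₁)))
  map_zero' := Subtype.ext (map_zero (TensorAlg.ofR K R (W₀ × W₁)))
  map_mul' _ _ := Subtype.ext (map_mul (TensorAlg.ofR K R (W₀ × W₁)) _ _)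
  map_add' _ _ := Subtype.ext (map_add (TensorAlg.ofR K R (W₀ × W₁)) _ _)

theorem degW_add (y z : W₀) :
    degW (K := K) (R := R) (W₁ := W₁) (y + z) = degW y + degW z := Subtype.ext (map_add _ _ _)

theorem degR_mul_degW (r : R) (y : W₀) :
    degR r * degW y = degW (K := K) (R := R) (W₁ := W₁) (r • y) := by
  refine Subtype.ext ?_
  have h := TensorAlg.ofW_left (K := K) r ((y, 0) : W₀ × W₁)
  rw [Prod.smul_mk, smul_zero] at h
  exact h.symm

theorem degW_mul_degR (r : R) (y : W₀) :
    degW y * degR r = degW (K := K) (R := R) (W₁ := W₁) (op r • y) := by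
  refine Subtype.ext ?_
  have h := TensorAlg.ofW_right (K := K) ((y, 0) : W₀ × W₁) r
  rw [Prod.smul_mk, smul_zero] at h
  exact h.symm

theorem of₁_smul (r : R) (y : W₁) :
    of₁ K R W₀ W₁ (r • y) = TensorAlg.ofR K R (W₀ × W₁) r * of₁ K R W₀ W₁ y := by
  have h := TensorAlg.ofW_left (K := K) r ((0, y) : W₀ × W₁)
  rw [Prod.smul_mk, smul_zero] at h
  exact h

theorem of₁_op_smul (r : R) (y : W₁) :
    of₁ K R W₀ W₁ (op r • y) = of₁ K R W₀ W₁ y * TensorAlg.ofR K R (W₀ × W₁) r := by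
  have h := TensorAlg.ofW_right (K := K) ((0, y) : W₀ × W₁) r
  rw [Prod.smul_mk, smul_zero] at h
  exact h

/-- Induction on the elements of degree one. -/
theorem deg_one_induction {p : GrTensor K R W₀ W₁ → Prop}
    (gen : ∀ (a b : degZero K R W₀ W₁) (y : W₁), p (a * of₁ K R W₀ W₁ y * b))
    (zero : p 0) (smul : ∀ (k : K) s, p s → p (k • s))
    (add : ∀ s t, p s → p t → p (s + t)) {t : GrTensor K R W₀ W₁}
    (ht : t ∈ deg K R W₀ W₁ 1) : p t := by
  -- The middle factor of a product of degree one lies only in the span of the generators, so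
  -- linearity is used before a single generator is available.
  have key : ∀ (x : GrTensor K R W₀ W₁), x ∈ Submodule.span K (Set.range (of₁ K R W₀ W₁)) →
      ∀ (a b : degZero K R W₀ W₁), p (a * x * b) := by
    intro x hx a b
    induction hx using Submodule.span_induction with
    | mem x hx => obtain ⟨y, rfl⟩ := hx; exact gen a b y
    | zero => rw [mul_zero, zero_mul]; exact zero
    | add x y _ _ hx hy => rw [mul_add, add_mul]; exact add _ _ hx hy
    | smul k x _ hx => rw [mul_smul_comm, smul_mul_assoc]; exact smul k _ hx
  change t ∈ Subalgebra.toSubmodule (degZero K R W₀ W₁) * _ * _ at ht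
  induction ht using Submodule.mul_induction_on' with
  | mem_mul_mem x hx b hb =>
    induction hx using Submodule.mul_induction_on' with
    | mem_mul_mem a ha y hy => exact key y hy ⟨a, ha⟩ ⟨b, hb⟩
    | add x₁ _ x₂ _ h₁ h₂ => rw [add_mul]; exact add _ _ h₁ h₂
  | add x₁ _ x₂ _ h₁ h₂ => exact add _ _ h₁ h₂

/-! ### Extending a right module over the degree-zero part to the whole tensor algebra -/

section extend

variable {V : Type x} [AddCommGroup V] [Module K V] [Module (degZero K R W₀ W₁)ᵐᵒᵖ V]
  [IsScalarTower K (degZero K R W₀ W₁)ᵐᵒᵖ V]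

variable (V) in
/-- The action of `T_R(W)_0` on a right module, as a representation. -/
noncomputable def degZeroRep : degZero K R W₀ W₁ →ₐ[K] (Module.End K V)ᵐᵒᵖ where
  toFun a := op (Algebra.lsmul K K V (op a))
  map_one' := by rw [MulOpposite.op_one, map_one]; rfl
  map_zero' := by rw [MulOpposite.op_zero, map_zero]; rfl
  map_mul' a b := by rw [MulOpposite.op_mul, map_mul]; rfl
  map_add' a b := by rw [MulOpposite.op_add, map_add]; rfl
  commutes' k := congrArg op (AlgHom.commutes (Algebra.lsmul K K V) k)

variable (V) in
/-- The right action of `R`, as a representation. -/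
noncomputable def degRRep : R →ₐ[K] (Module.End K V)ᵐᵒᵖ :=
  (degZeroRep (K := K) (R := R) (W₀ := W₀) (W₁ := W₁) V).comp
    { degRHom K R W₀ W₁ with
      commutes' := fun k => Subtype.ext (AlgHom.commutes (TensorAlg.ofR K R (W₀ × W₁)) k) }

/-- The action of the generators in `W`. -/
noncomputable def genRep (F : W₁ →+ Module.End K V) : W₀ × W₁ →+ (Module.End K V)ᵐᵒᵖ :=
  AddMonoidHom.mk' (fun y => degZeroRep (K := K) (R := R) (W₀ := W₀) (W₁ := W₁) V (degW y.1) +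
    op (F y.2)) (fun y z => by
      rw [Prod.fst_add, Prod.snd_add, degW_add, map_add, map_add, MulOpposite.op_add]; abel)

/-- Extension of a right action of `T_R(W)_0` to an action of `T_R(W)`. -/
noncomputable def extendAct (F : W₁ →+ Module.End K V)
    (hl : ∀ (r : R) (y : W₁) (m : V), F (r • y) m =
      F y (op (degR r : degZero K R W₀ W₁) • m))
    (hr : ∀ (r : R) (y : W₁) (m : V), F (op r • y) m =
      op (degR r : degZero K R W₀ W₁) • F y m) :
    GrTensor K R W₀ W₁ →ₐ[K] (Module.End K V)ᵐᵒᵖ :=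
  TensorAlg.lift (degRRep (K := K) (R := R) (W₀ := W₀) (W₁ := W₁) V)
    (genRep (K := K) (R := R) (W₀ := W₀) (W₁ := W₁) F)
    (fun r y => by
      have h : op (F (r • y.2)) = degZeroRep (K := K) (R := R) (W₀ := W₀) (W₁ := W₁) V (degR r) *
          op (F y.2) := congrArg op (LinearMap.ext fun m => hl r y.2 m)
      change degZeroRep V (degW (r • y.1)) + op (F (r • y.2)) =
        degZeroRep V (degR r) * (degZeroRep V (degW y.1) + op (F y.2))
      rw [← degR_mul_degW, map_mul, mul_add, h])
    (fun y r => by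
      have h : op (F (op r • y.2)) = op (F y.2) *
          degZeroRep (K := K) (R := R) (W₀ := W₀) (W₁ := W₁) V (degR r) :=
        congrArg op (LinearMap.ext fun m => hr r y.2 m)
      change degZeroRep V (degW (op r • y.1)) + op (F (op r • y.2)) =
        (degZeroRep V (degW y.1) + op (F y.2)) * degZeroRep V (degR r)
      rw [← degW_mul_degR, map_mul, add_mul, h])

variable {F : W₁ →+ Module.End K V}
    {hl : ∀ (r : R) (y : W₁) (m : V), F (r • y) m =
      F y (op (degR r : degZero K R W₀ W₁) • m)}
    {hr : ∀ (r : R) (y : W₁) (m : V), F (op r • y) m =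
      op (degR r : degZero K R W₀ W₁) • F y m}

theorem extendAct_of₁ (y : W₁) : extendAct F hl hr (of₁ K R W₀ W₁ y) = op (F y) := by
  refine (TensorAlg.lift_ofW _ _ _ _ _).trans ?_
  change degZeroRep V (degW (0 : W₀)) + op (F y) = _
  have h : degW (K := K) (R := R) (W₁ := W₁) (0 : W₀) = 0 :=
    Subtype.ext (map_zero (of₀ K R W₀ W₁))
  rw [h, map_zero, zero_add]

theorem extendAct_degZero {a : GrTensor K R W₀ W₁} (ha : a ∈ degZero K R W₀ W₁) :
    extendAct F hl hr a = degZeroRep V ⟨a, ha⟩ := by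
  induction ha using Algebra.adjoin_induction with
  | mem y hy =>
    rcases hy with ⟨r, rfl⟩ | ⟨y, rfl⟩
    · exact TensorAlg.lift_ofR _ _ _ _ _
    · refine (TensorAlg.lift_ofW _ _ _ _ _).trans ?_
      change degZeroRep V (degW y) + op (F 0) = _
      rw [map_zero, MulOpposite.op_zero, add_zero]; rfl
  | algebraMap k =>
    rw [AlgHom.commutes]
    exact (AlgHom.commutes (degZeroRep V) k).symm
  | add y z hy hz h1 h2 => rw [map_add, h1, h2, ← map_add]; rfl
  | mul y z hy hz h1 h2 => rw [map_mul, h1, h2, ← map_mul]; rfl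

theorem extendAct_mul (s t : GrTensor K R W₀ W₁) (m : V) :
    (extendAct F hl hr (s * t)).unop m =
      (extendAct F hl hr t).unop ((extendAct F hl hr s).unop m) := by
  rw [map_mul]; rfl

theorem extendAct_coe (a : degZero K R W₀ W₁) (m : V) :
    (extendAct F hl hr a).unop m = op a • m := by
  rw [extendAct_degZero a.2]; rfl

end extend

end GrTensor

namespace Ditalgebra

open GrTensor

variable {D : Ditalgebra K R W₀ W₁}

/-! ### Constructing a morphism from its values on generators -/

section ofGen

variable {M N : Rep.{u, v, w, w', x} D} (F : W₁ →+ (M.V →ₗ[K] N.V))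
  (hl : ∀ (r : R) (y : W₁) (m : M.V), F (r • y) m = F y (Rep.actR m r))
  (hr : ∀ (r : R) (y : W₁) (m : M.V), F (op r • y) m = Rep.actR (F y m) r)

/-- The extension of a morphism of `R`-bimodules `W₁ → Hom_K(M, N)` to `T_R(W)`, which on the
elements of degree one is a morphism of `T_R(W)_0`-bimodules. -/
noncomputable def bimodExt : GrTensor K R W₀ W₁ →ₗ[K] (M.V →ₗ[K] N.V) :=
  -- On `M ⊕ N` a generator `y` of degree one acts by `(m, n) ↦ (0, F y m)`, while degree zero acts
  -- diagonally. The entry from `M` to `N` is therefore the bimodule extension of `F` in degree one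
  -- and zero in every other degree.
  let Φ := extendAct (K := K) (R := R) (W₀ := W₀) (W₁ := W₁) (V := M.V × N.V)
    (AddMonoidHom.mk' (fun y => LinearMap.inr K M.V N.V ∘ₗ F y ∘ₗ LinearMap.fst K M.V N.V)
      (fun y z => by rw [map_add, LinearMap.add_comp, LinearMap.comp_add]))
    (fun r y m => Prod.ext rfl (hl r y m.1))
    (fun r y m => Prod.ext (smul_zero _).symm (hr r y m.1))
  LinearMap.mk₂ K (fun t m => ((Φ t).unop (m, 0)).2)
    (fun s t m => by rw [map_add]; rfl)
    (fun k t m => by rw [map_smul]; rfl)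
    (fun t m n => by
      rw [← Prod.snd_add, ← map_add, Prod.mk_add_mk, add_zero])
    (fun k t m => by
      rw [← Prod.smul_snd, ← map_smul, Prod.smul_mk, smul_zero])

theorem bimodExt_of₁ (y : W₁) : bimodExt F hl hr (of₁ K R W₀ W₁ y) = F y := by
  ext m
  change ((extendAct _ _ _ _).unop (m, 0)).2 = _
  rw [extendAct_of₁]; rfl

theorem bimodExt_mul_left (a : degZero K R W₀ W₁) (t : GrTensor K R W₀ W₁) (m : M.V) :
    bimodExt F hl hr (a * t) m = bimodExt F hl hr t (Rep.act m a) := by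
  change ((extendAct _ _ _ _).unop (m, 0)).2 = ((extendAct _ _ _ _).unop (Rep.act m a, 0)).2
  rw [extendAct_mul, extendAct_coe, Prod.smul_mk, smul_zero]; rfl

theorem bimodExt_mul_right (t : GrTensor K R W₀ W₁) (a : degZero K R W₀ W₁) (m : M.V) :
    bimodExt F hl hr (t * a) m = Rep.act (bimodExt F hl hr t m) a := by
  change ((extendAct _ _ _ _).unop (m, 0)).2 = op a • ((extendAct _ _ _ _).unop (m, 0)).2
  rw [extendAct_mul, extendAct_coe]; rfl

/-- A morphism of representations is determined by its values on the generators. -/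
noncomputable def Hom.ofGen (f₀ : M.V →ₗ[K] N.V)
    (hf : ∀ m r, f₀ (Rep.actR m r) = Rep.actR (f₀ m) r)
    (hc : ∀ (y : W₀) (m : M.V), Rep.act₀ (f₀ m) y =
      f₀ (Rep.act₀ m y) + bimodExt F hl hr (D.δ (y, 0)) m) : Hom M N where
  f₀ := f₀
  f₁ := (bimodExt F hl hr).domRestrict _
  map_actR := hf
  left a t m := bimodExt_mul_left F hl hr a t m
  right a t m := bimodExt_mul_right F hl hr t a m
  comm := by
    rintro ⟨a, ha⟩
    change ∀ m : M.V, Rep.act (f₀ m) ⟨a, ha⟩ = f₀ (Rep.act m ⟨a, ha⟩) + bimodExt F hl hr (D.d a) m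
    induction ha using Algebra.adjoin_induction with
    | mem y hy =>
      rcases hy with ⟨r, rfl⟩ | ⟨y, rfl⟩
      · intro m
        rw [D.d_ofR, map_zero, LinearMap.zero_apply, add_zero]
        exact (hf m r).symm
      · intro m
        rw [D.d_of₀]
        exact hc y m
    | algebraMap k =>
      intro m
      -- Scalars come from `R`, where `d` vanishes and `f₀` is linear.
      have h : (⟨algebraMap K _ k, Subalgebra.algebraMap_mem _ k⟩ : degZero K R W₀ W₁) =
          degR (algebraMap K R k) := Subtype.ext (AlgHom.commutes _ k).symm
      rw [h, ← AlgHom.commutes (TensorAlg.ofR K R (W₀ × W₁)), D.d_ofR, map_zero,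
        LinearMap.zero_apply, add_zero]
      exact (hf m _).symm
    | add y z hy hz h1 h2 =>
      intro m
      have e : ∀ {L : D.Rep} (n : L.V), Rep.act n ⟨y + z, Subalgebra.add_mem _ hy hz⟩ =
          Rep.act n ⟨y, hy⟩ + Rep.act n ⟨z, hz⟩ := fun n =>
        add_smul (op (⟨y, hy⟩ : degZero K R W₀ W₁)) (op ⟨z, hz⟩) n
      rw [e, e, h1, h2, map_add, map_add, map_add, LinearMap.add_apply]; abel
    | mul y z hy hz h1 h2 =>
      intro m
      have e : ∀ {L : D.Rep} (n : L.V), Rep.act n ⟨y * z, Subalgebra.mul_mem _ hy hz⟩ =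
          Rep.act (Rep.act n ⟨y, hy⟩) ⟨z, hz⟩ := fun n =>
        mul_smul (op (⟨z, hz⟩ : degZero K R W₀ W₁)) (op ⟨y, hy⟩) n
      have e2 : ∀ (n n' : N.V), Rep.act (n + n') ⟨z, hz⟩ =
          Rep.act n ⟨z, hz⟩ + Rep.act n' ⟨z, hz⟩ := fun n n' => smul_add _ n n'
      -- The condition is stable under products by the Leibniz rule, which carries no sign here
      -- since `y` has degree zero: `d(y) z` is the defect at `y` followed by `z`, and `y d(z)` is
      -- the defect at `z` evaluated at `m y`.
      rw [e, e, h1, e2, h2, D.d_mul, sgn_degZero hy, map_add, LinearMap.add_apply,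
        ← bimodExt_mul_right F hl hr, ← bimodExt_mul_left F hl hr ⟨y, hy⟩, add_assoc,
        add_comm (bimodExt F hl hr (y * D.d z) m)]

theorem Hom.ofGen_f₁_of₁ (f₀ : M.V →ₗ[K] N.V) (hf) (hc) (y : W₁) :
    (Hom.ofGen F hl hr f₀ hf hc).f₁ ⟨of₁ K R W₀ W₁ y, of₁_mem y⟩ = F y :=
  bimodExt_of₁ F hl hr y

end ofGen

/-! ### Composites, checked on generators -/

section comp

variable {M N L : Rep.{u, v, w, w', x} D} (f : Hom M N) (g : Hom N L)

theorem Hom.f₁_of₁_smul (r : R) (y : W₁) (m : M.V) :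
    f.f₁ ⟨of₁ K R W₀ W₁ (r • y), of₁_mem _⟩ m =
      f.f₁ ⟨of₁ K R W₀ W₁ y, of₁_mem _⟩ (Rep.actR m r) := by
  refine Eq.trans ?_ (f.left (degR r) ⟨of₁ K R W₀ W₁ y, of₁_mem _⟩ m)
  congr 2
  exact Subtype.ext (of₁_smul r y)

theorem Hom.f₁_of₁_op_smul (r : R) (y : W₁) (m : M.V) :
    f.f₁ ⟨of₁ K R W₀ W₁ (op r • y), of₁_mem _⟩ m =
      Rep.actR (f.f₁ ⟨of₁ K R W₀ W₁ y, of₁_mem _⟩ m) r := by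
  refine Eq.trans ?_ (f.right (degR r) ⟨of₁ K R W₀ W₁ y, of₁_mem _⟩ m)
  congr 2
  exact Subtype.ext (of₁_op_smul r y)

/-- `f¹` on the generators of degree one. -/
noncomputable def Hom.gen₁ : W₁ →+ (M.V →ₗ[K] N.V) :=
  AddMonoidHom.mk' (fun y => f.f₁ ⟨of₁ K R W₀ W₁ y, of₁_mem _⟩) (fun y z => by
    rw [← map_add]; congr 1; exact Subtype.ext (map_add _ _ _))

theorem Hom.gen₁_smul (r : R) (y : W₁) (m : M.V) :
    f.gen₁ (r • y) m = f.gen₁ y (Rep.actR m r) := f.f₁_of₁_smul r y m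

theorem Hom.gen₁_op_smul (r : R) (y : W₁) (m : M.V) :
    f.gen₁ (op r • y) m = Rep.actR (f.gen₁ y m) r := f.f₁_of₁_op_smul r y m

/-- The degree-one part is generated by `W₁` as a bimodule over the degree-zero part, and both sides
are bimodule morphisms with the same values on `W₁`. So every `f¹` arises from the triangular
construction. -/
theorem Hom.f₁_eq_bimodExt (t : deg K R W₀ W₁ 1) (m : M.V) :
    f.f₁ t m = bimodExt f.gen₁ f.gen₁_smul f.gen₁_op_smul t m := by
  obtain ⟨t, ht⟩ := t
  suffices h : ∃ h : t ∈ deg K R W₀ W₁ 1,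
      f.f₁ ⟨t, h⟩ m = bimodExt f.gen₁ f.gen₁_smul f.gen₁_op_smul t m from h.2
  refine deg_one_induction (p := fun t => ∃ h : t ∈ deg K R W₀ W₁ 1,
      f.f₁ ⟨t, h⟩ m = bimodExt f.gen₁ f.gen₁_smul f.gen₁_op_smul t m) ?_ ?_ ?_ ?_ ht
  · intro a b y
    have ha := mul_mem_deg a.2 (of₁_mem (K := K) (R := R) (W₀ := W₀) y)
    refine ⟨deg_mul_mem b.2 ha, (f.right b ⟨_, ha⟩ m).trans ?_⟩
    rw [bimodExt_mul_right, bimodExt_mul_left, bimodExt_of₁]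
    exact congrArg (Rep.act · b) (f.left a ⟨_, of₁_mem y⟩ m)
  · refine ⟨Submodule.zero_mem _, ?_⟩
    have e : (⟨0, Submodule.zero_mem _⟩ : deg K R W₀ W₁ 1) = 0 := rfl
    simp [e]
  · rintro k s ⟨h, e⟩
    refine ⟨Submodule.smul_mem _ k h, ?_⟩
    have e' : (⟨k • s, Submodule.smul_mem _ k h⟩ : deg K R W₀ W₁ 1) = k • ⟨s, h⟩ := rfl
    simp only [e', map_smul, LinearMap.smul_apply, e]
  · rintro s t ⟨h, e⟩ ⟨h', e2⟩
    refine ⟨Submodule.add_mem _ h h', ?_⟩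
    have e' : (⟨s + t, Submodule.add_mem _ h h'⟩ : deg K R W₀ W₁ 1) = ⟨s, h⟩ + ⟨t, h'⟩ := rfl
    simp only [e', map_add, LinearMap.add_apply, e, e2]

theorem Hom.comm_of₀ (y : W₀) (m : M.V) : Rep.act₀ (f.f₀ m) y = f.f₀ (Rep.act₀ m y) +
    bimodExt f.gen₁ f.gen₁_smul f.gen₁_op_smul (D.δ (y, 0)) m := by
  rw [← D.d_of₀]
  exact (f.comm ⟨_, of₀_mem y⟩ m).trans (congrArg (f.f₀ (Rep.act₀ m y) + ·)
    (f.f₁_eq_bimodExt _ m))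

/-- The action of `T_R(W)` on `M ⊕ N ⊕ L` given by `f¹` and `g¹`. -/
noncomputable def compAct :
    GrTensor K R W₀ W₁ →ₐ[K] (Module.End K (M.V × N.V × L.V))ᵐᵒᵖ :=
  extendAct (K := K) (R := R) (W₀ := W₀) (W₁ := W₁) (V := M.V × N.V × L.V)
    (AddMonoidHom.mk' (fun y => LinearMap.inr K M.V (N.V × L.V) ∘ₗ
        LinearMap.prodMap (f.gen₁ y) (g.gen₁ y) ∘ₗ
        LinearMap.prodMap LinearMap.id (LinearMap.fst K N.V L.V))
      (fun y z => by
        rw [map_add, map_add]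
        exact LinearMap.ext fun m => Prod.ext (add_zero _).symm rfl))
    (fun r y m => Prod.ext rfl (Prod.ext (f.f₁_of₁_smul r y m.1) (g.f₁_of₁_smul r y m.2.1)))
    (fun r y m => Prod.ext (smul_zero _).symm
      (Prod.ext (f.f₁_of₁_op_smul r y m.1) (g.f₁_of₁_op_smul r y m.2.1)))

theorem compAct_of₁ (y : W₁) (m : M.V) (n : N.V) (l : L.V) :
    (compAct f g (of₁ K R W₀ W₁ y)).unop (m, n, l) = (0, f.gen₁ y m, g.gen₁ y n) := by
  rw [compAct, extendAct_of₁]; rfl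

theorem compAct_mul (s t : GrTensor K R W₀ W₁) (z : M.V × N.V × L.V) :
    (compAct f g (s * t)).unop z = (compAct f g t).unop ((compAct f g s).unop z) :=
  extendAct_mul s t z

theorem compAct_coe (a : degZero K R W₀ W₁) (m : M.V) (n : N.V) (l : L.V) :
    (compAct f g a).unop (m, n, l) = (Rep.act m a, Rep.act n a, Rep.act l a) :=
  extendAct_coe a _

/-- On `M ⊕ N ⊕ L` an element of degree one moves each summand exactly one place to the right,
through `f¹` and then `g¹`. A product of two such elements hence has `g¹ f¹` as its entry from `M`
to `L`, which is what makes `comp₂` well defined without choosing a decomposition. -/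
theorem compAct_deg_one (t : deg K R W₀ W₁ 1) (m : M.V) (n : N.V) (l : L.V) :
    (compAct f g t).unop (m, n, l) = (0, f.f₁ t m, g.f₁ t n) := by
  obtain ⟨t, ht⟩ := t
  suffices h : ∃ h : t ∈ deg K R W₀ W₁ 1,
      (compAct f g t).unop (m, n, l) = (0, f.f₁ ⟨t, h⟩ m, g.f₁ ⟨t, h⟩ n) from h.2
  revert m n l
  refine deg_one_induction (p := fun t => ∀ (m : M.V) (n : N.V) (l : L.V),
    ∃ h : t ∈ deg K R W₀ W₁ 1,
      (compAct f g t).unop (m, n, l) = (0, f.f₁ ⟨t, h⟩ m, g.f₁ ⟨t, h⟩ n)) ?_ ?_ ?_ ?_ ht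
  · intro a b y m n l
    refine ⟨deg_mul_mem b.2 (mul_mem_deg a.2 (of₁_mem y)), ?_⟩
    rw [compAct_mul, compAct_mul, compAct_coe, compAct_of₁, compAct_coe]
    refine Prod.ext (smul_zero _) (Prod.ext ?_ ?_)
    · exact ((f.right b ⟨_, mul_mem_deg a.2 (of₁_mem y)⟩ m).trans
        (congrArg (Rep.act · b) (f.left a ⟨_, of₁_mem y⟩ m))).symm
    · exact ((g.right b ⟨_, mul_mem_deg a.2 (of₁_mem y)⟩ n).trans
        (congrArg (Rep.act · b) (g.left a ⟨_, of₁_mem y⟩ n))).symm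
  · intro m n l
    refine ⟨Submodule.zero_mem _, ?_⟩
    have e : (⟨0, Submodule.zero_mem _⟩ : deg K R W₀ W₁ 1) = 0 := rfl
    rw [e, map_zero, map_zero, map_zero]; rfl
  · intro k s hs m n l
    obtain ⟨h, e⟩ := hs m n l
    refine ⟨Submodule.smul_mem _ k h, ?_⟩
    have e' : (⟨k • s, Submodule.smul_mem _ k h⟩ : deg K R W₀ W₁ 1) = k • ⟨s, h⟩ := rfl
    rw [e', map_smul, map_smul, map_smul, MulOpposite.unop_smul, LinearMap.smul_apply, e,
      Prod.smul_mk, smul_zero]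
    rfl
  · intro s t hs ht m n l
    obtain ⟨h, e⟩ := hs m n l
    obtain ⟨h', e'⟩ := ht m n l
    refine ⟨Submodule.add_mem _ h h', ?_⟩
    have e'' : (⟨s + t, Submodule.add_mem _ h h'⟩ : deg K R W₀ W₁ 1) = ⟨s, h⟩ + ⟨t, h'⟩ := rfl
    rw [e'', map_add, map_add, map_add, MulOpposite.unop_add, LinearMap.add_apply, e, e',
      Prod.mk_add_mk, add_zero]
    rfl

/-- The linear map which sends `s s'` to `g¹(s') f¹(s)` if `s, s'` are of degree one. -/
noncomputable def comp₂ : GrTensor K R W₀ W₁ →ₗ[K] (M.V →ₗ[K] L.V) :=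
  LinearMap.mk₂ K (fun t m => ((compAct f g t).unop (m, 0, 0)).2.2)
    (fun s t m => by rw [map_add]; rfl)
    (fun k t m => by rw [map_smul]; rfl)
    (fun t m n => by
      rw [← Prod.snd_add, ← Prod.snd_add, ← map_add]
      simp only [Prod.mk_add_mk, add_zero])
    (fun k t m => by
      rw [← Prod.smul_snd, ← Prod.smul_snd, ← map_smul]
      simp only [Prod.smul_mk, smul_zero])

theorem comp₂_mul (s t : deg K R W₀ W₁ 1) (m : M.V) :
    comp₂ f g ((s : GrTensor K R W₀ W₁) * t) m = g.f₁ t (f.f₁ s m) := by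
  change ((compAct f g (_ * _)).unop (m, 0, 0)).2.2 = _
  rw [compAct_mul, compAct_deg_one, compAct_deg_one]

theorem comp₂_mul_left (a : degZero K R W₀ W₁) (t : GrTensor K R W₀ W₁) (m : M.V) :
    comp₂ f g (a * t) m = comp₂ f g t (Rep.act m a) := by
  change ((compAct f g (_ * _)).unop (m, 0, 0)).2.2 = ((compAct f g _).unop (_, 0, 0)).2.2
  rw [compAct_mul, compAct_coe]
  simp only [Rep.act, smul_zero]

theorem comp₂_mul_right (t : GrTensor K R W₀ W₁) (a : degZero K R W₀ W₁) (m : M.V) :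
    comp₂ f g (t * a) m = Rep.act (comp₂ f g t m) a := by
  change ((compAct f g (_ * _)).unop (m, 0, 0)).2.2 = _
  rw [compAct_mul]
  exact congrArg (fun z => z.2.2) (compAct_coe f g a _ _ _)

/-- It is enough to check the formula for the composite on the generators of degree one. -/
theorem Hom.isComp_of_gen (h : Hom M L) (h0 : h.f₀ = g.f₀ ∘ₗ f.f₀)
    (h1 : ∀ (y : W₁) (m : M.V), h.gen₁ y m = g.gen₁ y (f.f₀ m) + g.f₀ (f.gen₁ y m) -
      comp₂ f g (D.δ (0, y)) m) : f.IsComp g h := by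
  have key : ∀ t ∈ deg K R W₀ W₁ 1, ∀ m : M.V, ∃ ht : t ∈ deg K R W₀ W₁ 1,
      h.f₁ ⟨t, ht⟩ m = g.f₁ ⟨t, ht⟩ (f.f₀ m) + g.f₀ (f.f₁ ⟨t, ht⟩ m) -
        comp₂ f g (D.d t) m := by
    intro t ht
    refine deg_one_induction (p := fun t => ∀ m : M.V, ∃ ht : t ∈ deg K R W₀ W₁ 1,
      h.f₁ ⟨t, ht⟩ m = g.f₁ ⟨t, ht⟩ (f.f₀ m) + g.f₀ (f.f₁ ⟨t, ht⟩ m) -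
        comp₂ f g (D.d t) m) ?_ ?_ ?_ ?_ ht
    · intro a b y m
      have ha := mul_mem_deg a.2 (of₁_mem (K := K) (R := R) (W₀ := W₀) y)
      refine ⟨deg_mul_mem b.2 ha, ?_⟩
      have e : ∀ {M' N' : Rep.{u, v, w, w', x} D} (f' : Hom M' N') (m' : M'.V),
          f'.f₁ ⟨a * of₁ K R W₀ W₁ y * b, deg_mul_mem b.2 ha⟩ m' =
            Rep.act (f'.gen₁ y (Rep.act m' a)) b := fun f' m' =>
        (f'.right b ⟨_, ha⟩ m').trans (congrArg (Rep.act · b) (f'.left a ⟨_, of₁_mem y⟩ m'))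
      -- The minus sign in the last term comes from moving `d` past the degree-one generator `y`.
      have e1 : D.d ((a : GrTensor K R W₀ W₁) * of₁ K R W₀ W₁ y * b) =
          D.d a * (of₁ K R W₀ W₁ y * b) + a * (D.δ (0, y) * b) -
            (a * of₁ K R W₀ W₁ y) * D.d b := by
        rw [D.d_mul, D.d_mul, D.d_of₁, map_mul, sgn_degZero a.2, sgn_of₁]
        noncomm_ring
      have e2 : comp₂ f g (D.d a * (of₁ K R W₀ W₁ y * b)) m =
          Rep.act (g.gen₁ y (f.f₁ ⟨D.d a, D.d_degZero_mem a.2⟩ m)) b := by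
        rw [← mul_assoc, comp₂_mul_right]
        exact congrArg (Rep.act · b) (comp₂_mul f g ⟨D.d a, D.d_degZero_mem a.2⟩
          ⟨_, of₁_mem y⟩ m)
      have e3 : comp₂ f g ((a * of₁ K R W₀ W₁ y) * D.d b) m =
          g.f₁ ⟨D.d b, D.d_degZero_mem b.2⟩ (f.gen₁ y (Rep.act m a)) := by
        rw [mul_assoc, comp₂_mul_left]
        exact comp₂_mul f g ⟨_, of₁_mem y⟩ ⟨D.d b, D.d_degZero_mem b.2⟩ _
      have e4 : comp₂ f g (a * (D.δ (0, y) * b)) m =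
          Rep.act (comp₂ f g (D.δ (0, y)) (Rep.act m a)) b := by
        rw [comp₂_mul_left, comp₂_mul_right]
      have e5 : ∀ n n' : L.V, Rep.act (n + n') b = Rep.act n b + Rep.act n' b :=
        fun n n' => smul_add _ n n'
      have e6 : ∀ n n' : L.V, Rep.act (n - n') b = Rep.act n b - Rep.act n' b :=
        fun n n' => smul_sub _ n n'
      -- The terms with `d a` and `d b` are the defects measured by the compatibility of `f` at `a`
      -- and of `g` at `b`; after substituting both, only the formula at the generator `y` remains.
      have c1 := f.comm a m
      have c2 := g.comm b (f.gen₁ y (Rep.act m a))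
      rw [e h, e g, e f, e1, map_sub, map_add, LinearMap.sub_apply, LinearMap.add_apply, e2, e3, e4, h1,
        c1, e6, e5, c2, map_add, e5]
      abel
    · intro m
      refine ⟨Submodule.zero_mem _, ?_⟩
      have e : (⟨0, Submodule.zero_mem _⟩ : deg K R W₀ W₁ 1) = 0 := rfl
      simp [e]
    · intro k s hs m
      obtain ⟨ht, e⟩ := hs m
      refine ⟨Submodule.smul_mem _ k ht, ?_⟩
      have e' : (⟨k • s, Submodule.smul_mem _ k ht⟩ : deg K R W₀ W₁ 1) = k • ⟨s, ht⟩ := rfl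
      simp only [e', map_smul, LinearMap.smul_apply, e, smul_add, smul_sub]
    · intro s t hs ht m
      obtain ⟨hs', e⟩ := hs m
      obtain ⟨ht', e2⟩ := ht m
      refine ⟨Submodule.add_mem _ hs' ht', ?_⟩
      have e' : (⟨s + t, Submodule.add_mem _ hs' ht'⟩ : deg K R W₀ W₁ 1) =
        ⟨s, hs'⟩ + ⟨t, ht'⟩ := rfl
      simp only [e', map_add, LinearMap.add_apply, e, e2]
      abel
  -- The correction term depends on `d t` alone, as the value of `comp₂`, so every decomposition of
  -- `d t` into products gives the same one.
  refine ⟨h0, fun t n s s' hd => LinearMap.ext fun m => ?_⟩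
  obtain ⟨ht, e⟩ := key t t.2 m
  rw [hd, map_sum, LinearMap.sum_apply] at e
  simp only [comp₂_mul] at e
  simpa using e

end comp

end Ditalgebra

end Dit

end EqPoset

namespace EqPoset

/-! ### Representations of the Drozd ditalgebra in terms of the action of `*J` -/

section DrozdRep

open GrTensor Ditalgebra

namespace Decomp

variable {K : Type u} {Λ : Type v} [Field K] [Ring Λ] [Algebra K Λ] {Δ : Decomp K Λ}

/-- A morphism of right `S`-modules `*J → S` is the evaluation at an element of `J`. -/
theorem DualBasis.ev_sum_smul (B : Δ.DualBasis) (h : Δ.LDual →+ Δ.S)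
    (hs : ∀ γ s, h (op s • γ) = h γ * s) (γ : Δ.LDual) :
    γ.ev (∑ i, h (B.γ i) • B.p i) = h γ := by
  conv_rhs => rw [← B.expand γ, map_sum]
  rw [LDual.ev_sum]
  exact Finset.sum_congr rfl fun i _ => by rw [LDual.ev_smul, hs]

/-- The expansion in the dual basis involves only values of elements of `*J`. Identities in `J` may
thus be tested by applying every `γ`. -/
theorem DualBasis.ext_ev (B : Δ.DualBasis) {a b : Δ.J} (h : ∀ γ : Δ.LDual, γ.ev a = γ.ev b) :
    a = b := by
  rw [← B.sum_eq a, ← B.sum_eq b]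
  exact Finset.sum_congr rfl fun i _ => by rw [h]

variable {B : Δ.DualBasis}

variable (Δ) in
/-- The algebra of elements of degree zero. -/
noncomputable abbrev TT₀ : Subalgebra K Δ.TT := degZero K Δ.RR (Δ.Blk 0 1) (Δ.Blk 0 0 × Δ.Blk 1 1)

/-- An element of `R`, in degree zero. -/
noncomputable def inR (r : Δ.RR) : Δ.TT₀ := degR r

/-- The element `w_{1,2} γ`, in degree zero. -/
noncomputable def in12 (γ : Δ.LDual) : Δ.TT₀ := ⟨Δ.w12 γ, w12_mem γ⟩

theorem inR_mul_in12 (r : Δ.RR) (γ : Δ.LDual) : inR r * in12 γ = in12 ((r 0 : Λ) • γ) :=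
  Subtype.ext (w12_left r γ).symm

theorem in12_mul_inR (r : Δ.RR) (γ : Δ.LDual) : in12 γ * inR r = in12 (op (r 1) • γ) :=
  Subtype.ext (w12_right r γ).symm

/-- A representation of the Drozd ditalgebra as a right `S`-module, along the diagonal
embedding of `S` in `R`. -/
noncomputable instance (M : Ditalgebra.Rep.{u, v, v, v, x} (drozd B)) : Module (Δ.S)ᵐᵒᵖ M.V :=
  Module.compHom M.V ((degRHom K Δ.RR (Δ.Blk 0 1) (Δ.Blk 0 0 × Δ.Blk 1 1)).comp
    (Pi.constRingHom (Fin 2) Δ.S)).op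

variable {M N L : Ditalgebra.Rep.{u, v, v, v, x} (drozd B)}

theorem actR_mul (m : M.V) (r s : Δ.RR) : Ditalgebra.Rep.actR m (r * s) = Ditalgebra.Rep.actR (Ditalgebra.Rep.actR m r) s := by
  have h : (degR (r * s) : degZero K Δ.RR (Δ.Blk 0 1) (Δ.Blk 0 0 × Δ.Blk 1 1)) =
    degR r * degR s := map_mul (degRHom K Δ.RR (Δ.Blk 0 1) (Δ.Blk 0 0 × Δ.Blk 1 1)) r s
  change op (degR (r * s) : degZero K Δ.RR (Δ.Blk 0 1) (Δ.Blk 0 0 × Δ.Blk 1 1)) • m = _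
  rw [h, MulOpposite.op_mul, mul_smul]; rfl

theorem actR_add (m : M.V) (r s : Δ.RR) : Ditalgebra.Rep.actR m (r + s) = Ditalgebra.Rep.actR m r + Ditalgebra.Rep.actR m s := by
  have h : (degR (r + s) : degZero K Δ.RR (Δ.Blk 0 1) (Δ.Blk 0 0 × Δ.Blk 1 1)) =
    degR r + degR s := map_add (degRHom K Δ.RR (Δ.Blk 0 1) (Δ.Blk 0 0 × Δ.Blk 1 1)) r s
  change op (degR (r + s) : degZero K Δ.RR (Δ.Blk 0 1) (Δ.Blk 0 0 × Δ.Blk 1 1)) • m = _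
  rw [h, MulOpposite.op_add, add_smul]; rfl

theorem zero_actR (r : Δ.RR) : Ditalgebra.Rep.actR (0 : M.V) r = 0 := smul_zero _

instance : IsScalarTower K (Δ.S)ᵐᵒᵖ M.V where
  smul_assoc k s m := by
    have h : (degR (fun _ => k • s.unop) : degZero K Δ.RR (Δ.Blk 0 1) (Δ.Blk 0 0 × Δ.Blk 1 1)) =
        k • degR (fun _ => s.unop) :=
      Subtype.ext (map_smul (TensorAlg.ofR K Δ.RR (Δ.Blk 0 1 × (Δ.Blk 0 0 × Δ.Blk 1 1))) k
        (fun _ => s.unop))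
    change op (degR (fun _ => k • s.unop) :
      degZero K Δ.RR (Δ.Blk 0 1) (Δ.Blk 0 0 × Δ.Blk 1 1)) • m = _
    rw [h, MulOpposite.op_smul, smul_assoc]; rfl

/-- The action of `w_{1,2} *J`. -/
noncomputable def jact (M : Ditalgebra.Rep.{u, v, v, v, x} (drozd B)) : Δ.LDual →+ M.V →+ M.V :=
  AddMonoidHom.mk' (fun γ => AddMonoidHom.mk' (fun m => Ditalgebra.Rep.act₀ m (show Δ.Blk 0 1 from γ))
    (fun _ _ => smul_add _ _ _)) (fun γ η => AddMonoidHom.ext fun m => by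
      have h : degW (K := K) (R := Δ.RR) (W₁ := Δ.Blk 0 0 × Δ.Blk 1 1)
        (show Δ.Blk 0 1 from γ + η) = degW (show Δ.Blk 0 1 from γ) + degW (show Δ.Blk 0 1 from η) :=
        degW_add _ _
      change op (degW (K := K) (R := Δ.RR) (W₁ := Δ.Blk 0 0 × Δ.Blk 1 1)
        (show Δ.Blk 0 1 from γ + η)) • m = _
      rw [h, MulOpposite.op_add, add_smul]; rfl)

theorem jact_actR (r : Δ.RR) (γ : Δ.LDual) (m : M.V) :
    jact M γ (Ditalgebra.Rep.actR m r) = jact M ((r 0 : Λ) • γ) m := by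
  exact ((mul_smul (op (in12 γ)) (op (inR r)) m).symm.trans
    (congrArg (fun a : Δ.TT₀ => op a • m) (inR_mul_in12 r γ)))

theorem actR_jact (r : Δ.RR) (γ : Δ.LDual) (m : M.V) :
    Ditalgebra.Rep.actR (jact M γ m) r = jact M (op (r 1) • γ) m := by
  exact ((mul_smul (op (inR r)) (op (in12 γ)) m).symm.trans
    (congrArg (fun a : Δ.TT₀ => op a • m) (in12_mul_inR r γ)))

theorem jact_op_smul (s : Δ.S) (γ : Δ.LDual) (m : M.V) :
    jact M γ (op s • m) = jact M ((s : Λ) • γ) m := jact_actR (fun _ => s) γ m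

theorem op_smul_jact (s : Δ.S) (γ : Δ.LDual) (m : M.V) :
    op s • jact M γ m = jact M (op s • γ) m := actR_jact (fun _ => s) γ m

/-- The map `γ ↦ f¹(w₁ γ)`. -/
noncomputable def homW1 (f : Hom M N) : Δ.LDual →+ (M.V →ₗ[K] N.V) :=
  f.gen₁.comp (AddMonoidHom.inl (Δ.Blk 0 0) (Δ.Blk 1 1))

/-- The map `γ ↦ f¹(w₂ γ)`. -/
noncomputable def homW2 (f : Hom M N) : Δ.LDual →+ (M.V →ₗ[K] N.V) :=
  f.gen₁.comp (AddMonoidHom.inr (Δ.Blk 0 0) (Δ.Blk 1 1))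

theorem gen₁_eq (f : Hom M N) (γ η : Δ.LDual) :
    f.gen₁ ((show Δ.Blk 0 0 from γ), (show Δ.Blk 1 1 from η)) = homW1 f γ + homW2 f η := by
  change _ = f.gen₁ _ + f.gen₁ _
  rw [← map_add]
  congr 1
  exact Prod.ext (add_zero _).symm (zero_add _).symm

theorem homW2_actR (f : Hom M N) (r : Δ.RR) (γ : Δ.LDual) (m : M.V) :
    homW2 f γ (Ditalgebra.Rep.actR m r) = homW2 f ((r 1 : Λ) • γ) m := by
  refine (f.f₁_of₁_smul r ((0 : Δ.Blk 0 0), (show Δ.Blk 1 1 from γ)) m).symm.trans ?_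
  rw [Prod.smul_mk, smul_zero]; rfl

theorem f₀_op_smul (f : Hom M N) (s : Δ.S) (m : M.V) : f.f₀ (op s • m) = op s • f.f₀ m :=
  f.map_actR m (fun _ => s)

theorem drozd_δ_w12 (γ : Δ.LDual) : (drozd B).δ ((show Δ.Blk 0 1 from γ), 0) =
    ∑ i, Δ.w12 (B.γ i) * Δ.w2 ((B.p i : Λ) • γ) - ∑ i, Δ.w1 (B.γ i) * Δ.w12 ((B.p i : Λ) • γ) := by
  rw [← B.comul_apply, ← B.comul_apply, ← d_w12]
  exact ((drozdPre B).d_of₀ _).symm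

theorem drozd_δ_W₁ (γ η : Δ.LDual) :
    (drozd B).δ (0, ((show Δ.Blk 0 0 from γ), (show Δ.Blk 1 1 from η))) =
    -∑ i, Δ.w1 (B.γ i) * Δ.w1 ((B.p i : Λ) • γ) - ∑ i, Δ.w2 (B.γ i) * Δ.w2 ((B.p i : Λ) • η) := by
  rw [← B.comul_apply, ← B.comul_apply, ← d_w1, sub_eq_add_neg, ← d_w2]
  refine Eq.trans ?_ (congrArg₂ (· + ·) ((drozdPre B).d_of₁ (γ, (0 : Δ.LDual))).symm
    ((drozdPre B).d_of₁ ((0 : Δ.LDual), η)).symm)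
  rw [← map_add]
  congr 1
  exact Prod.ext (add_zero _).symm (Prod.ext (add_zero _).symm (zero_add _).symm)

/-- Every summand of `d(w_{1,2} γ)` has one factor of degree zero and one of degree one. A factor of
degree zero on the left acts on `M` before `F`; one on the right acts on `N` after `F`. -/
theorem bimodExt_δ (F : Δ.Blk 0 0 × Δ.Blk 1 1 →+ (M.V →ₗ[K] N.V)) (hl) (hr) (γ : Δ.LDual)
    (m : M.V) : bimodExt F hl hr ((drozd B).δ ((show Δ.Blk 0 1 from γ), 0)) m =
    ∑ i, F (0, (show Δ.Blk 1 1 from (B.p i : Λ) • γ)) (jact M (B.γ i) m) -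
    ∑ i, jact N ((B.p i : Λ) • γ) (F ((show Δ.Blk 0 0 from B.γ i), 0) m) := by
  rw [drozd_δ_w12, map_sub, map_sum, map_sum, LinearMap.sub_apply, LinearMap.sum_apply,
    LinearMap.sum_apply]
  congr 1
  · refine Finset.sum_congr rfl fun i _ => ?_
    refine (bimodExt_mul_left F hl hr ⟨_, w12_mem (B.γ i)⟩ _ m).trans ?_
    exact congrArg (fun z : M.V →ₗ[K] N.V => z _) (bimodExt_of₁ F hl hr _)
  · refine Finset.sum_congr rfl fun i _ => ?_
    refine (bimodExt_mul_right F hl hr _ ⟨_, w12_mem ((B.p i : Λ) • γ)⟩ m).trans ?_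
    exact congrArg (fun z : M.V →ₗ[K] N.V => jact N _ (z m)) (bimodExt_of₁ F hl hr _)

/-- The compatibility condition for a morphism, at an element of `w_{1,2} *J`. -/
theorem jact_f₀ (f : Hom M N) (γ : Δ.LDual) (m : M.V) :
    jact N γ (f.f₀ m) = f.f₀ (jact M γ m) +
      (∑ i, homW2 f ((B.p i : Λ) • γ) (jact M (B.γ i) m) -
        ∑ i, jact N ((B.p i : Λ) • γ) (homW1 f (B.γ i) m)) := by
  refine (f.comm_of₀ (show Δ.Blk 0 1 from γ) m).trans (congrArg (f.f₀ (jact M γ m) + ·) ?_)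
  exact bimodExt_δ f.gen₁ _ _ γ m

theorem comp₂_δ (f : Hom M N) (g : Hom N L) (γ η : Δ.LDual) (m : M.V) :
    comp₂ f g ((drozd B).δ (0, ((show Δ.Blk 0 0 from γ), (show Δ.Blk 1 1 from η)))) m =
    -∑ i, homW1 g ((B.p i : Λ) • γ) (homW1 f (B.γ i) m) -
      ∑ i, homW2 g ((B.p i : Λ) • η) (homW2 f (B.γ i) m) := by
  rw [drozd_δ_W₁, map_sub, map_neg, map_sum, map_sum, LinearMap.sub_apply, LinearMap.neg_apply,
    LinearMap.sum_apply, LinearMap.sum_apply]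
  congr 1
  · congr 1
    exact Finset.sum_congr rfl fun i _ => comp₂_mul f g ⟨_, w1_mem _⟩ ⟨_, w1_mem _⟩ m
  · exact Finset.sum_congr rfl fun i _ => comp₂_mul f g ⟨_, w2_mem _⟩ ⟨_, w2_mem _⟩ m

end Decomp

end DrozdRep

end EqPoset

namespace EqPoset

/-! ### Objects and morphisms of `mod 𝒟ᵉ` as matrices over the incidence algebra -/

section Equipped

namespace MultSystem

variable {K : Type u} {A : Type v} {Q : Type w} [Field K] [Ring A] [Algebra K A] [PartialOrder Q]
  {ℛ : MultSystem K A Q} [Fintype Q]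

/-! ### The projections of `Λ = S ⊕ J` -/

/-- The diagonal entry of an element of `Λ`. -/
def ent (i : Q) (a : ℛ.Inc) : ℛ.Pt i := Pt.mk (a.entry i i) (a.entry_mem i i)

theorem eS_mul_right (i : Q) (r : ℛ.Pt i) (s : ℛ.decomp.S) :
    eS i r * s = eS i (r * ent i (s : ℛ.Inc)) := by
  refine diag_ext fun j => ?_
  rw [Subalgebra.coe_mul, diag_mul_entry]
  by_cases h : j = i
  · subst h; rw [eS_entry_self, eS_entry_self]; rfl
  · rw [eS_entry_of_ne i _ h, eS_entry_of_ne i _ h, zero_mul]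

theorem mul_eS_left (i : Q) (r : ℛ.Pt i) (s : ℛ.decomp.S) :
    s * eS i r = eS i (ent i (s : ℛ.Inc) * r) := by
  refine diag_ext fun j => ?_
  rw [Subalgebra.coe_mul, diag_mul_entry]
  by_cases h : j = i
  · subst h; rw [eS_entry_self, eS_entry_self]; rfl
  · rw [eS_entry_of_ne i _ h, eS_entry_of_ne i _ h, mul_zero]

theorem eS_one_comm (i : Q) (s : ℛ.decomp.S) : eS i 1 * s = s * eS i 1 := by
  rw [eS_mul_right, mul_eS_left, _root_.one_mul, _root_.mul_one]

theorem eS_mul_of_ne {i j : Q} (h : i ≠ j) (r : ℛ.Pt i) (s : ℛ.Pt j) : eS i r * eS j s = 0 := by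
  rw [eS_mul_right]
  refine diag_ext fun l => ?_
  by_cases hl : l = i
  · subst hl
    rw [eS_entry_self, Pt.val_mul]
    change _ * (eS j s : ℛ.Inc).entry l l = 0
    rw [eS_entry_of_ne j s h, mul_zero]
  · rw [eS_entry_of_ne _ _ hl]; rfl

theorem sum_eS_one : ∑ i, (eS i 1 : ℛ.decomp.S) = 1 := by
  have h : ∀ s : ℛ.decomp.S, (∑ i, eS i 1) * s = s := by
    intro s
    rw [Finset.sum_mul]
    refine diag_ext fun j => ?_
    have e : ∀ (f : Q → ℛ.decomp.S), ((∑ i, f i : ℛ.decomp.S) : ℛ.Inc).entry j j =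
        ∑ i, (f i : ℛ.Inc).entry j j := fun f =>
      map_sum (AddMonoidHom.mk' (fun s : ℛ.decomp.S => (s : ℛ.Inc).entry j j) fun _ _ => rfl) f _
    rw [e, Finset.sum_eq_single j]
    · rw [eS_mul_right, _root_.one_mul, eS_entry_self]; rfl
    · intro i _ h
      rw [eS_mul_right, eS_entry_of_ne _ _ h.symm]
    · simp
  simpa using h 1

variable (ℛ) in
/-- The projection of `Λ` onto `S`. -/
noncomputable def dpart : ℛ.Inc →+* ℛ.decomp.S where
  toFun a := ⟨dg fun i => ent i a, show ∀ j l, j ≠ l → (dg fun i => ent i a).entry j l = 0 from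
    fun _ _ h => dg_entry_ne _ h⟩
  map_one' := diag_ext fun i => dg_entry_self _ i
  map_zero' := diag_ext fun i => dg_entry_self _ i
  map_mul' a b := diag_ext fun i => by
    rw [Subalgebra.coe_mul, Inc.mul_entry_self]
    refine (dg_entry_self _ i).trans (Eq.trans ?_
      (congrArg₂ (· * ·) (dg_entry_self _ i) (dg_entry_self _ i)).symm)
    exact Inc.mul_entry_self a b i
  map_add' a b := diag_ext fun i => by
    rw [Subalgebra.coe_add, Inc.add_entry]
    refine (dg_entry_self _ i).trans (Eq.trans ?_
      (congrArg₂ (· + ·) (dg_entry_self _ i) (dg_entry_self _ i)).symm)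
    rfl

theorem dpart_entry (a : ℛ.Inc) (i : Q) : (ℛ.dpart a : ℛ.Inc).entry i i = a.entry i i :=
  dg_entry_self _ i

@[simp] theorem dpart_coe (s : ℛ.decomp.S) : ℛ.dpart (s : ℛ.Inc) = s :=
  diag_ext fun i => dpart_entry _ i

variable (ℛ) in
/-- The projection of `Λ` onto `J`. -/
noncomputable def jpart : ℛ.Inc →+ ℛ.decomp.J :=
  AddMonoidHom.mk' (fun a => ⟨a - (ℛ.dpart a : ℛ.Inc), fun i => by
    rw [Inc.sub_entry, dpart_entry, sub_self]⟩) (fun a b => Subtype.ext (by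
      change a + b - (ℛ.dpart (a + b) : ℛ.Inc) =
        (a - (ℛ.dpart a : ℛ.Inc)) + (b - (ℛ.dpart b : ℛ.Inc))
      rw [map_add, Subalgebra.coe_add]; abel))

theorem jpart_val (a : ℛ.Inc) : (ℛ.jpart a : ℛ.Inc) = a - (ℛ.dpart a : ℛ.Inc) := rfl

theorem dpart_add_jpart (a : ℛ.Inc) : (ℛ.dpart a : ℛ.Inc) + (ℛ.jpart a : ℛ.Inc) = a := by
  rw [jpart_val]; abel

theorem dpart_coe_J (j : ℛ.decomp.J) : ℛ.dpart (j : ℛ.Inc) = 0 :=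
  diag_ext fun i => (dpart_entry _ i).trans (j.2 i)

@[simp] theorem jpart_coe_J (j : ℛ.decomp.J) : ℛ.jpart (j : ℛ.Inc) = j :=
  Subtype.ext (by rw [jpart_val, dpart_coe_J]; exact sub_zero _)

@[simp] theorem jpart_coe_S (s : ℛ.decomp.S) : ℛ.jpart (s : ℛ.Inc) = 0 :=
  Subtype.ext (by rw [jpart_val, dpart_coe]; exact sub_self _)

theorem jpart_mul_coe (a : ℛ.Inc) (s : ℛ.decomp.S) :
    ℛ.jpart (a * s) = Decomp.rmul (ℛ.jpart a) (s : ℛ.Inc) :=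
  Subtype.ext (by
    change _ = (a - (ℛ.dpart a : ℛ.Inc)) * s
    rw [jpart_val, map_mul, dpart_coe, sub_mul]; rfl)

theorem jpart_coe_mul (s : ℛ.decomp.S) (a : ℛ.Inc) : ℛ.jpart (s * a) = s • ℛ.jpart a :=
  Subtype.ext (by
    change _ = s * (a - (ℛ.dpart a : ℛ.Inc))
    rw [jpart_val, map_mul, dpart_coe, mul_sub]; rfl)

/-- The extension of `γ ∈ *J` to `Λ`, by zero on `S`. -/
noncomputable def exd (γ : ℛ.decomp.LDual) : ℛ.Inc →+ ℛ.decomp.S :=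
  AddMonoidHom.mk' (fun a => γ.ev (ℛ.jpart a)) fun a b => by rw [map_add, γ.ev_add]

theorem exd_coe_J (γ : ℛ.decomp.LDual) (j : ℛ.decomp.J) : exd γ (j : ℛ.Inc) = γ.ev j :=
  congrArg γ.ev (jpart_coe_J j)

theorem exd_coe_S (γ : ℛ.decomp.LDual) (s : ℛ.decomp.S) : exd γ (s : ℛ.Inc) = 0 :=
  (congrArg γ.ev (jpart_coe_S s)).trans (LinearMap.map_zero _)

theorem exd_coe_mul (γ : ℛ.decomp.LDual) (s : ℛ.decomp.S) (a : ℛ.Inc) :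
    exd γ (s * a) = s * exd γ a :=
  (congrArg γ.ev (jpart_coe_mul s a)).trans (γ.ev_smul _ _)

theorem exd_mul_coe (γ : ℛ.decomp.LDual) (a : ℛ.Inc) (s : ℛ.decomp.S) :
    exd γ (a * s) = exd ((s : ℛ.Inc) • γ) a := congrArg γ.ev (jpart_mul_coe a s)

theorem exd_add_left (γ η : ℛ.decomp.LDual) (a : ℛ.Inc) :
    exd (γ + η) a = exd γ a + exd η a := rfl

theorem exd_op_smul (γ : ℛ.decomp.LDual) (s : ℛ.decomp.S) (a : ℛ.Inc) :
    exd (op s • γ) a = exd γ a * s := rfl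

theorem smul_exd_coe_J (γ : ℛ.decomp.LDual) (a : ℛ.Inc) (j : ℛ.decomp.J) :
    exd (a • γ) (j : ℛ.Inc) = exd γ (j * a) := by
  rw [exd_coe_J, Decomp.LDual.smul_ev, ← exd_coe_J]; rfl

/-- `γ` only sees the `J`-component. -/
theorem exd_jpart (γ : ℛ.decomp.LDual) (a : ℛ.Inc) : exd γ (ℛ.jpart a : ℛ.Inc) = exd γ a :=
  exd_coe_J _ _

theorem ext_exd (B : ℛ.decomp.DualBasis) {j j' : ℛ.decomp.J} (h : ∀ γ, exd γ (j : ℛ.Inc) = exd γ (j' : ℛ.Inc)) : j = j' :=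
  B.ext_ev fun γ => by rw [← exd_coe_J, h, exd_coe_J]

/-! ### Local bases as dual bases over `S` -/

/-- The index set of a local basis with dimension vector `d`. -/
abbrev Idx (d : Q → ℕ) : Type w := Σ y, Fin (d y)

variable (ℛ) in
/-- A basis of a right `S`-module, adapted to the idempotents of `S`. -/
structure SBasis (V : Type x) [AddCommGroup V] [Module (ℛ.decomp.S)ᵐᵒᵖ V] (d : Q → ℕ) where
  /-- the vectors -/
  vec : Idx d → V
  /-- the coordinates -/
  c : Idx d → V →ₗ[(ℛ.decomp.S)ᵐᵒᵖ] ℛ.decomp.S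
  sum_c : ∀ m, ∑ k, op (c k m) • vec k = m
  c_self : ∀ k, c k (vec k) = eS k.1 1
  c_ne : ∀ l k, l ≠ k → c l (vec k) = 0
  e_c : ∀ k m, eS k.1 1 * c k m = c k m

section

variable {V : Type x} [AddCommGroup V] [Module (ℛ.decomp.S)ᵐᵒᵖ V] {d : Q → ℕ} (b : ℛ.SBasis V d)

theorem SBasis.vec_e (k : Idx d) : op (eS k.1 1 : ℛ.decomp.S) • b.vec k = b.vec k := by
  conv_rhs => rw [← b.sum_c (b.vec k)]
  rw [Finset.sum_eq_single k, b.c_self]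
  · intro l _ h; rw [b.c_ne l k h, MulOpposite.op_zero, zero_smul]
  · simp

theorem SBasis.c_op_smul (k : Idx d) (s : ℛ.decomp.S) (m : V) : b.c k (op s • m) = b.c k m * s :=
  map_smul _ _ _

theorem SBasis.c_sum (k : Idx d) (s : Idx d → ℛ.decomp.S) :
    b.c k (∑ l, op (s l) • b.vec l) = eS k.1 1 * s k := by
  rw [map_sum, Finset.sum_eq_single k, b.c_op_smul, b.c_self]
  · intro l _ h; rw [b.c_op_smul, b.c_ne k l h.symm, zero_mul]
  · simp

end

/-! ### The idempotent `e₀` -/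

variable [OrderBot Q]

/-- No point lies strictly below `0`, so column `0` of an element of `J` is empty. The vanishing
statements that reduce the problem to a single matrix over `Λ` rest on this. -/
theorem J_mul_e0 (j : ℛ.decomp.J) : (j : ℛ.Inc) * ((eS ⊥ 1 : ℛ.decomp.S) : ℛ.Inc) = 0 := by
  refine Inc.ext fun i l => ?_
  rw [mul_diag_entry, Inc.zero_entry]
  by_cases hl : l = ⊥
  · subst hl
    by_cases hi : i = ⊥
    · subst hi
      have h : (j : ℛ.Inc).entry ⊥ ⊥ = 0 := j.2 ⊥
      rw [h, zero_mul]
    · rw [Inc.entry_eq_zero _ (fun h => hi (le_bot_iff.mp h)), zero_mul]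
  · rw [eS_entry_of_ne _ _ hl, mul_zero]

theorem e0_smul (γ : ℛ.decomp.LDual) : ((eS ⊥ 1 : ℛ.decomp.S) : ℛ.Inc) • γ = 0 := by
  refine Decomp.LDual.ext fun j => ?_
  have h : Decomp.rmul j ((eS ⊥ 1 : ℛ.decomp.S) : ℛ.Inc) = 0 := Subtype.ext (J_mul_e0 j)
  rw [Decomp.LDual.smul_ev, h]
  exact LinearMap.map_zero _

variable (ℛ) in
/-- An action of `*J` on a right `S`-module `V`, with the properties of the action of `w_{1,2} *J`
on an object of `mod 𝒟ᵉ`. -/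
structure JAct (V : Type x) [AddCommGroup V] [Module (ℛ.decomp.S)ᵐᵒᵖ V] where
  /-- the action -/
  act : ℛ.decomp.LDual →+ V →+ V
  act_op_smul : ∀ (γ : ℛ.decomp.LDual) (s : ℛ.decomp.S) m,
    act γ (op s • m) = act ((s : ℛ.Inc) • γ) m
  op_smul_act : ∀ (γ : ℛ.decomp.LDual) (s : ℛ.decomp.S) m, op s • act γ m = act (op s • γ) m
  e0_act : ∀ γ m, op (eS ⊥ 1 : ℛ.decomp.S) • act γ m = act γ m

section

variable {V : Type x} [AddCommGroup V] [Module (ℛ.decomp.S)ᵐᵒᵖ V] {d : Q → ℕ}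
  (b : ℛ.SBasis V d) (a : ℛ.JAct V) (B : ℛ.decomp.DualBasis)

/-- The matrix over `J` of the action of `*J`. -/
noncomputable def jmat : Matrix (Idx d) (Idx d) ℛ.Inc := fun l k =>
  ((∑ i, b.c l (a.act (B.γ i) (b.vec k)) • B.p i : ℛ.decomp.J) : ℛ.Inc)

theorem jmat_mem (l k : Idx d) : ∃ j : ℛ.decomp.J, jmat b a B l k = (j : ℛ.Inc) := ⟨_, rfl⟩

/-- For fixed `l` and `k` the right-hand side is right `S`-linear in `γ`, so the dual basis
represents it as evaluation at one element of `J`; that element is the entry of `jmat`. -/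
theorem exd_jmat (γ : ℛ.decomp.LDual) (l k : Idx d) :
    exd γ (jmat b a B l k) = b.c l (a.act γ (b.vec k)) :=
  (exd_coe_J _ _).trans (B.ev_sum_smul
    (AddMonoidHom.mk' (fun γ => b.c l (a.act γ (b.vec k))) fun γ η => by
      rw [map_add, AddMonoidHom.add_apply, map_add])
    (fun γ s => by
      change b.c l (a.act (op s • γ) (b.vec k)) = b.c l (a.act γ (b.vec k)) * s
      rw [← a.op_smul_act, b.c_op_smul]) γ)

/-- In coordinates, acting by `γ` is multiplication of the coordinate column by `jmat` followed by
`γ`. -/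
theorem c_act (γ : ℛ.decomp.LDual) (l : Idx d) (m : V) :
    b.c l (a.act γ m) = exd γ (∑ k, jmat b a B l k * (b.c k m : ℛ.Inc)) := by
  conv_lhs => rw [← b.sum_c m, map_sum, map_sum]
  rw [map_sum]
  refine Finset.sum_congr rfl fun k _ => ?_
  rw [a.act_op_smul, ← exd_jmat b a B, exd_mul_coe]

theorem e_mul_jmat (l k : Idx d) :
    ((eS l.1 1 : ℛ.decomp.S) : ℛ.Inc) * jmat b a B l k = jmat b a B l k := by
  have h : ((eS l.1 1 : ℛ.decomp.S)) • (∑ i, b.c l (a.act (B.γ i) (b.vec k)) • B.p i : ℛ.decomp.J)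
    = ∑ i, b.c l (a.act (B.γ i) (b.vec k)) • B.p i := by
    rw [Finset.smul_sum]
    exact Finset.sum_congr rfl fun i _ => by rw [← mul_smul, b.e_c]
  exact congrArg Subtype.val h

/-- The action lands in `V e₀`, and `e₀` is central in `S`, so it can be moved from the right of a
coordinate to its left. -/
theorem e0_mul_jmat (l k : Idx d) :
    ((eS ⊥ 1 : ℛ.decomp.S) : ℛ.Inc) * jmat b a B l k = jmat b a B l k := by
  have h : ((eS ⊥ 1 : ℛ.decomp.S)) • (∑ i, b.c l (a.act (B.γ i) (b.vec k)) • B.p i : ℛ.decomp.J)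
    = ∑ i, b.c l (a.act (B.γ i) (b.vec k)) • B.p i := by
    rw [Finset.smul_sum]
    refine Finset.sum_congr rfl fun i _ => ?_
    rw [← mul_smul, eS_one_comm, ← b.c_op_smul, a.e0_act]
  exact congrArg Subtype.val h

theorem jmat_mul_e (l k : Idx d) :
    jmat b a B l k * ((eS k.1 1 : ℛ.decomp.S) : ℛ.Inc) = jmat b a B l k := by
  refine congrArg Subtype.val (ext_exd B (j := Decomp.rmul _ _) fun γ => ?_)
  change exd γ (jmat b a B l k * _) = exd γ (jmat b a B l k)
  rw [exd_mul_coe, exd_jmat, exd_jmat, ← a.act_op_smul, b.vec_e]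

theorem jmat_row_ne {l : Idx d} (h : l.1 ≠ ⊥) (k : Idx d) : jmat b a B l k = 0 := by
  rw [← e_mul_jmat, ← e0_mul_jmat, ← mul_assoc, ← Subalgebra.coe_mul, eS_mul_of_ne h,
    ZeroMemClass.coe_zero, zero_mul]

/-- The entries of `jmat` lie in `e₀ J`, and `J e₀ = 0`. Left multiplication on `jmat` therefore
sees only the `S`-part of the multiplier. -/
theorem J_mul_jmat (j : ℛ.decomp.J) (l k : Idx d) : (j : ℛ.Inc) * jmat b a B l k = 0 := by
  rw [← e0_mul_jmat, ← mul_assoc, J_mul_e0, zero_mul]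

theorem jmat_col_bot (l : Idx d) {k : Idx d} (h : k.1 = ⊥) : jmat b a B l k = 0 := by
  obtain ⟨j, hj⟩ := jmat_mem b a B l k
  rw [← jmat_mul_e, hj, h, J_mul_e0]

end

end MultSystem

namespace MultSystem

variable {K : Type u} {A : Type v} {Q : Type w} [Field K] [Ring A] [Algebra K A] [PartialOrder Q]
  {ℛ : MultSystem K A Q} [Fintype Q]

/-! ### Morphisms given by matrices over `Λ` -/

section

variable {V V' : Type x} [AddCommGroup V] [Module (ℛ.decomp.S)ᵐᵒᵖ V]
  [AddCommGroup V'] [Module (ℛ.decomp.S)ᵐᵒᵖ V'] [Module K V] [Module K V']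
  [IsScalarTower K (ℛ.decomp.S)ᵐᵒᵖ V] [IsScalarTower K (ℛ.decomp.S)ᵐᵒᵖ V']
  {d d' : Q → ℕ} (b : ℛ.SBasis V d) (b' : ℛ.SBasis V' d')
  (X : Matrix (Idx d') (Idx d) ℛ.Inc)

theorem op_algebraMap_smul (k : K) (m : V) :
    op (algebraMap K ℛ.decomp.S k) • m = k • m := by
  have h : (op (algebraMap K ℛ.decomp.S k) : (ℛ.decomp.S)ᵐᵒᵖ) = k • 1 := by
    rw [Algebra.algebraMap_eq_smul_one]; rfl
  rw [h, smul_assoc, one_smul]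

/-- The `j`-th component of the image of `m` in `V' ⊗ Λ`. -/
noncomputable def SBasis.row (j : Idx d') : V →+ ℛ.Inc :=
  AddMonoidHom.mk' (fun m => ∑ k, X j k * (b.c k m : ℛ.Inc)) fun m n => by
    simp only [map_add, Subalgebra.coe_add, mul_add, Finset.sum_add_distrib]

theorem SBasis.row_apply (j : Idx d') (m : V) :
    b.row X j m = ∑ k, X j k * (b.c k m : ℛ.Inc) := rfl

theorem SBasis.row_op_smul (j : Idx d') (s : ℛ.decomp.S) (m : V) :
    b.row X j (op s • m) = b.row X j m * s := by
  simp only [SBasis.row_apply, SBasis.c_op_smul, Subalgebra.coe_mul, Finset.sum_mul, mul_assoc]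

/-- The component `f⁰` of the morphism given by the matrix `X`. -/
noncomputable def matHom₀ : V →ₗ[K] V' where
  toFun m := ∑ j, op (ℛ.dpart (b.row X j m)) • b'.vec j
  map_add' m n := by
    simp only [map_add, MulOpposite.op_add, add_smul, Finset.sum_add_distrib]
  map_smul' k m := by
    rw [RingHom.id_apply, Finset.smul_sum]
    refine Finset.sum_congr rfl fun j _ => ?_
    rw [← op_algebraMap_smul (ℛ := ℛ) k m, b.row_op_smul, map_mul, dpart_coe, ← Algebra.commutes,
      ← op_algebraMap_smul (ℛ := ℛ) k (_ • b'.vec j), ← mul_smul, ← MulOpposite.op_mul,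
      Algebra.commutes]

theorem matHom₀_apply (m : V) :
    matHom₀ b b' X m = ∑ j, op (ℛ.dpart (b.row X j m)) • b'.vec j := rfl

theorem matHom₀_op_smul (s : ℛ.decomp.S) (m : V) :
    matHom₀ b b' X (op s • m) = op s • matHom₀ b b' X m := by
  simp only [matHom₀_apply, Finset.smul_sum, b.row_op_smul, map_mul, dpart_coe,
    MulOpposite.op_mul, mul_smul]

/-- The component `γ ↦ f¹(w₁ γ)` of the morphism given by the matrix `X`. -/
noncomputable def matHom₁ : ℛ.decomp.LDual →+ (V →ₗ[K] V') :=
  AddMonoidHom.mk' (fun γ =>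
    { toFun := fun m => ∑ j, op (exd γ (b.row X j m)) • b'.vec j
      map_add' := fun m n => by
        simp only [map_add, MulOpposite.op_add, add_smul, Finset.sum_add_distrib]
      map_smul' := fun k m => by
        rw [RingHom.id_apply, Finset.smul_sum]
        refine Finset.sum_congr rfl fun j _ => ?_
        have h : b.row X j m * ((algebraMap K ℛ.decomp.S k : ℛ.decomp.S) : ℛ.Inc) =
            ((algebraMap K ℛ.decomp.S k : ℛ.decomp.S) : ℛ.Inc) * b.row X j m :=
          (Algebra.commutes (A := ℛ.Inc) k (b.row X j m)).symm
        rw [← op_algebraMap_smul (ℛ := ℛ) k m, b.row_op_smul, h, exd_coe_mul,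
          ← op_algebraMap_smul (ℛ := ℛ) k (_ • b'.vec j), ← mul_smul, ← MulOpposite.op_mul,
          Algebra.commutes] })
    (fun γ η => LinearMap.ext fun m => by
      change ∑ j, op (exd (γ + η) (b.row X j m)) • b'.vec j =
        ∑ j, op (exd γ (b.row X j m)) • b'.vec j + ∑ j, op (exd η (b.row X j m)) • b'.vec j
      simp only [exd_add_left, MulOpposite.op_add, add_smul, Finset.sum_add_distrib])

theorem matHom₁_apply (γ : ℛ.decomp.LDual) (m : V) :
    matHom₁ b b' X γ m = ∑ j, op (exd γ (b.row X j m)) • b'.vec j := rfl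

theorem matHom₁_op_smul (γ : ℛ.decomp.LDual) (s : ℛ.decomp.S) (m : V) :
    matHom₁ b b' X γ (op s • m) = matHom₁ b b' X ((s : ℛ.Inc) • γ) m := by
  simp only [matHom₁_apply, b.row_op_smul, exd_mul_coe]

theorem op_smul_matHom₁ (γ : ℛ.decomp.LDual) (s : ℛ.decomp.S) (m : V) :
    op s • matHom₁ b b' X γ m = matHom₁ b b' X (op s • γ) m := by
  simp only [matHom₁_apply, exd_op_smul, Finset.smul_sum, MulOpposite.op_mul, mul_smul]

section conditions

variable {b b' X}

/-- If `X` commutes with the idempotents, then the coordinates of `f⁰(m)` are the diagonal parts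
of the components of `m`. -/
theorem c_matHom₀ (hE : ∀ j k, ((eS j.1 1 : ℛ.decomp.S) : ℛ.Inc) * X j k =
    X j k * ((eS k.1 1 : ℛ.decomp.S) : ℛ.Inc)) (j : Idx d') (m : V) :
    b'.c j (matHom₀ b b' X m) = ℛ.dpart (b.row X j m) := by
  -- The coordinate picks up a factor `e_j`; `hE` carries it through `X` as `e_k`, which the
  -- coordinate `c_k(m)` absorbs.
  rw [matHom₀_apply, b'.c_sum, ← dpart_coe (eS j.1 1), ← map_mul, b.row_apply, Finset.mul_sum]
  simp only [← mul_assoc, hE]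
  simp only [mul_assoc, ← Subalgebra.coe_mul, b.e_c]

theorem c_matHom₁ (hE : ∀ j k, ((eS j.1 1 : ℛ.decomp.S) : ℛ.Inc) * X j k =
    X j k * ((eS k.1 1 : ℛ.decomp.S) : ℛ.Inc)) (γ : ℛ.decomp.LDual) (j : Idx d') (m : V) :
    b'.c j (matHom₁ b b' X γ m) = exd γ (b.row X j m) := by
  rw [matHom₁_apply, b'.c_sum, ← exd_coe_mul, b.row_apply, Finset.mul_sum]
  simp only [← mul_assoc, hE]
  simp only [mul_assoc, ← Subalgebra.coe_mul, b.e_c]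

variable [OrderBot Q]

theorem matHom₁_e0 (γ : ℛ.decomp.LDual) (m : V) :
    matHom₁ b b' X γ (op (eS ⊥ 1 : ℛ.decomp.S) • m) = 0 := by
  rw [matHom₁_op_smul, e0_smul, map_zero, LinearMap.zero_apply]

theorem jpart_e0_mul (y : ℛ.Inc) (h : ((eS ⊥ 1 : ℛ.decomp.S) : ℛ.Inc) * y =
    y * ((eS ⊥ 1 : ℛ.decomp.S) : ℛ.Inc)) : (eS ⊥ 1 : ℛ.decomp.S) • ℛ.jpart y = 0 := by
  rw [← jpart_coe_mul, h, jpart_mul_coe]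
  exact Subtype.ext (J_mul_e0 _)

/-- The component `f¹(w₁ γ)` uses only the `J`-part of a row. If `e₀` commutes with `X`, it commutes
with that row, and `e₀ j = j e₀ = 0` for the `J`-part `j`. -/
theorem e0_matHom₁ (h0 : ∀ j k, ((eS ⊥ 1 : ℛ.decomp.S) : ℛ.Inc) * X j k =
    X j k * ((eS ⊥ 1 : ℛ.decomp.S) : ℛ.Inc)) (γ : ℛ.decomp.LDual) (m : V) :
    op (eS ⊥ 1 : ℛ.decomp.S) • matHom₁ b b' X γ m = 0 := by
  rw [matHom₁_apply, Finset.smul_sum]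
  refine Finset.sum_eq_zero fun j _ => ?_
  have h : ((eS ⊥ 1 : ℛ.decomp.S) : ℛ.Inc) * b.row X j m =
      b.row X j m * ((eS ⊥ 1 : ℛ.decomp.S) : ℛ.Inc) := by
    rw [b.row_apply, Finset.mul_sum, Finset.sum_mul]
    refine Finset.sum_congr rfl fun k _ => ?_
    rw [← mul_assoc, h0, mul_assoc, mul_assoc, ← Subalgebra.coe_mul, ← Subalgebra.coe_mul,
      eS_one_comm]
  have h2 : (eS ⊥ 1 : ℛ.decomp.S) * exd γ (b.row X j m) = 0 := by
    rw [← exd_coe_mul, ← exd_jpart, jpart_coe_mul, jpart_e0_mul _ h, ZeroMemClass.coe_zero,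
      map_zero]
  rw [← mul_smul, ← MulOpposite.op_mul, ← eS_one_comm, h2, MulOpposite.op_zero, zero_smul]

theorem coe_dpart_mul_jmat (a : ℛ.JAct V) (B : ℛ.decomp.DualBasis) (y : ℛ.Inc) (l k : Idx d) :
    (ℛ.dpart y : ℛ.Inc) * jmat b a B l k = y * jmat b a B l k := by
  conv_rhs => rw [← dpart_add_jpart y, add_mul, J_mul_jmat, add_zero]

/-- The compatibility condition for the morphism given by `X`. -/
theorem act_matHom₀ (a : ℛ.JAct V) (a' : ℛ.JAct V') (B : ℛ.decomp.DualBasis)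
    (hX : jmat b' a' B * X = X * jmat b a B) (γ : ℛ.decomp.LDual) (m : V) :
    a'.act γ (matHom₀ b b' X m) = matHom₀ b b' X (a.act γ m) -
      ∑ i, a'.act ((B.p i : ℛ.Inc) • γ) (matHom₁ b b' X (B.γ i) m) := by
  have hn : ∀ (y : ℛ.Inc) (j : Idx d'), a'.act (y • γ) (b'.vec j) =
      ∑ l, op (exd γ (jmat b' a' B l j * y)) • b'.vec l := by
    intro y j
    conv_lhs => rw [← b'.sum_c (a'.act (y • γ) (b'.vec j))]
    refine Finset.sum_congr rfl fun l _ => ?_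
    rw [← exd_jmat b' a' B]
    obtain ⟨q, hq⟩ := jmat_mem b' a' B l j
    rw [hq, smul_exd_coe_J]
  -- Summing over the dual basis reassembles the `J`-part of each row from its values under the
  -- `γᵢ`.
  have h1 : ∑ i, a'.act ((B.p i : ℛ.Inc) • γ) (matHom₁ b b' X (B.γ i) m) =
      ∑ j, a'.act (((ℛ.jpart (b.row X j m) : ℛ.decomp.J) : ℛ.Inc) • γ) (b'.vec j) := by
    simp only [matHom₁_apply, map_sum, a'.act_op_smul]
    rw [Finset.sum_comm]
    refine Finset.sum_congr rfl fun j _ => ?_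
    have e := congrArg (fun q : ℛ.decomp.J => a'.act ((q : ℛ.Inc) • γ) (b'.vec j))
      (B.sum_eq (ℛ.jpart (b.row X j m)))
    refine Eq.trans ?_ e
    simp only [Submodule.coe_sum, Finset.sum_smul, map_sum, AddMonoidHom.finsetSum_apply]
    refine Finset.sum_congr rfl fun i _ => ?_
    rw [← mul_smul]; rfl
  have h2 : matHom₀ b b' X (a.act γ m) =
      ∑ l, op (exd γ (∑ k, (X * jmat b a B) l k * (b.c k m : ℛ.Inc))) • b'.vec l := by
    rw [matHom₀_apply]
    refine Finset.sum_congr rfl fun l _ => ?_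
    congr 2
    rw [b.row_apply, map_sum]
    -- Only the diagonal part of `X` occurs in `f⁰`, but to the left of `jmat` it may be replaced by
    -- `X` itself, which yields the full product `X * jmat`.
    simp only [c_act b a B, map_mul, dpart_coe, ← exd_coe_mul]
    rw [← map_sum]
    congr 1
    simp only [Matrix.mul_apply, Finset.sum_mul, Finset.mul_sum, ← mul_assoc, coe_dpart_mul_jmat]
    rw [Finset.sum_comm]
  have h3 : a'.act γ (matHom₀ b b' X m) =
      ∑ j, a'.act ((ℛ.dpart (b.row X j m) : ℛ.Inc) • γ) (b'.vec j) := by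
    simp only [matHom₀_apply, map_sum, a'.act_op_smul]
  -- The `S`-part from `f⁰` and the `J`-part from `f¹` add up to the whole row, so the other side
  -- becomes `jmat * X`.
  have hs : ∀ j, a'.act ((ℛ.dpart (b.row X j m) : ℛ.Inc) • γ) (b'.vec j) +
      a'.act (((ℛ.jpart (b.row X j m) : ℛ.decomp.J) : ℛ.Inc) • γ) (b'.vec j) =
      ∑ l, op (exd γ (jmat b' a' B l j * b.row X j m)) • b'.vec l := fun j => by
    rw [← AddMonoidHom.add_apply, ← map_add, ← add_smul, dpart_add_jpart, hn]
  rw [eq_sub_iff_add_eq, h1, h3, ← Finset.sum_add_distrib, h2, ← hX]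
  rw [Finset.sum_congr rfl fun j _ => hs j, Finset.sum_comm]
  refine Finset.sum_congr rfl fun l _ => ?_
  rw [← Finset.sum_smul, ← Finset.op_sum, ← map_sum]
  congr 3
  simp only [Matrix.mul_apply, b.row_apply, Finset.sum_mul, Finset.mul_sum, ← mul_assoc]
  rw [Finset.sum_comm]

end conditions

section comp

open scoped Classical

variable {b b' X} {Y : Matrix (Idx d) (Idx d') ℛ.Inc}

theorem sum_mul_row (h : Y * X = 1) (l : Idx d) (m : V) :
    ∑ j, Y l j * b.row X j m = (b.c l m : ℛ.Inc) := by
  have h1 : ∀ k, ∑ j, Y l j * X j k = (1 : Matrix (Idx d) (Idx d) ℛ.Inc) l k := fun k => by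
    rw [← h, Matrix.mul_apply]
  simp only [b.row_apply, Finset.mul_sum, ← mul_assoc]
  rw [Finset.sum_comm]
  simp only [← Finset.sum_mul, h1, Matrix.one_apply]
  rw [Finset.sum_eq_single l]
  · rw [if_pos rfl, _root_.one_mul]
  · intro k _ hk; rw [if_neg hk.symm, zero_mul]
  · simp

/-- The projection `Λ → S` is a ring morphism, as `J` is an ideal, so the diagonal part of `Y X = 1`
is the statement for the composite of the components `f⁰`. -/
theorem matHom₀_matHom₀ (hE : ∀ j k, ((eS j.1 1 : ℛ.decomp.S) : ℛ.Inc) * X j k =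
      X j k * ((eS k.1 1 : ℛ.decomp.S) : ℛ.Inc)) (h : Y * X = 1) (m : V) :
    matHom₀ b' b Y (matHom₀ b b' X m) = m := by
  conv_rhs => rw [← b.sum_c m]
  rw [matHom₀_apply]
  refine Finset.sum_congr rfl fun l _ => ?_
  congr 2
  rw [← dpart_coe (b.c l m), ← sum_mul_row h, b'.row_apply, map_sum, map_sum]
  simp only [c_matHom₀ hE, map_mul, dpart_coe]

/-- The three sums are the contributions to the `J`-part of a product in `S ⊕ J`: `J` times `S`, `S`
times `J`, and `J` times `J`. Together they give `γ` applied to the column `Y X c(m) = c(m)`, which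
has entries in `S` and is killed by `γ`. -/
theorem matHom₁_comp (B : ℛ.decomp.DualBasis)
    (hE : ∀ j k, ((eS j.1 1 : ℛ.decomp.S) : ℛ.Inc) * X j k =
      X j k * ((eS k.1 1 : ℛ.decomp.S) : ℛ.Inc)) (h : Y * X = 1) (γ : ℛ.decomp.LDual) (m : V) :
    matHom₁ b' b Y γ (matHom₀ b b' X m) + matHom₀ b' b Y (matHom₁ b b' X γ m) +
      ∑ i, matHom₁ b' b Y ((B.p i : ℛ.Inc) • γ) (matHom₁ b b' X (B.γ i) m) = 0 := by
  simp only [matHom₁_apply b' b, matHom₀_apply b' b]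
  rw [Finset.sum_comm, ← Finset.sum_add_distrib, ← Finset.sum_add_distrib]
  refine Finset.sum_eq_zero fun l _ => ?_
  rw [← Finset.sum_smul, ← add_smul, ← add_smul, ← Finset.op_sum, ← MulOpposite.op_add,
    ← MulOpposite.op_add]
  have h1 : exd γ (b'.row Y l (matHom₀ b b' X m)) =
      ∑ j, exd γ (Y l j * (ℛ.dpart (b.row X j m) : ℛ.Inc)) := by
    rw [b'.row_apply, map_sum]
    simp only [c_matHom₀ hE]
  have h2 : ℛ.dpart (b'.row Y l (matHom₁ b b' X γ m)) =
      ∑ j, exd γ ((ℛ.dpart (Y l j) : ℛ.Inc) * b.row X j m) := by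
    rw [b'.row_apply, map_sum]
    simp only [c_matHom₁ hE, map_mul, dpart_coe, exd_coe_mul]
  have h3 : ∑ i, exd ((B.p i : ℛ.Inc) • γ) (b'.row Y l (matHom₁ b b' X (B.γ i) m)) =
      ∑ j, exd γ ((ℛ.jpart (Y l j) : ℛ.Inc) * (ℛ.jpart (b.row X j m) : ℛ.Inc)) := by
    simp only [b'.row_apply, map_sum, c_matHom₁ hE]
    rw [Finset.sum_comm]
    refine Finset.sum_congr rfl fun j _ => ?_
    conv_rhs => rw [← B.sum_eq (ℛ.jpart (b.row X j m)), Submodule.coe_sum, Finset.mul_sum, map_sum]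
    refine Finset.sum_congr rfl fun i _ => ?_
    rw [exd_mul_coe, ← exd_jpart, ← exd_mul_coe]
    change exd ((B.p i : ℛ.Inc) • γ) ((Decomp.rmul (ℛ.jpart (Y l j)) _ : ℛ.decomp.J) : ℛ.Inc) = _
    rw [smul_exd_coe_J]
    congr 1
    exact mul_assoc _ _ _
  have h4 : ∀ j, exd γ (Y l j * (ℛ.dpart (b.row X j m) : ℛ.Inc)) +
      exd γ ((ℛ.dpart (Y l j) : ℛ.Inc) * b.row X j m) +
      exd γ ((ℛ.jpart (Y l j) : ℛ.Inc) * (ℛ.jpart (b.row X j m) : ℛ.Inc)) =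
      exd γ (Y l j * b.row X j m) := by
    intro j
    have e0 : exd γ ((ℛ.dpart (Y l j) : ℛ.Inc) * (ℛ.dpart (b.row X j m) : ℛ.Inc)) = 0 := by
      rw [← Subalgebra.coe_mul, exd_coe_S]
    -- The first two terms on the right both contain the product of the diagonal parts, so it is
    -- counted twice; the extra copy lies in `S` and is invisible to `γ`.
    have e1 : Y l j * b.row X j m + (ℛ.dpart (Y l j) : ℛ.Inc) * (ℛ.dpart (b.row X j m) : ℛ.Inc) =
      Y l j * (ℛ.dpart (b.row X j m) : ℛ.Inc) + (ℛ.dpart (Y l j) : ℛ.Inc) * b.row X j m +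
      (ℛ.jpart (Y l j) : ℛ.Inc) * (ℛ.jpart (b.row X j m) : ℛ.Inc) := by
      rw [jpart_val, jpart_val]; noncomm_ring
    rw [← map_add, ← map_add, ← e1, map_add, e0, add_zero]
  rw [h1, h2, h3, ← Finset.sum_add_distrib, ← Finset.sum_add_distrib,
    Finset.sum_congr rfl fun j _ => h4 j, ← map_sum, sum_mul_row h, exd_coe_S, MulOpposite.op_zero,
    zero_smul]

end comp

end

end MultSystem

namespace MultSystem

variable {K : Type u} {A : Type v} {Q : Type w} [Field K] [Ring A] [Algebra K A] [PartialOrder Q]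
  {ℛ : MultSystem K A Q} [Fintype Q]

/-! ### Entries, invertibility and blocks of matrices over the incidence algebra -/

open scoped Classical

theorem Inc.sum_entry {ι : Type*} (s : Finset ι) (f : ι → ℛ.Inc) (i j : Q) :
    (∑ k ∈ s, f k).entry i j = ∑ k ∈ s, (f k).entry i j :=
  map_sum (AddMonoidHom.mk' (fun a : ℛ.Inc => a.entry i j) fun _ _ => rfl) f s

theorem Pt.val_sum {ι : Type*} (s : Finset ι) {i : Q} (f : ι → ℛ.Pt i) :
    (∑ k ∈ s, f k).val = ∑ k ∈ s, (f k).val :=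
  map_sum (AddMonoidHom.mk' (fun a : ℛ.Pt i => a.val) fun _ _ => rfl) f s

theorem mul_entry_of_mul_e {a : ℛ.Inc} {y : Q}
    (h : a * ((eS y 1 : ℛ.decomp.S) : ℛ.Inc) = a) (c : ℛ.Inc) (i j : Q) :
    (a * c).entry i j = a.entry i y * c.entry y j := by
  rw [Inc.mul_entry, Finset.sum_eq_single y]
  · intro l _ hl
    rw [← h, mul_diag_entry, eS_entry_of_ne _ _ hl, mul_zero, zero_mul]
  · simp

theorem mul_entry_of_e_mul {c : ℛ.Inc} {y : Q}
    (h : ((eS y 1 : ℛ.decomp.S) : ℛ.Inc) * c = c) (a : ℛ.Inc) (i j : Q) :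
    (a * c).entry i j = a.entry i y * c.entry y j := by
  rw [Inc.mul_entry, Finset.sum_eq_single y]
  · intro l _ hl
    rw [← h, diag_mul_entry, eS_entry_of_ne _ _ hl, zero_mul, mul_zero]
  · simp

/-- The element `e_{y,z} a` of `Λ`. -/
noncomputable def el (y z : Q) (a : ℛ.R y z) : ℛ.Inc :=
  ⟨Matrix.single y z (a : A), fun i j => by
    by_cases h : y = i ∧ z = j
    · obtain ⟨rfl, rfl⟩ := h
      rw [Matrix.single_apply_same]; exact a.2
    · rw [Matrix.single_apply_of_ne _ _ _ _ _ h]; exact Submodule.zero_mem _⟩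

theorem el_entry_self (y z : Q) (a : ℛ.R y z) : (el y z a).entry y z = a :=
  Matrix.single_apply_same _ _ _

theorem el_entry_ne (y z : Q) (a : ℛ.R y z) {i j : Q} (h : ¬(y = i ∧ z = j)) :
    (el y z a).entry i j = 0 := Matrix.single_apply_of_ne _ _ _ _ _ h

theorem el_mem_J {y z : Q} (h : y ≠ z) (a : ℛ.R y z) : el y z a ∈ ℛ.decomp.J := fun _ =>
  el_entry_ne y z a fun hi => h (hi.1.trans hi.2.symm)

theorem e_mul_el (y z : Q) (a : ℛ.R y z) :
    ((eS y 1 : ℛ.decomp.S) : ℛ.Inc) * el y z a = el y z a := by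
  refine Inc.ext fun i j => ?_
  rw [diag_mul_entry]
  by_cases h : i = y
  · subst h; rw [eS_entry_self]; exact ℛ.one_mul' (Inc.entry_mem _ _ _)
  · rw [eS_entry_of_ne _ _ h, zero_mul, el_entry_ne _ _ _ fun hi => h hi.1.symm]

theorem el_mul_e (y z : Q) (a : ℛ.R y z) :
    el y z a * ((eS z 1 : ℛ.decomp.S) : ℛ.Inc) = el y z a := by
  refine Inc.ext fun i j => ?_
  rw [mul_diag_entry]
  by_cases h : j = z
  · subst h; rw [eS_entry_self]; exact ℛ.mul_one' (Inc.entry_mem _ _ _)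
  · rw [eS_entry_of_ne _ _ h, mul_zero, el_entry_ne _ _ _ fun hi => h hi.2.symm]

/-! ### Nilpotent matrices -/

variable {ι : Type*} [Fintype ι] [DecidableEq ι]

/-- A nonzero entry of an element of `J` leads strictly upwards in `Q`. The number of points below
serves as a rank, and each factor of `Z` raises it by at least one. -/
theorem pow_entry_ne_zero {Z : Matrix ι ι ℛ.Inc} (hZ : ∀ j k, Z j k ∈ ℛ.decomp.J) (n : ℕ)
    (j k : ι) (p q : Q) (h : ((Z ^ n) j k).entry p q ≠ 0) :
    (Finset.univ.filter (· < p)).card + n ≤ (Finset.univ.filter (· < q)).card := by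
  induction n generalizing k q with
  | zero =>
    have hpq : p ≤ q := by
      by_contra hpq
      exact h (Inc.entry_eq_zero _ hpq)
    refine Finset.card_le_card fun z hz => ?_
    rw [Finset.mem_filter] at hz ⊢
    exact ⟨hz.1, hz.2.trans_le hpq⟩
  | succ n ih =>
    rw [pow_succ, Matrix.mul_apply, Inc.sum_entry] at h
    obtain ⟨l, -, hl⟩ := Finset.exists_ne_zero_of_sum_ne_zero h
    rw [Inc.mul_entry] at hl
    obtain ⟨r, -, hr⟩ := Finset.exists_ne_zero_of_sum_ne_zero hl
    have h1 := ih l r (left_ne_zero_of_mul hr)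
    have h2 := right_ne_zero_of_mul hr
    have hrq : r < q := by
      refine lt_of_le_of_ne ?_ ?_
      · by_contra hrq
        exact h2 (Inc.entry_eq_zero _ hrq)
      · rintro rfl
        exact h2 (hZ l k r)
    have h3 : (Finset.univ.filter (· < r)).card < (Finset.univ.filter (· < q)).card := by
      refine Finset.card_lt_card ⟨fun z hz => ?_, fun hs => ?_⟩
      · rw [Finset.mem_filter] at hz ⊢
        exact ⟨hz.1, hz.2.trans hrq⟩
      · have := hs (Finset.mem_filter.mpr ⟨Finset.mem_univ r, hrq⟩)
        exact lt_irrefl _ (Finset.mem_filter.mp this).2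
    omega

theorem isNilpotent_of_mem_J {Z : Matrix ι ι ℛ.Inc} (hZ : ∀ j k, Z j k ∈ ℛ.decomp.J) :
    IsNilpotent Z := by
  -- The rank never exceeds `|Q|`, so this exponent leaves no room for a nonzero entry.
  refine ⟨Fintype.card Q + 1, Matrix.ext fun j k => Inc.ext fun p q => ?_⟩
  by_contra h
  have h1 := pow_entry_ne_zero hZ _ j k p q h
  have h2 : (Finset.univ.filter (· < q)).card ≤ Fintype.card Q := Finset.card_le_univ _
  omega

/-- Factor out `G`: since `J` is an ideal, `G⁻¹ Z` again has entries in `J`, and `1` plus a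
nilpotent is a unit. -/
theorem isUnit_add_of_mem_J {G Z : Matrix ι ι ℛ.Inc} (hG : IsUnit G)
    (hZ : ∀ j k, Z j k ∈ ℛ.decomp.J) : IsUnit (G + Z) := by
  obtain ⟨G, rfl⟩ := hG
  have h : (G : Matrix ι ι ℛ.Inc) + Z = G * (1 + (↑G⁻¹ : Matrix ι ι ℛ.Inc) * Z) := by
    rw [mul_add, _root_.mul_one, ← mul_assoc, Units.mul_inv, _root_.one_mul]
  rw [h]
  refine G.isUnit.mul (IsNilpotent.isUnit_one_add (isNilpotent_of_mem_J fun j k => ?_))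
  rw [Matrix.mul_apply]
  exact Submodule.sum_mem _ fun l _ => ℛ.decomp.mul_left _ (hZ l k)

/-! ### The matrix over `Λ` given by its blocks -/

variable {d : Q → ℕ}

/-- The matrix over `S` with given diagonal blocks. -/
noncomputable def diagM (T : ∀ z, Matrix (Fin (d z)) (Fin (d z)) (ℛ.Pt z)) :
    Matrix (Idx d) (Idx d) ℛ.Inc :=
  Matrix.blockDiagonal' fun z => (T z).map fun r => ((eS z r : ℛ.decomp.S) : ℛ.Inc)

theorem diagM_mul (T T' : ∀ z, Matrix (Fin (d z)) (Fin (d z)) (ℛ.Pt z)) :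
    diagM T * diagM T' = diagM fun z => T z * T' z := by
  rw [diagM, diagM, ← Matrix.blockDiagonal'_mul]
  congr 1
  funext z
  ext1 j k
  have hs : ∀ f : Fin (d z) → ℛ.Pt z, eS z (∑ l, f l) = ∑ l, eS z (f l) := fun f =>
    map_sum (AddMonoidHom.mk' (fun r : ℛ.Pt z => eS z r) fun r s => eS_add z r s) f _
  simp only [Matrix.mul_apply, Matrix.map_apply, hs, AddSubmonoidClass.coe_finsetSum, eS_mul,
    Subalgebra.coe_mul]

theorem diagM_same (T : ∀ z, Matrix (Fin (d z)) (Fin (d z)) (ℛ.Pt z)) (z : Q)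
    (j k : Fin (d z)) : diagM T ⟨z, j⟩ ⟨z, k⟩ = ((eS z (T z j k) : ℛ.decomp.S) : ℛ.Inc) :=
  Matrix.blockDiagonal'_apply_eq _ _ _ _

theorem diagM_ne (T : ∀ z, Matrix (Fin (d z)) (Fin (d z)) (ℛ.Pt z)) {j k : Idx d}
    (h : j.1 ≠ k.1) : diagM T j k = 0 := Matrix.blockDiagonal'_apply_ne _ _ _ h

theorem diagM_mem_S (T : ∀ z, Matrix (Fin (d z)) (Fin (d z)) (ℛ.Pt z)) (j k : Idx d) :
    ∃ s : ℛ.decomp.S, diagM T j k = (s : ℛ.Inc) := by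
  obtain ⟨y, j⟩ := j
  obtain ⟨z, k⟩ := k
  by_cases h : y = z
  · subst h; exact ⟨_, diagM_same T y j k⟩
  · exact ⟨0, diagM_ne T h⟩

theorem diagM_one : diagM (ℛ := ℛ) (fun z => (1 : Matrix (Fin (d z)) (Fin (d z)) (ℛ.Pt z))) =
    Matrix.diagonal fun k : Idx d => ((eS k.1 1 : ℛ.decomp.S) : ℛ.Inc) := by
  ext1 ⟨y, j⟩ ⟨z, k⟩
  by_cases h : y = z
  · subst h
    rw [diagM_same]
    by_cases hj : j = k
    · subst hj; rw [Matrix.one_apply_eq, Matrix.diagonal_apply_eq]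
    · rw [Matrix.one_apply_ne hj, Matrix.diagonal_apply_ne _ fun e => hj (by simpa using e)]
      have h0 : eS y (0 : ℛ.Pt y) = 0 :=
        map_zero (AddMonoidHom.mk' (fun r : ℛ.Pt y => eS y r) fun r s => eS_add y r s)
      rw [h0]; rfl
  · rw [diagM_ne _ h, Matrix.diagonal_apply_ne _ fun e => h (congrArg Sigma.fst e)]

/-- Identity blocks give the diagonal matrix of the idempotents `e_k`, not the identity matrix over
`Λ`. Adding the complementary idempotent, which annihilates all block matrices over `S`, turns
inverse blocks into inverse matrices. -/
theorem isUnit_diagM {T : ∀ z, Matrix (Fin (d z)) (Fin (d z)) (ℛ.Pt z)}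
    (hT : ∀ z, IsUnit (T z)) :
    IsUnit (diagM T + (1 - diagM fun z => (1 : Matrix (Fin (d z)) (Fin (d z)) (ℛ.Pt z)))) := by
  choose G hG using hT
  obtain rfl : (fun z => (G z : Matrix (Fin (d z)) (Fin (d z)) (ℛ.Pt z))) = T := funext hG
  have key : ∀ T T' : ∀ z, Matrix (Fin (d z)) (Fin (d z)) (ℛ.Pt z), (∀ z, T z * T' z = 1) →
      (diagM T + (1 - diagM fun z => (1 : Matrix (Fin (d z)) (Fin (d z)) (ℛ.Pt z)))) *
      (diagM T' + (1 - diagM fun z => (1 : Matrix (Fin (d z)) (Fin (d z)) (ℛ.Pt z)))) = 1 := by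
    intro T T' h
    simp only [add_mul, mul_add, sub_mul, mul_sub, diagM_mul, h, _root_.one_mul, _root_.mul_one]
    abel
  exact ⟨⟨_, _, key _ (fun z => ↑(G z)⁻¹) fun z => (G z).mul_inv,
    key (fun z => ↑(G z)⁻¹) _ fun z => (G z).inv_mul⟩, rfl⟩

variable [OrderBot Q]

/-- The strictly upper triangular part of the matrix with given blocks. -/
noncomputable def upperM (U : ∀ y z, Matrix (Fin (d y)) (Fin (d z)) (ℛ.R y z)) :
    Matrix (Idx d) (Idx d) ℛ.Inc := fun j k =>
  if ⊥ < j.1 ∧ j.1 < k.1 then el j.1 k.1 (U j.1 k.1 j.2 k.2) else 0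

/-- The matrix over `Λ` with given blocks, completed to a unit. -/
noncomputable def blockM (T : ∀ z, Matrix (Fin (d z)) (Fin (d z)) (ℛ.Pt z))
    (U : ∀ y z, Matrix (Fin (d y)) (Fin (d z)) (ℛ.R y z)) : Matrix (Idx d) (Idx d) ℛ.Inc :=
  (diagM T + (1 - diagM fun z => (1 : Matrix (Fin (d z)) (Fin (d z)) (ℛ.Pt z)))) + upperM U

theorem upperM_mem_J (U : ∀ y z, Matrix (Fin (d y)) (Fin (d z)) (ℛ.R y z)) (j k : Idx d) :
    upperM U j k ∈ ℛ.decomp.J := by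
  rw [upperM]
  split_ifs with h
  · exact el_mem_J h.2.ne _
  · exact Submodule.zero_mem _

theorem isUnit_blockM {T : ∀ z, Matrix (Fin (d z)) (Fin (d z)) (ℛ.Pt z)}
    (hT : ∀ z, IsUnit (T z)) (U : ∀ y z, Matrix (Fin (d y)) (Fin (d z)) (ℛ.R y z)) :
    IsUnit (blockM T U) := isUnit_add_of_mem_J (isUnit_diagM hT) (upperM_mem_J U)

theorem blockM_commute_e (T : ∀ z, Matrix (Fin (d z)) (Fin (d z)) (ℛ.Pt z))
    (U : ∀ y z, Matrix (Fin (d y)) (Fin (d z)) (ℛ.R y z)) :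
    Commute (Matrix.diagonal fun k : Idx d => ((eS k.1 1 : ℛ.decomp.S) : ℛ.Inc))
      (blockM T U) := by
  have h1 : ∀ T : ∀ z, Matrix (Fin (d z)) (Fin (d z)) (ℛ.Pt z),
      Commute (Matrix.diagonal fun k : Idx d => ((eS k.1 1 : ℛ.decomp.S) : ℛ.Inc))
        (diagM T) := fun T => by
    rw [← diagM_one, Commute, SemiconjBy, diagM_mul, diagM_mul]
    simp only [_root_.one_mul, _root_.mul_one]
  refine ((h1 T).add_right ((Commute.one_right _).sub_right (h1 _))).add_right ?_
  refine Matrix.ext fun j k => ?_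
  rw [Matrix.diagonal_mul, Matrix.mul_diagonal, upperM]
  split_ifs
  · rw [e_mul_el, el_mul_e]
  · rw [mul_zero, zero_mul]

/-- The idempotent `e₀` is central in `S`, and it kills the strictly upper blocks on both sides: on
the right since `J e₀ = 0`, on the left because these blocks start at points `y > 0`. -/
theorem blockM_commute_e0 (T : ∀ z, Matrix (Fin (d z)) (Fin (d z)) (ℛ.Pt z))
    (U : ∀ y z, Matrix (Fin (d y)) (Fin (d z)) (ℛ.R y z)) :
    Commute (Matrix.diagonal fun _ : Idx d => ((eS ⊥ 1 : ℛ.decomp.S) : ℛ.Inc))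
      (blockM T U) := by
  have h1 : ∀ T : ∀ z, Matrix (Fin (d z)) (Fin (d z)) (ℛ.Pt z),
      Commute (Matrix.diagonal fun _ : Idx d => ((eS ⊥ 1 : ℛ.decomp.S) : ℛ.Inc))
        (diagM T) := fun T => by
    refine Matrix.ext fun j k => ?_
    obtain ⟨s, hs⟩ := diagM_mem_S T j k
    rw [Matrix.diagonal_mul, Matrix.mul_diagonal, hs, ← Subalgebra.coe_mul, eS_one_comm]; rfl
  refine ((h1 T).add_right ((Commute.one_right _).sub_right (h1 _))).add_right ?_
  refine Matrix.ext fun j k => ?_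
  rw [Matrix.diagonal_mul, Matrix.mul_diagonal, J_mul_e0 ⟨_, upperM_mem_J U j k⟩, upperM]
  split_ifs with h
  · rw [← e_mul_el, ← mul_assoc, ← Subalgebra.coe_mul, eS_mul_of_ne h.1.ne,
      ZeroMemClass.coe_zero, zero_mul]
  · rw [mul_zero]

/-- The diagonal blocks of a matrix over `Λ`. -/
def blkT (X : Matrix (Idx d) (Idx d) ℛ.Inc) (z : Q) : Matrix (Fin (d z)) (Fin (d z)) (ℛ.Pt z) :=
  Matrix.of fun j k => ent z (X ⟨z, j⟩ ⟨z, k⟩)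

/-- The blocks of a matrix over `Λ`. -/
def blkU (X : Matrix (Idx d) (Idx d) ℛ.Inc) (y z : Q) :
    Matrix (Fin (d y)) (Fin (d z)) (ℛ.R y z) :=
  Matrix.of fun j k => ⟨(X ⟨y, j⟩ ⟨z, k⟩).entry y z, Inc.entry_mem _ _ _⟩

/-- The completing idempotent contributes nothing to the diagonal blocks, so the blocks put into
`blockM` can be recovered from it. -/
theorem diagM_one_sub_entry (y : Q) (j k : Fin (d y)) :
    ((1 - diagM fun z => (1 : Matrix (Fin (d z)) (Fin (d z)) (ℛ.Pt z))) ⟨y, j⟩ ⟨y, k⟩).entry y y =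
      0 := by
  rw [diagM_one, Matrix.sub_apply, Inc.sub_entry]
  by_cases h : j = k
  · subst h
    rw [Matrix.one_apply_eq, Matrix.diagonal_apply_eq, eS_entry_self, Inc.one_eq, dg_entry_self,
      sub_self]
  · have h' : (⟨y, j⟩ : Idx d) ≠ ⟨y, k⟩ := fun e => h (by simpa using e)
    rw [Matrix.one_apply_ne h', Matrix.diagonal_apply_ne _ h', sub_self]

theorem blkT_blockM (T : ∀ z, Matrix (Fin (d z)) (Fin (d z)) (ℛ.Pt z))
    (U : ∀ y z, Matrix (Fin (d y)) (Fin (d z)) (ℛ.R y z)) (z : Q) :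
    blkT (blockM T U) z = T z := by
  ext1 j k
  refine Pt.ext ?_
  change (blockM T U ⟨z, j⟩ ⟨z, k⟩).entry z z = _
  have h : upperM U ⟨z, j⟩ ⟨z, k⟩ = 0 := if_neg fun h => lt_irrefl _ h.2
  rw [blockM, Matrix.add_apply, Matrix.add_apply, h, add_zero, Inc.add_entry,
    diagM_one_sub_entry, add_zero, diagM_same, eS_entry_self]

theorem blkU_blockM (T : ∀ z, Matrix (Fin (d z)) (Fin (d z)) (ℛ.Pt z))
    (U : ∀ y z, Matrix (Fin (d y)) (Fin (d z)) (ℛ.R y z)) {y z : Q} (hy : ⊥ < y) (hz : y < z) :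
    blkU (blockM T U) y z = U y z := by
  ext1 j k
  refine Subtype.ext ?_
  change (blockM T U ⟨y, j⟩ ⟨z, k⟩).entry y z = _
  have h : upperM U ⟨y, j⟩ ⟨z, k⟩ = el y z (U y z j k) := if_pos ⟨hy, hz⟩
  have h' : (⟨y, j⟩ : Idx d) ≠ ⟨z, k⟩ := fun e => hz.ne (congrArg Sigma.fst e)
  rw [blockM, Matrix.add_apply, Matrix.add_apply, h, diagM_ne _ hz.ne, zero_add, Matrix.sub_apply,
    Matrix.one_apply_ne h', diagM_ne _ hz.ne, sub_self, zero_add, el_entry_self]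

/-! ### The matrices `ℳ(M)_x` -/

section

variable {V V' : Type x} [AddCommGroup V] [Module (ℛ.decomp.S)ᵐᵒᵖ V]
  [AddCommGroup V'] [Module (ℛ.decomp.S)ᵐᵒᵖ V'] (b : ℛ.SBasis V d) (b' : ℛ.SBasis V' d)
  (a : ℛ.JAct V) (a' : ℛ.JAct V') (B : ℛ.decomp.DualBasis) (g : ℛ.Gens)

/-- The matrix `ℳ_x` of the action of `*J`. -/
noncomputable def gmat (z : Q) : Matrix (Fin (d ⊥)) (Fin (d z)) (ℛ.Pt ⊥) :=
  Matrix.of fun j k => g.coeff z ⟨(jmat b a B ⟨⊥, j⟩ ⟨z, k⟩).entry ⊥ z, Inc.entry_mem _ _ _⟩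

theorem gmat_spec (z : Q) (j : Fin (d ⊥)) (k : Fin (d z)) :
    (jmat b a B ⟨⊥, j⟩ ⟨z, k⟩).entry ⊥ z = (gmat b a B g z j k).val * g.v z :=
  g.coeff_spec z ⟨(jmat b a B ⟨⊥, j⟩ ⟨z, k⟩).entry ⊥ z, Inc.entry_mem _ _ _⟩

theorem _root_.EqPoset.MultSystem.Gens.chi_spec (g : ℛ.Gens) (y z : Q) (r : ℛ.R y z) :
    (g.chi y z r).val * g.v z = g.v y * r :=
  (g.coeff_spec z ⟨g.v y * r, ℛ.mul_mem' (g.mem y) r.2⟩).symm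

theorem mem_below {y z : Q} : y ∈ below z ↔ ⊥ < y ∧ y < z := by
  rw [below, Set.Finite.mem_toFinset]; rfl

/-- Only the rows of `jmat` over `0` are nonzero, so of `X` only the block at `0` takes part. -/
theorem mul_jmat_entry (X : Matrix (Idx d) (Idx d) ℛ.Inc) (z : Q) (j : Fin (d ⊥))
    (k : Fin (d z)) : ((X * jmat b a B) ⟨⊥, j⟩ ⟨z, k⟩).entry ⊥ z =
      ((blkT X ⊥ * gmat b a B g z) j k).val * g.v z := by
  rw [Matrix.mul_apply, Inc.sum_entry, Fintype.sum_sigma, Finset.sum_eq_single ⊥, Matrix.mul_apply,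
    Pt.val_sum, Finset.sum_mul]
  · refine Finset.sum_congr rfl fun l _ => ?_
    rw [mul_entry_of_e_mul (e_mul_jmat b a B ⟨⊥, l⟩ _), gmat_spec b a B g, Pt.val_mul, mul_assoc]
    rfl
  · intro y _ hy
    refine Finset.sum_eq_zero fun l _ => ?_
    rw [jmat_row_ne b a B (l := ⟨y, l⟩) hy, mul_zero, Inc.zero_entry]
  · simp

/-- A column of `jmat` over `y` contributes a coefficient times `v_{0,y}`. Moving `v_{0,y}` past the
entry of `X` at `(y, z)` gives `φ_z` if `y = z` and `χ_{y,z}` if `0 < y < z`. -/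
theorem jmat_mul_entry (X : Matrix (Idx d) (Idx d) ℛ.Inc) {z : Q} (j : Fin (d ⊥))
    (k : Fin (d z)) :
    ((jmat b a B * X) ⟨⊥, j⟩ ⟨z, k⟩).entry ⊥ z =
      ((gmat b a B g z * (blkT X z).map (g.phi z) +
        ∑ y ∈ below z, gmat b a B g y * (blkU X y z).map (g.chi y z)) j k).val * g.v z := by
  have h : ∀ y, (∑ l : Fin (d y), jmat b a B ⟨⊥, j⟩ ⟨y, l⟩ * X ⟨y, l⟩ ⟨z, k⟩).entry ⊥ z =
      ∑ l : Fin (d y), (gmat b a B g y j l).val * (g.v y * (X ⟨y, l⟩ ⟨z, k⟩).entry y z) := by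
    intro y
    rw [Inc.sum_entry]
    refine Finset.sum_congr rfl fun l _ => ?_
    rw [mul_entry_of_mul_e (jmat_mul_e b a B _ ⟨y, l⟩), gmat_spec b a B g, mul_assoc]
  have hz' : z ∉ below z := fun h => lt_irrefl _ (mem_below.mp h).2
  rw [Matrix.mul_apply, Fintype.sum_sigma, Inc.sum_entry,
    ← Finset.sum_subset (Finset.subset_univ (insert z (below z))), Finset.sum_insert hz',
    Matrix.add_apply, Pt.val_add, add_mul]
  · congr 1
    · rw [h, Matrix.mul_apply, Pt.val_sum, Finset.sum_mul]
      refine Finset.sum_congr rfl fun l _ => ?_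
      rw [Pt.val_mul, mul_assoc, Matrix.map_apply, g.phi_spec]
      rfl
    · rw [Matrix.sum_apply, Pt.val_sum, Finset.sum_mul]
      refine Finset.sum_congr rfl fun y _ => ?_
      rw [h, Matrix.mul_apply, Pt.val_sum, Finset.sum_mul]
      refine Finset.sum_congr rfl fun l _ => ?_
      rw [Pt.val_mul, mul_assoc, Matrix.map_apply, g.chi_spec]
      rfl
  · intro y _ hy
    rw [Finset.mem_insert, not_or] at hy
    rw [h]
    refine Finset.sum_eq_zero fun l _ => ?_
    -- The remaining points give nothing: the column of `jmat` over `0` is zero, and the entry of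
    -- `X` at `(y, z)` is zero if `y` is not below `z`.
    by_cases hb : y = ⊥
    · subst hb
      have h0 : (gmat b a B g ⊥ j l).val * g.v ⊥ = 0 := by
        rw [← gmat_spec, jmat_col_bot b a B _ rfl, Inc.zero_entry]
      rw [← mul_assoc, h0, zero_mul]
    · rw [Inc.entry_eq_zero _ fun h => hy.2 (mem_below.mpr
        ⟨bot_lt_iff_ne_bot.mpr hb, lt_of_le_of_ne h hy.1⟩), mul_zero, mul_zero]

theorem _root_.EqPoset.MultSystem.Gens.mul_v_cancel (g : ℛ.Gens) (z : Q) {r s : ℛ.Pt ⊥}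
    (h : r.val * g.v z = s.val * g.v z) : r = s :=
  (g.basis z _ (ℛ.mul_mem' r.val_mem (g.mem z))).unique rfl h

/-- The equation between the matrices `ℳ_x` holds if `X` intertwines the actions of `*J`. -/
theorem gmat_eq {X : Matrix (Idx d) (Idx d) ℛ.Inc} (h : jmat b' a' B * X = X * jmat b a B)
    (z : Q) : blkT X ⊥ * gmat b a B g z = gmat b' a' B g z * (blkT X z).map (g.phi z) +
        ∑ y ∈ below z, gmat b' a' B g y * (blkU X y z).map (g.chi y z) := by
  ext1 j k
  apply g.mul_v_cancel z
  rw [← mul_jmat_entry, ← jmat_mul_entry, h]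

/-- Conversely, `X` intertwines the actions of `*J` if it satisfies the equations. -/
theorem jmat_mul_eq {X : Matrix (Idx d) (Idx d) ℛ.Inc}
    (hE : Commute (Matrix.diagonal fun k : Idx d => ((eS k.1 1 : ℛ.decomp.S) : ℛ.Inc)) X)
    (h0 : Commute (Matrix.diagonal fun _ : Idx d => ((eS ⊥ 1 : ℛ.decomp.S) : ℛ.Inc)) X)
    (h : ∀ z, ⊥ < z → blkT X ⊥ * gmat b a B g z =
      gmat b' a' B g z * (blkT X z).map (g.phi z) +
        ∑ y ∈ below z, gmat b' a' B g y * (blkU X y z).map (g.chi y z)) :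
    jmat b' a' B * X = X * jmat b a B := by
  have hE' : ∀ j k, ((eS j.1 1 : ℛ.decomp.S) : ℛ.Inc) * X j k =
      X j k * ((eS k.1 1 : ℛ.decomp.S) : ℛ.Inc) := fun j k => by
    have := congrFun (congrFun hE.eq j) k
    rwa [Matrix.diagonal_mul, Matrix.mul_diagonal] at this
  have h0' : ∀ j k, ((eS ⊥ 1 : ℛ.decomp.S) : ℛ.Inc) * X j k =
      X j k * ((eS ⊥ 1 : ℛ.decomp.S) : ℛ.Inc) := fun j k => by
    have := congrFun (congrFun h0.eq j) k
    rwa [Matrix.diagonal_mul, Matrix.mul_diagonal] at this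
  have hl : ∀ j k, ((eS j.1 1 : ℛ.decomp.S) : ℛ.Inc) * (jmat b' a' B * X) j k =
      (jmat b' a' B * X) j k := fun j k => by
    simp only [Matrix.mul_apply, Finset.mul_sum, ← mul_assoc, e_mul_jmat]
  have hl' : ∀ j k, ((eS j.1 1 : ℛ.decomp.S) : ℛ.Inc) * (X * jmat b a B) j k =
      (X * jmat b a B) j k := fun j k => by
    simp only [Matrix.mul_apply, Finset.mul_sum, ← mul_assoc, hE']
    simp only [mul_assoc, e_mul_jmat]
  have hr : ∀ j k, (jmat b' a' B * X) j k * ((eS k.1 1 : ℛ.decomp.S) : ℛ.Inc) =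
      (jmat b' a' B * X) j k := fun j k => by
    simp only [Matrix.mul_apply, Finset.sum_mul, mul_assoc, ← hE']
    simp only [← mul_assoc, jmat_mul_e]
  have hr' : ∀ j k, (X * jmat b a B) j k * ((eS k.1 1 : ℛ.decomp.S) : ℛ.Inc) =
      (X * jmat b a B) j k := fun j k => by
    simp only [Matrix.mul_apply, Finset.sum_mul, mul_assoc, jmat_mul_e]
  ext1 ⟨y, j⟩ ⟨z, k⟩
  by_cases hy : y = ⊥
  · subst hy
    -- In the column over `0` both sides vanish: `jmat` has no such column, and in the other product
    -- `e₀` moves through `X` to meet an entry of `J`.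
    by_cases hz : z = ⊥
    · subst hz
      rw [← hr]
      simp only [Matrix.mul_apply, Finset.sum_mul]
      refine Finset.sum_congr rfl fun l _ => ?_
      obtain ⟨q, hq⟩ := jmat_mem b' a' B ⟨⊥, j⟩ l
      rw [jmat_col_bot b a B l rfl, mul_zero, mul_assoc, ← h0', ← mul_assoc, hq, J_mul_e0,
        zero_mul]
    · refine Inc.ext fun p q => ?_
      -- By `hl` and `hr` the entries of both products are supported at the place `(0, z)`, the only
      -- one seen by the hypothesis `h`.
      by_cases hq : q = z
      · subst hq
        by_cases hp : p = ⊥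
        · subst hp
          rw [jmat_mul_entry b' a' B g, mul_jmat_entry b a B g, h _ (bot_lt_iff_ne_bot.mpr hz)]
        · rw [← hl, ← hl', diag_mul_entry, diag_mul_entry, eS_entry_of_ne _ _ hp, zero_mul,
            zero_mul]
      · rw [← hr, ← hr', mul_diag_entry, mul_diag_entry, eS_entry_of_ne _ _ hq, mul_zero,
          mul_zero]
  · have e1 : (jmat b' a' B * X) ⟨y, j⟩ ⟨z, k⟩ = 0 := by
      rw [Matrix.mul_apply]
      exact Finset.sum_eq_zero fun l _ => by
        rw [jmat_row_ne b' a' B (l := ⟨y, j⟩) hy, zero_mul]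
    -- The entry is fixed on the left by both `e₀` and `e_y`, which are orthogonal.
    have e2 : ((eS ⊥ 1 : ℛ.decomp.S) : ℛ.Inc) * (X * jmat b a B) ⟨y, j⟩ ⟨z, k⟩ =
        (X * jmat b a B) ⟨y, j⟩ ⟨z, k⟩ := by
      simp only [Matrix.mul_apply, Finset.mul_sum, ← mul_assoc, h0']
      simp only [mul_assoc, e0_mul_jmat]
    rw [e1, ← hl', ← e2, ← mul_assoc, ← Subalgebra.coe_mul, eS_mul_of_ne hy,
      ZeroMemClass.coe_zero, zero_mul]

/-! ### The matrix of a morphism -/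

/-- The diagonal blocks of the matrix of a morphism of right `S`-modules. -/
noncomputable def coordM {d' : Q → ℕ} (b : ℛ.SBasis V d) (b' : ℛ.SBasis V' d') (f : V → V')
    (z : Q) : Matrix (Fin (d' z)) (Fin (d z)) (ℛ.Pt z) :=
  Matrix.of fun j k => ent z (b'.c ⟨z, j⟩ (f (b.vec ⟨z, k⟩)) : ℛ.Inc)

/-- An `S`-linear map preserves the idempotent components, so its coordinate matrix is block
diagonal and the blocks multiply separately. The two dimension vectors may differ, as needed for
comparing dimensions. -/
theorem coordM_mul {d' : Q → ℕ} (b : ℛ.SBasis V d) (b' : ℛ.SBasis V' d') {f : V →+ V'}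
    {f' : V' →+ V} (hf : ∀ (s : ℛ.decomp.S) m, f (op s • m) = op s • f m)
    (hf' : ∀ (s : ℛ.decomp.S) m, f' (op s • m) = op s • f' m) (h : ∀ m, f' (f m) = m) (z : Q) :
    coordM b' b f' z * coordM b b' f z = 1 := by
  have he : ∀ (j : Idx d') (k : Idx d), j.1 ≠ k.1 → b'.c j (f (b.vec k)) = 0 := by
    intro j k hjk
    rw [← b'.e_c, ← b.vec_e, hf, b'.c_op_smul, ← eS_one_comm, ← mul_assoc, eS_mul_of_ne hjk,
      zero_mul]
  ext1 l k
  have h1 : b.c ⟨z, l⟩ (b.vec ⟨z, k⟩) =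
      ∑ j : Fin (d' z), b.c ⟨z, l⟩ (f' (b'.vec ⟨z, j⟩)) * b'.c ⟨z, j⟩ (f (b.vec ⟨z, k⟩)) := by
    conv_lhs => rw [← h (b.vec ⟨z, k⟩), ← b'.sum_c (f (b.vec ⟨z, k⟩)), map_sum, map_sum,
      Fintype.sum_sigma]
    rw [Finset.sum_eq_single z]
    · exact Finset.sum_congr rfl fun j _ => by rw [hf', b.c_op_smul]
    · intro y _ hy
      refine Finset.sum_eq_zero fun j _ => ?_
      rw [he ⟨y, j⟩ ⟨z, k⟩ hy, MulOpposite.op_zero, zero_smul, map_zero, map_zero]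
    · simp
  have h2 : ∀ f : Fin (d' z) → ℛ.decomp.S, ent z ((∑ j, f j : ℛ.decomp.S) : ℛ.Inc) =
      ∑ j, ent z (f j : ℛ.Inc) := fun f =>
    map_sum (AddMonoidHom.mk' (fun s : ℛ.decomp.S => ent z (s : ℛ.Inc)) fun _ _ => rfl) f _
  have h3 : ∀ s t : ℛ.decomp.S, ent z ((s * t : ℛ.decomp.S) : ℛ.Inc) =
      ent z (s : ℛ.Inc) * ent z (t : ℛ.Inc) := fun s t => Pt.ext (Inc.mul_entry_self _ _ _)
  have h4 := congrArg (fun s : ℛ.decomp.S => ent z (s : ℛ.Inc)) h1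
  simp only [h2, h3] at h4
  rw [Matrix.mul_apply]
  refine h4.symm.trans ?_
  by_cases hlk : l = k
  · subst hlk
    rw [b.c_self, Matrix.one_apply_eq]
    exact Pt.ext (eS_entry_self _ _)
  · rw [b.c_ne _ _ fun e => hlk (by simpa using e), Matrix.one_apply_ne hlk]; rfl

/-- The matrix over `Λ` of a morphism. -/
noncomputable def homM (f₀ : V → V') (f₁ : ℛ.decomp.LDual → V → V') :
    Matrix (Idx d) (Idx d) ℛ.Inc := fun j k => (b'.c j (f₀ (b.vec k)) : ℛ.Inc) +
      ((∑ i, b'.c j (f₁ (B.γ i) (b.vec k)) • B.p i : ℛ.decomp.J) : ℛ.Inc)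

theorem blkT_homM (f₀ : V → V') (f₁ : ℛ.decomp.LDual → V → V') (z : Q) :
    blkT (homM b b' B f₀ f₁) z = coordM b b' f₀ z := by
  ext1 j k
  refine Pt.ext ?_
  change (_ + ((∑ i, b'.c ⟨z, j⟩ (f₁ (B.γ i) (b.vec ⟨z, k⟩)) • B.p i : ℛ.decomp.J) :
    ℛ.Inc)).entry z z = _
  have h : ((∑ i, b'.c ⟨z, j⟩ (f₁ (B.γ i) (b.vec ⟨z, k⟩)) • B.p i : ℛ.decomp.J) :
    ℛ.Inc).entry z z = 0 := (∑ i, b'.c ⟨z, j⟩ (f₁ (B.γ i) (b.vec ⟨z, k⟩)) • B.p i).2 z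
  rw [Inc.add_entry, h, add_zero]; rfl

/-- The matrix of a morphism intertwines the actions of `*J`. -/
theorem jmat_mul_homM (f₀ : V →+ V') (f₁ : ℛ.decomp.LDual → V → V')
    (hf : ∀ (s : ℛ.decomp.S) m, f₀ (op s • m) = op s • f₀ m)
    (hc : ∀ γ m, a'.act γ (f₀ m) = f₀ (a.act γ m) -
      ∑ i, a'.act ((B.p i : ℛ.Inc) • γ) (f₁ (B.γ i) m)) :
    jmat b' a' B * homM b b' B f₀ f₁ = homM b b' B f₀ f₁ * jmat b a B := by
  ext1 l k
  set p : Idx d → ℛ.decomp.J := fun j => ∑ i, b'.c j (f₁ (B.γ i) (b.vec k)) • B.p i with hp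
  have hX : ∀ j, homM b b' B f₀ f₁ j k = (b'.c j (f₀ (b.vec k)) : ℛ.Inc) + (p j : ℛ.Inc) :=
    fun j => rfl
  have h1 : (homM b b' B f₀ f₁ * jmat b a B) l k =
      ∑ r, (b'.c l (f₀ (b.vec r)) : ℛ.Inc) * jmat b a B r k := by
    rw [Matrix.mul_apply]
    refine Finset.sum_congr rfl fun r _ => ?_
    change (_ + ((_ : ℛ.decomp.J) : ℛ.Inc)) * _ = _
    rw [add_mul, J_mul_jmat, add_zero]
  have hJ1 : (jmat b' a' B * homM b b' B f₀ f₁) l k ∈ ℛ.decomp.J := by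
    rw [Matrix.mul_apply]
    exact Submodule.sum_mem _ fun j _ => ℛ.decomp.mul_right _ (Subtype.property _)
  have hJ2 : (homM b b' B f₀ f₁ * jmat b a B) l k ∈ ℛ.decomp.J := by
    rw [Matrix.mul_apply]
    exact Submodule.sum_mem _ fun j _ => ℛ.decomp.mul_left _ (Subtype.property _)
  -- Both products have entries in `J`, which `*J` separates, so the identity becomes the
  -- compatibility condition evaluated at each `γ`.
  refine congrArg Subtype.val (ext_exd B (j := ⟨_, hJ1⟩) (j' := ⟨_, hJ2⟩) fun γ => ?_)
  change exd γ ((jmat b' a' B * homM b b' B f₀ f₁) l k) =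
    exd γ ((homM b b' B f₀ f₁ * jmat b a B) l k)
  have e := congrArg (b'.c l) (hc γ (b.vec k))
  rw [c_act b' a' B, map_sub, eq_sub_iff_add_eq, map_sum (b'.c l)] at e
  have e1 : b'.c l (f₀ (a.act γ (b.vec k))) = exd γ ((homM b b' B f₀ f₁ * jmat b a B) l k) := by
    conv_lhs => rw [← b.sum_c (a.act γ (b.vec k)), map_sum, map_sum]
    rw [h1, map_sum]
    exact Finset.sum_congr rfl fun r _ => by rw [hf, b'.c_op_smul, ← exd_jmat b a B, exd_coe_mul]
  have e2 : ∑ i, b'.c l (a'.act ((B.p i : ℛ.Inc) • γ) (f₁ (B.γ i) (b.vec k))) =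
      exd γ (∑ j, jmat b' a' B l j * (p j : ℛ.Inc)) := by
    simp only [c_act b' a' B, map_sum]
    rw [Finset.sum_comm]
    refine Finset.sum_congr rfl fun j _ => ?_
    rw [hp]
    simp only [Submodule.coe_sum, Finset.mul_sum, map_sum]
    refine Finset.sum_congr rfl fun i _ => ?_
    obtain ⟨q, hq⟩ := jmat_mem b' a' B l j
    rw [hq]
    change exd ((B.p i : ℛ.Inc) • γ) ((Decomp.rmul q _ : ℛ.decomp.J) : ℛ.Inc) = _
    rw [smul_exd_coe_J]
    congr 1
    exact mul_assoc _ _ _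
  rw [← e1, ← e, e2, ← map_add, ← Finset.sum_add_distrib, Matrix.mul_apply]
  simp only [hX, mul_add]

end

end MultSystem

open GrTensor Ditalgebra Decomp

namespace MultSystem

variable {K : Type u} {A : Type v} {Q : Type w} [Field K] [Ring A] [Algebra K A] [PartialOrder Q]
  {ℛ : MultSystem K A Q} [Fintype Q] [OrderBot Q] {B : ℛ.decomp.DualBasis}

/-! ### Objects of `mod 𝒟ᵉ` as right `S`-modules with an action of `*J` -/

namespace ModDe

variable (M N : ModDe.{u, v, w, x} B)

/-- On an object of `mod 𝒟ᵉ`, the action of `R` is induced by the action of `S`. -/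
theorem actR_eq (m : M.M.V) (r : ℛ.decomp.RR) :
    Ditalgebra.Rep.actR m r = op (r 0 * (1 - eS ⊥ 1) + r 1 * eS ⊥ 1) • m := by
  -- Modulo the multiples of `1 - e`, which kill `M`, every element of `R` is congruent to a
  -- constant pair.
  have h : r = (fun _ => r 0 * (1 - eS ⊥ 1) + r 1 * eS ⊥ 1) +
      (1 - ℛ.idemE) * ![r 0 - r 1, r 1 - r 0] := by
    have h0 := eS_one_comm ⊥ (r 0)
    have h1 := eS_one_comm ⊥ (r 1)
    funext i
    fin_cases i
    · simp only [idemE, Pi.add_apply, Pi.mul_apply, Pi.sub_apply, Pi.one_apply, Fin.zero_eta,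
        Matrix.cons_val_zero, sub_sub_cancel, mul_sub, h0, h1, _root_.mul_one]
      abel
    · simp only [idemE, Pi.add_apply, Pi.mul_apply, Pi.sub_apply, Fin.mk_one,
        Matrix.cons_val_one, Matrix.cons_val_fin_one, sub_mul, mul_sub, h0, h1, _root_.mul_one,
        _root_.one_mul]
      abel
  conv_lhs => rw [h]
  rw [actR_add, actR_mul, M.killed, zero_actR, add_zero]
  rfl

theorem actR_eR (m : M.M.V) (y : Q) (r : ℛ.Pt y) :
    Ditalgebra.Rep.actR m (eR ℛ y r) = op (eS y r) • m := by
  rw [actR_eq]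
  congr 2
  by_cases h : y = ⊥
  · subst h
    simp only [eR, if_pos, Matrix.cons_val_zero, Matrix.cons_val_one, Matrix.cons_val_fin_one,
      zero_mul, zero_add, ← eS_mul, _root_.mul_one]
  · simp only [eR, if_neg h, Matrix.cons_val_zero, Matrix.cons_val_one, Matrix.cons_val_fin_one,
      zero_mul, add_zero, mul_sub, _root_.mul_one, eS_mul_of_ne h, sub_zero]

/-- The action of `w_{1,2} *J` on an object of `mod 𝒟ᵉ`. -/
noncomputable def toJAct : ℛ.JAct M.M.V where
  act := jact M.M
  act_op_smul γ s m := jact_op_smul s γ m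
  op_smul_act γ s m := op_smul_jact s γ m
  e0_act γ m := by
    -- Here `w_{1,2} γ w₁ = 0`, while `w₁` acts on `M` as `1 - e₀`; hence `e₀` fixes the image of
    -- `w_{1,2} γ`.
    have h := actR_jact ![1, 0] γ m
    have h0 : op ((![1, 0] : ℛ.decomp.RR) 1) • γ = 0 := zero_smul (ℛ.decomp.S)ᵐᵒᵖ γ
    rw [h0, map_zero, actR_eq] at h
    simp only [Matrix.cons_val_zero, Matrix.cons_val_one, Matrix.cons_val_fin_one, zero_mul,
      add_zero, _root_.one_mul, MulOpposite.op_sub, MulOpposite.op_one, sub_smul, one_smul,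
      AddMonoidHom.zero_apply] at h
    exact (sub_eq_zero.mp h).symm

-- Since `w₁ w₂ = 0` and `w₁` acts as `1 - e₀`, the value of `f¹(w₂ γ)` at `m` equals its value at
-- `m e₀`. That value is `f¹(w₂ e₀ γ)(m)`, and `e₀ γ = 0`.
variable {M N} in
theorem homW2_eq_zero (f : Hom M.M N.M) (γ : ℛ.decomp.LDual) (m : M.M.V) :
    homW2 f γ m = 0 := by
  have h := homW2_actR f ![0, 1] γ m
  have h2 := homW2_actR f ![1, 0] γ m
  have h3 := homW2_actR f (fun _ => eS ⊥ 1) γ m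
  rw [e0_smul, map_zero, actR_eq] at h3
  rw [actR_eq] at h2
  simp only [Matrix.cons_val_zero, Matrix.cons_val_one, Matrix.cons_val_fin_one, zero_mul,
      add_zero, _root_.one_mul, MulOpposite.op_sub, MulOpposite.op_one, sub_smul, one_smul,
      map_sub, ZeroMemClass.coe_zero, zero_smul, map_zero, LinearMap.zero_apply] at h2
  rw [sub_eq_zero.mp h2]
  refine Eq.trans ?_ h3
  congr 2
  rw [mul_sub, _root_.mul_one, ← eS_mul, _root_.mul_one, sub_self, zero_add]

variable {M N} in
theorem jact_f₀_eq (f : Hom M.M N.M) (γ : ℛ.decomp.LDual) (m : M.M.V) :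
    N.toJAct.act γ (f.f₀ m) = f.f₀ (M.toJAct.act γ m) -
      ∑ i, N.toJAct.act ((B.p i : ℛ.Inc) • γ) (homW1 f (B.γ i) m) := by
  refine (jact_f₀ f γ m).trans ?_
  simp only [homW2_eq_zero, Finset.sum_const_zero, zero_sub]
  exact (sub_eq_add_neg _ _).symm

section LocalBasis

variable {M} (b : M.LocalBasis)

theorem smul_e_mem_comp (y : Q) (m : M.M.V) : op (eS y 1 : ℛ.decomp.S) • m ∈ M.comp y :=
  ⟨m, M.actR_eR m y 1⟩

theorem smul_e_of_mem_comp {y : Q} {m : M.M.V} (h : m ∈ M.comp y) :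
    op (eS y 1 : ℛ.decomp.S) • m = m := by
  obtain ⟨n, rfl⟩ := h
  simp only [actR_eR]
  rw [← mul_smul, ← MulOpposite.op_mul, ← eS_mul, _root_.mul_one]

theorem LocalBasis.coord_spec (y : Q) (m : M.comp y) :
    ∑ i, op (eS y (b.coord y m i) : ℛ.decomp.S) • b.vec y i = m := by
  refine Eq.trans ?_ (b.basis y m m.2).choose_spec.1.symm
  exact Finset.sum_congr rfl fun i _ => (M.actR_eR _ _ _).symm

theorem LocalBasis.coord_unique (y : Q) (m : M.comp y) (r : Fin (b.dim y) → ℛ.Pt y)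
    (h : ∑ i, op (eS y (r i) : ℛ.decomp.S) • b.vec y i = m) : b.coord y m = r := by
  refine ((b.basis y m m.2).choose_spec.2 r ?_).symm
  exact h.symm.trans (Finset.sum_congr rfl fun i _ => (M.actR_eR _ _ _).symm)

/-- The coordinates with respect to a local basis. -/
noncomputable def LocalBasis.coordS (k : Idx b.dim) :
    M.M.V →ₗ[(ℛ.decomp.S)ᵐᵒᵖ] ℛ.decomp.S where
  toFun m := eS k.1 (b.coord k.1 ⟨_, smul_e_mem_comp k.1 m⟩ k.2)
  map_add' m n := by
    rw [← eS_add]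
    refine congrArg (eS k.1) (congrFun (b.coord_unique k.1 _ (b.coord k.1 _ + b.coord k.1 _) ?_)
      k.2)
    simp only [Pi.add_apply, eS_add, MulOpposite.op_add, add_smul, Finset.sum_add_distrib,
      b.coord_spec, smul_add]
  map_smul' s m := by
    change _ = eS k.1 _ * s.unop
    rw [eS_mul_right]
    refine congrArg (eS k.1) (congrFun (b.coord_unique k.1 _
      (fun i => b.coord k.1 ⟨_, smul_e_mem_comp k.1 m⟩ i * ent k.1 (s.unop : ℛ.Inc)) ?_) k.2)
    simp only [← eS_mul_right]
    have h : ∀ t : ℛ.decomp.S, op (t * s.unop) = s * op t := fun t => rfl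
    simp only [h, mul_smul, ← Finset.smul_sum, b.coord_spec]
    have h2 : s = op s.unop := rfl
    rw [h2, ← mul_smul, ← mul_smul, ← MulOpposite.op_mul, ← MulOpposite.op_mul, eS_one_comm]

theorem LocalBasis.coordS_apply (k : Idx b.dim) (m : M.M.V) :
    b.coordS k m = eS k.1 (b.coord k.1 ⟨_, smul_e_mem_comp k.1 m⟩ k.2) := rfl

open scoped Classical in
theorem LocalBasis.coord_vec (y : Q) (j : Fin (b.dim y)) :
    b.coord y ⟨b.vec y j, b.mem y j⟩ = Pi.single j 1 := by
  refine b.coord_unique _ _ _ ?_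
  rw [Finset.sum_eq_single j, Pi.single_eq_same]
  · exact smul_e_of_mem_comp (b.mem y j)
  · intro i _ hi
    have h0 : eS y (0 : ℛ.Pt y) = 0 :=
      map_zero (AddMonoidHom.mk' (fun r : ℛ.Pt y => eS y r) fun r s => eS_add y r s)
    rw [Pi.single_eq_of_ne hi, h0, MulOpposite.op_zero, zero_smul]
  · simp

/-- A local basis as a dual basis over `S`. -/
noncomputable def LocalBasis.toSBasis : ℛ.SBasis M.M.V b.dim where
  vec k := b.vec k.1 k.2
  c := b.coordS
  sum_c m := by
    rw [Fintype.sum_sigma]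
    have h : ∀ y, ∑ i, op (b.coordS ⟨y, i⟩ m) • b.vec y i = op (eS y 1 : ℛ.decomp.S) • m :=
      fun y => b.coord_spec y ⟨_, smul_e_mem_comp y m⟩
    refine (Finset.sum_congr rfl fun y _ => h y).trans ?_
    rw [← Finset.sum_smul, ← Finset.op_sum, sum_eS_one, MulOpposite.op_one, one_smul]
  c_self k := by
    classical
    rw [b.coordS_apply]
    have h : (⟨_, smul_e_mem_comp k.1 (b.vec k.1 k.2)⟩ : M.comp k.1) =
      ⟨b.vec k.1 k.2, b.mem k.1 k.2⟩ := Subtype.ext (smul_e_of_mem_comp (b.mem k.1 k.2))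
    rw [h, b.coord_vec, Pi.single_eq_same]
  c_ne := by
    classical
    rintro ⟨y, l⟩ ⟨z, k⟩ hlk
    have h0 : eS y (0 : ℛ.Pt y) = 0 :=
      map_zero (AddMonoidHom.mk' (fun r : ℛ.Pt y => eS y r) fun r s => eS_add y r s)
    by_cases h : y = z
    · subst h
      rw [b.coordS_apply]
      have h : (⟨_, smul_e_mem_comp y (b.vec y k)⟩ : M.comp y) =
        ⟨b.vec y k, b.mem y k⟩ := Subtype.ext (smul_e_of_mem_comp (b.mem y k))
      simp only [h, b.coord_vec]
      rw [Pi.single_eq_of_ne fun e => hlk (by rw [e]), h0]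
    · have h1 : b.coord y ⟨_, smul_e_mem_comp y (b.vec z k)⟩ = 0 := by
        refine b.coord_unique _ _ _ ?_
        simp only [Pi.zero_apply, h0, MulOpposite.op_zero, zero_smul, Finset.sum_const_zero]
        rw [← smul_e_of_mem_comp (b.mem z k), ← mul_smul, ← MulOpposite.op_mul,
          eS_mul_of_ne (Ne.symm h), MulOpposite.op_zero, zero_smul]
      rw [b.coordS_apply]
      simp only [h1, Pi.zero_apply, h0]
  e_c k m := by
    rw [b.coordS_apply, ← eS_mul, _root_.one_mul]

/-- Applying `û_{0,z}` to an entry of `jmat` reads off its coefficient at `e_{0,z} v_{0,z}`; by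
`exd_jmat` the same value is a coordinate of the basis vector multiplied by `w_{1,2} û_{0,z}`. -/
theorem gmat_toSBasis (g : ℛ.Gens) (z : Q) :
    gmat b.toSBasis M.toJAct B g z = b.matrix g z := by
  ext1 j k
  have h := exd_jmat b.toSBasis M.toJAct B (g.uhat z) ⟨⊥, j⟩ ⟨z, k⟩
  obtain ⟨q, hq⟩ := jmat_mem b.toSBasis M.toJAct B ⟨⊥, j⟩ ⟨z, k⟩
  have h2 : exd (g.uhat z) (jmat b.toSBasis M.toJAct B ⟨⊥, j⟩ ⟨z, k⟩) =
      eS ⊥ (gmat b.toSBasis M.toJAct B g z j k) := by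
    rw [gmat, Matrix.of_apply]
    simp only [hq]
    rw [exd_coe_J]; rfl
  have h3 : (⟨_, smul_e_mem_comp ⊥ (jact M.M (g.uhat z) (b.vec z k))⟩ : M.comp ⊥) =
      ⟨_, g.act_uhat_mem M z (b.vec z k)⟩ :=
    Subtype.ext (smul_e_of_mem_comp (g.act_uhat_mem M z (b.vec z k)))
  have h4 : b.toSBasis.c ⟨⊥, j⟩ (M.toJAct.act (g.uhat z) (b.toSBasis.vec ⟨z, k⟩)) =
      eS ⊥ (b.matrix g z j k) :=
    congrArg (fun n : M.comp ⊥ => (eS ⊥ (b.coord ⊥ n j) : ℛ.decomp.S)) h3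
  rw [h2, h4] at h
  refine Pt.ext ?_
  rw [← eS_entry_self ⊥ (gmat b.toSBasis M.toJAct B g z j k), h, eS_entry_self]

end LocalBasis

end ModDe

end MultSystem

open GrTensor Ditalgebra Decomp

namespace MultSystem

variable {K : Type u} {A : Type v} {Q : Type w} [Field K] [Ring A] [Algebra K A] [PartialOrder Q]
  {ℛ : MultSystem K A Q} [Fintype Q] [OrderBot Q] {B : ℛ.decomp.DualBasis}

namespace ModDe

variable {M N : ModDe.{u, v, w, x} B}

/-! ### Morphisms of `mod 𝒟ᵉ` from intertwining matrices -/

section construction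

open scoped Classical

variable {d d' : Q → ℕ}

section

variable (b : ℛ.SBasis M.M.V d) (b' : ℛ.SBasis N.M.V d') (X : Matrix (Idx d') (Idx d) ℛ.Inc)

/-- The values on the generators of degree one of the morphism given by a matrix over `Λ`. -/
noncomputable def matGen : ℛ.decomp.Blk 0 0 × ℛ.decomp.Blk 1 1 →+ (M.M.V →ₗ[K] N.M.V) :=
  (matHom₁ b b' X).comp (AddMonoidHom.fst (ℛ.decomp.Blk 0 0) (ℛ.decomp.Blk 1 1))

/-- With `e₀` written first in the correction term, it acts first, and both the source and the image
of `matHom₁` are killed there. Only `r 0` is left. -/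
theorem idem_split (r : ℛ.decomp.RR) :
    r 0 * (1 - eS ⊥ 1) + r 1 * eS ⊥ 1 = r 0 + eS ⊥ 1 * (r 1 - r 0) := by
  rw [eS_one_comm, mul_sub, sub_mul, _root_.mul_one]; abel

theorem matGen_smul (r : ℛ.decomp.RR) (y : ℛ.decomp.Blk 0 0 × ℛ.decomp.Blk 1 1) (m : M.M.V) :
    matGen b b' X (r • y) m = matGen b b' X y (Ditalgebra.Rep.actR m r) := by
  have h1 : matGen b b' X y (Ditalgebra.Rep.actR m r) =
      matHom₁ b b' X (show ℛ.decomp.LDual from y.1) (op (r 0) • m) := by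
    rw [actR_eq, idem_split, MulOpposite.op_add, add_smul, map_add, MulOpposite.op_mul, mul_smul]
    refine (congrArg _ ?_).trans (add_zero _)
    refine (matHom₁_op_smul b b' X _ _ _).trans ?_
    exact matHom₁_e0 _ _
  rw [h1]
  exact (matHom₁_op_smul b b' X _ _ _).symm

theorem matGen_op_smul (h0 : ∀ j k, ((eS ⊥ 1 : ℛ.decomp.S) : ℛ.Inc) * X j k =
      X j k * ((eS ⊥ 1 : ℛ.decomp.S) : ℛ.Inc)) (r : ℛ.decomp.RR)
    (y : ℛ.decomp.Blk 0 0 × ℛ.decomp.Blk 1 1) (m : M.M.V) :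
    matGen b b' X (op r • y) m = Ditalgebra.Rep.actR (matGen b b' X y m) r := by
  have h1 : Ditalgebra.Rep.actR (matGen b b' X y m) r =
      op (r 0) • matHom₁ b b' X (show ℛ.decomp.LDual from y.1) m := by
    rw [actR_eq, idem_split, MulOpposite.op_add, add_smul, MulOpposite.op_mul, mul_smul]
    refine (congrArg _ ?_).trans (add_zero _)
    refine (congrArg _ (e0_matHom₁ h0 _ _)).trans (smul_zero _)
  rw [h1]
  exact (op_smul_matHom₁ b b' X _ _ _).symm

theorem act₀_matHom₀ (h0 : ∀ j k, ((eS ⊥ 1 : ℛ.decomp.S) : ℛ.Inc) * X j k =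
      X j k * ((eS ⊥ 1 : ℛ.decomp.S) : ℛ.Inc))
    (hX : jmat b' N.toJAct B * X = X * jmat b M.toJAct B) (γ : ℛ.decomp.Blk 0 1) (m : M.M.V) :
    Ditalgebra.Rep.act₀ (matHom₀ b b' X m) γ = matHom₀ b b' X (Ditalgebra.Rep.act₀ m γ) +
      bimodExt (matGen b b' X) (matGen_smul b b' X) (matGen_op_smul b b' X h0)
        ((drozd B).δ (γ, 0)) m := by
  refine (act_matHom₀ M.toJAct N.toJAct B hX γ m).trans ?_
  refine (sub_eq_add_neg _ _).trans (congrArg (matHom₀ b b' X (M.toJAct.act γ m) + ·) ?_)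
  refine Eq.trans ?_ (bimodExt_δ (B := B) _ _ _ γ m).symm
  refine (zero_sub _).symm.trans (congrArg (· - _) (Finset.sum_eq_zero fun i _ => ?_).symm)
  exact LinearMap.congr_fun (map_zero (matHom₁ b b' X)) _

/-- The morphism given by a matrix over `Λ`. -/
noncomputable def matHom (h0 : ∀ j k, ((eS ⊥ 1 : ℛ.decomp.S) : ℛ.Inc) * X j k =
      X j k * ((eS ⊥ 1 : ℛ.decomp.S) : ℛ.Inc))
    (hX : jmat b' N.toJAct B * X = X * jmat b M.toJAct B) : Hom M.M N.M :=
  Hom.ofGen (matGen b b' X) (matGen_smul b b' X) (matGen_op_smul b b' X h0)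
    (matHom₀ b b' X)
    (fun m r => by rw [actR_eq, actR_eq, matHom₀_op_smul])
    (act₀_matHom₀ b b' X h0 hX)

theorem homW1_matHom (h0) (hX) (γ : ℛ.decomp.LDual) :
    homW1 (matHom (M := M) (N := N) b b' X h0 hX) γ = matHom₁ b b' X γ :=
  Hom.ofGen_f₁_of₁ (matGen b b' X) (matGen_smul b b' X) (matGen_op_smul b b' X h0)
    (matHom₀ b b' X) (fun m r => by rw [actR_eq, actR_eq, matHom₀_op_smul])
    (act₀_matHom₀ b b' X h0 hX) ((show ℛ.decomp.Blk 0 0 from γ), 0)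

end

theorem gen₁_eq_homW1 (f : Hom M.M N.M) (y : ℛ.decomp.Blk 0 0 × ℛ.decomp.Blk 1 1) :
    f.gen₁ y = homW1 f y.1 := by
  refine (gen₁_eq f y.1 y.2).trans ?_
  rw [show homW2 f y.2 = 0 from LinearMap.ext fun m => homW2_eq_zero _ _ _, add_zero]

theorem comp₂_δ_eq {L : ModDe.{u, v, w, x} B} (f : Hom M.M N.M) (g : Hom N.M L.M)
    (y : ℛ.decomp.Blk 0 0 × ℛ.decomp.Blk 1 1) (m : M.M.V) :
    comp₂ f g ((drozd B).δ (0, y)) m =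
      -∑ i, homW1 g ((B.p i : ℛ.Inc) • (show ℛ.decomp.LDual from y.1)) (homW1 f (B.γ i) m) := by
  refine (comp₂_δ f g y.1 y.2 m).trans ?_
  refine (congrArg _ (Finset.sum_eq_zero fun i _ => ?_)).trans (sub_zero _)
  exact homW2_eq_zero _ _ _

/-- Everything at the place `w₂` vanishes, so the formula needs checking only on `w₁ *J`. The minus
sign in `d(w₁ γ)` cancels the one in the composition law. -/
theorem isComp_of_homW1 {L : ModDe.{u, v, w, x} B} (f : Hom M.M N.M) (g : Hom N.M L.M)
    (h : Hom M.M L.M) (h0 : ∀ m, h.f₀ m = g.f₀ (f.f₀ m))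
    (h1 : ∀ (γ : ℛ.decomp.LDual) (m : M.M.V), homW1 h γ m = homW1 g γ (f.f₀ m) +
      g.f₀ (homW1 f γ m) + ∑ i, homW1 g ((B.p i : ℛ.Inc) • γ) (homW1 f (B.γ i) m)) :
    f.IsComp g h := by
  refine Hom.isComp_of_gen f g h (LinearMap.ext h0) fun y m => ?_
  refine ((LinearMap.congr_fun (gen₁_eq_homW1 h y) m).trans (h1 y.1 m)).trans ?_
  refine Eq.trans ?_ (congrArg₂ (· - ·) (congrArg₂ (· + ·)
    (LinearMap.congr_fun (gen₁_eq_homW1 g y) (f.f₀ m))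
    (congrArg g.f₀ (LinearMap.congr_fun (gen₁_eq_homW1 f y) m)))
    (comp₂_δ_eq f g y m)).symm
  exact (sub_neg_eq_add _ _).symm

theorem homW1_id (γ : ℛ.decomp.LDual) (m : M.M.V) : homW1 (Hom.id M.M) γ m = 0 := rfl

theorem isComp_matHom {b : ℛ.SBasis M.M.V d} {b' : ℛ.SBasis N.M.V d'}
    {X : Matrix (Idx d') (Idx d) ℛ.Inc} {Y : Matrix (Idx d) (Idx d') ℛ.Inc}
    (hE : ∀ j k, ((eS j.1 1 : ℛ.decomp.S) : ℛ.Inc) * X j k =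
      X j k * ((eS k.1 1 : ℛ.decomp.S) : ℛ.Inc)) (h : Y * X = 1) (h0) (hX) (h0') (hX') :
    (matHom b b' X h0 hX).IsComp (matHom b' b Y h0' hX') (Hom.id M.M) := by
  refine isComp_of_homW1 _ _ _ (fun m => (matHom₀_matHom₀ (b := b) (b' := b') hE h m).symm) fun γ m => ?_
  refine (homW1_id γ m).trans ((matHom₁_comp (b := b) (b' := b') B hE h γ m).symm.trans ?_)
  rw [homW1_matHom, homW1_matHom]
  refine congrArg₂ (· + ·) rfl (Finset.sum_congr rfl fun i _ => ?_)
  rw [homW1_matHom, homW1_matHom]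

end construction

end ModDe

end MultSystem

/-! ### Isomorphism and the matrix problem -/

open GrTensor Ditalgebra Decomp

theorem IsDivRing.invariantBasisNumber {D : Type*} [Ring D] (h : IsDivRing D) :
    InvariantBasisNumber D := by
  have := h.1
  let _ : DivisionRing D := DivisionRing.ofIsUnitOrEqZero fun a =>
    or_iff_not_imp_right.mpr (h.2 a)
  infer_instance

namespace MultSystem

variable {K : Type u} {A : Type v} {Q : Type w} [Field K] [Ring A] [Algebra K A] [PartialOrder Q]
  {ℛ : MultSystem K A Q} [Fintype Q] [OrderBot Q] {B : ℛ.decomp.DualBasis}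

namespace ModDe

variable {M N : ModDe.{u, v, w, x} B}

open scoped Classical

theorem f₀_cancel {f : Hom M.M N.M} {g : Hom N.M M.M} (h : f.IsComp g (Hom.id M.M)) (m : M.M.V) :
    g.f₀ (f.f₀ m) = m := (LinearMap.congr_fun h.1 m).symm

section

variable {d : Q → ℕ} (b : ℛ.SBasis M.M.V d) (b' : ℛ.SBasis N.M.V d) (g : ℛ.Gens)

/-- The matrix of an isomorphism intertwines `jmat`, which gives the equation with the block at `0`
on the side of `M`. Its inverse, the block at `0` of the inverse morphism, is moved across and
becomes `T₀`. -/
theorem exists_matrices_of_iso (h : M.Iso N) :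
    ∃ T₀ : Matrix (Fin (d ⊥)) (Fin (d ⊥)) (ℛ.Pt ⊥),
    ∃ T : ∀ z, Matrix (Fin (d z)) (Fin (d z)) (ℛ.Pt z),
    ∃ U : ∀ y z, Matrix (Fin (d y)) (Fin (d z)) (ℛ.R y z),
      IsUnit T₀ ∧ (∀ z, ⊥ < z → IsUnit (T z)) ∧ ∀ z, ⊥ < z →
        gmat b M.toJAct B g z = T₀ * gmat b' N.toJAct B g z * (T z).map (g.phi z) +
          ∑ y ∈ below z, T₀ * gmat b' N.toJAct B g y * (U y z).map (g.chi y z) := by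
  obtain ⟨f, f', hf, hf'⟩ := h
  have h1 := coordM_mul b b' (f := f.f₀.toAddMonoidHom) (f' := f'.f₀.toAddMonoidHom)
    (f₀_op_smul f) (f₀_op_smul f') (f₀_cancel hf)
  have h2 := coordM_mul b' b (f := f'.f₀.toAddMonoidHom) (f' := f.f₀.toAddMonoidHom)
    (f₀_op_smul f') (f₀_op_smul f) (f₀_cancel hf')
  have hX := jmat_mul_homM b b' M.toJAct N.toJAct B f.f₀.toAddMonoidHom
    (fun γ m => homW1 f γ m) (f₀_op_smul f) (jact_f₀_eq f)
  refine ⟨coordM b' b f'.f₀.toAddMonoidHom ⊥, fun z => coordM b b' f.f₀.toAddMonoidHom z,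
    blkU (homM b b' B f.f₀.toAddMonoidHom fun γ m => homW1 f γ m),
    ⟨⟨_, _, h1 ⊥, h2 ⊥⟩, rfl⟩, fun z _ => ⟨⟨_, _, h2 z, h1 z⟩, rfl⟩, fun z _ => ?_⟩
  have h3 := gmat_eq b b' M.toJAct N.toJAct B g hX z
  rw [blkT_homM, blkT_homM] at h3
  have h4 := congrArg (coordM b' b f'.f₀.toAddMonoidHom ⊥ * ·) h3
  simp only [Matrix.mul_add, ← Matrix.mul_assoc, h1, Matrix.one_mul, Matrix.mul_sum] at h4
  exact h4

/-- The blocks assemble into an invertible intertwiner `X` over `Λ`. Its inverse commutes with the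
same idempotents and intertwines in the other direction, so both define morphisms, and these are
mutually inverse. -/
theorem iso_of_matrices {T₀ : Matrix (Fin (d ⊥)) (Fin (d ⊥)) (ℛ.Pt ⊥)}
    {T : ∀ z, Matrix (Fin (d z)) (Fin (d z)) (ℛ.Pt z)}
    {U : ∀ y z, Matrix (Fin (d y)) (Fin (d z)) (ℛ.R y z)}
    (hT₀ : IsUnit T₀) (hT : ∀ z, ⊥ < z → IsUnit (T z)) (h : ∀ z, ⊥ < z →
        gmat b M.toJAct B g z = T₀ * gmat b' N.toJAct B g z * (T z).map (g.phi z) +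
          ∑ y ∈ below z, T₀ * gmat b' N.toJAct B g y * (U y z).map (g.chi y z)) :
    M.Iso N := by
  obtain ⟨T₀, rfl⟩ := hT₀
  -- The value of `T` at `0` is unconstrained; it is replaced by the block that the intertwining
  -- relation demands.
  set T' := Function.update T ⊥ (↑T₀⁻¹ : Matrix (Fin (d ⊥)) (Fin (d ⊥)) (ℛ.Pt ⊥)) with hT'
  have h1 : T' ⊥ = ↑T₀⁻¹ := Function.update_self _ _ _
  have h2 : ∀ z, ⊥ < z → T' z = T z := fun z hz => Function.update_of_ne hz.ne' _ _
  obtain ⟨X, hX⟩ := isUnit_blockM (T := T') (fun z => by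
    by_cases hz : z = ⊥
    · subst hz; rw [h1]; exact Units.isUnit _
    · rw [h2 z (bot_lt_iff_ne_bot.mpr hz)]; exact hT z (bot_lt_iff_ne_bot.mpr hz)) U
  have hE := blockM_commute_e T' U
  have h0 := blockM_commute_e0 T' U
  have hJ := jmat_mul_eq b b' M.toJAct N.toJAct B g hE h0 fun z hz => by
    rw [blkT_blockM, blkT_blockM, h1, h2 z hz, h z hz, Matrix.mul_add, Matrix.mul_sum]
    simp only [← Matrix.mul_assoc, Units.inv_mul, Matrix.one_mul]
    congr 1
    refine Finset.sum_congr rfl fun y hy => ?_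
    rw [blkU_blockM T' U (mem_below.mp hy).1 (mem_below.mp hy).2]
  rw [← hX] at hE h0 hJ
  have hJ' : jmat b M.toJAct B * (↑X⁻¹ : Matrix (Idx d) (Idx d) ℛ.Inc) =
      (↑X⁻¹ : Matrix (Idx d) (Idx d) ℛ.Inc) * jmat b' N.toJAct B := by
    rw [Units.eq_inv_mul_iff_mul_eq, ← mul_assoc, ← hJ, mul_assoc, Units.mul_inv,
      _root_.mul_one]
  have key : ∀ {Y : Matrix (Idx d) (Idx d) ℛ.Inc} {s : Idx d → ℛ.Inc},
      Commute (Matrix.diagonal s) Y → ∀ j k, s j * Y j k = Y j k * s k := fun hY j k => by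
    have := congrFun (congrFun hY.eq j) k
    rwa [Matrix.diagonal_mul, Matrix.mul_diagonal] at this
  exact ⟨matHom b b' X (key h0) hJ, matHom b' b _ (key h0.units_inv_right) hJ',
    isComp_matHom (key hE) X.inv_mul _ _ _ _,
    isComp_matHom (key hE.units_inv_right) X.mul_inv _ _ _ _⟩

end

/-- The blocks at `z` of `f⁰` and of its inverse are mutually inverse rectangular matrices over a
division ring, hence square. -/
theorem dim_eq_of_iso (hD : ∀ z, IsDivRing (ℛ.Pt z)) (bM : M.LocalBasis) (bN : N.LocalBasis)
    (h : M.Iso N) (z : Q) : bM.dim z = bN.dim z := by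
  obtain ⟨f, f', hf, hf'⟩ := h
  have := (hD z).invariantBasisNumber
  have h1 := coordM_mul bM.toSBasis bN.toSBasis (f := f.f₀.toAddMonoidHom)
    (f' := f'.f₀.toAddMonoidHom) (f₀_op_smul f) (f₀_op_smul f') (f₀_cancel hf) z
  have h2 := coordM_mul bN.toSBasis bM.toSBasis (f := f'.f₀.toAddMonoidHom)
    (f' := f.f₀.toAddMonoidHom) (f₀_op_smul f') (f₀_op_smul f) (f₀_cancel hf') z
  simpa using Matrix.square_of_invertible _ _ h1 h2

/-- The classification of the objects of `mod 𝒟ᵉ` by a matrix problem. -/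
theorem iso_iff_matrices (hD : ∀ z, IsDivRing (ℛ.Pt z)) (g : ℛ.Gens) (bM : M.LocalBasis)
    (bN : N.LocalBasis) : M.Iso N ↔
      ∃ hd : ∀ z, bM.dim z = bN.dim z,
      ∃ T₀ : Matrix (Fin (bM.dim ⊥)) (Fin (bM.dim ⊥)) (ℛ.Pt ⊥),
      ∃ T : ∀ z, Matrix (Fin (bM.dim z)) (Fin (bM.dim z)) (ℛ.Pt z),
      ∃ U : ∀ y z, Matrix (Fin (bM.dim y)) (Fin (bM.dim z)) (ℛ.R y z),
        IsUnit T₀ ∧ (∀ z, ⊥ < z → IsUnit (T z)) ∧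
        ∀ z, ⊥ < z →
          bM.matrix g z =
            T₀ * (bN.matrix g z).submatrix (Fin.cast (hd ⊥)) (Fin.cast (hd z)) *
              (T z).map (g.phi z) +
            ∑ y ∈ below z,
              T₀ * (bN.matrix g y).submatrix (Fin.cast (hd ⊥)) (Fin.cast (hd y)) *
                (U y z).map (g.chi y z) := by
  constructor
  · intro h
    have hd := dim_eq_of_iso hD bM bN h
    refine ⟨hd, ?_⟩
    -- Taking the basis apart frees its dimension vector, so the two vectors can be identified and
    -- the casts of indices disappear.
    obtain ⟨dim, vec, mem, basis⟩ := bN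
    obtain rfl : bM.dim = dim := funext hd
    obtain ⟨T₀, T, U, h1, h2, h3⟩ := exists_matrices_of_iso bM.toSBasis
      (LocalBasis.toSBasis (⟨bM.dim, vec, mem, basis⟩ : N.LocalBasis)) g h
    refine ⟨T₀, T, U, h1, h2, fun z hz => ?_⟩
    have h4 := h3 z hz
    simp only [gmat_toSBasis] at h4
    exact h4
  · rintro ⟨hd, T₀, T, U, h1, h2, h3⟩
    obtain ⟨dim, vec, mem, basis⟩ := bN
    obtain rfl : bM.dim = dim := funext hd
    refine iso_of_matrices bM.toSBasis
      (LocalBasis.toSBasis (⟨bM.dim, vec, mem, basis⟩ : N.LocalBasis)) g (U := U) h1 h2 fun z hz => ?_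
    have h4 := h3 z hz
    simp only [← gmat_toSBasis] at h4
    exact h4

end ModDe

end MultSystem

/-! ### Rewriting the matrix problem over the ambient algebra -/

namespace MultSystem

variable {K : Type u} {A : Type v} {Q : Type w} [Field K] [Ring A] [Algebra K A] [PartialOrder Q]
  {ℛ : MultSystem K A Q}

/-- The inclusion of `ℛ_x` in `A`, if they have the same unit. -/
def Pt.valHom {z : Q} (h : ℛ.one z = 1) : ℛ.Pt z →+* A where
  toFun := Pt.val
  map_one' := h
  map_mul' _ _ := rfl
  map_zero' := rfl
  map_add' _ _ := rfl

theorem Pt.map_val_injective {m n : Type*} {z : Q} :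
    Function.Injective fun X : Matrix m n (ℛ.Pt z) => X.map Pt.val := fun _ _ h =>
  Matrix.ext fun j k => Pt.ext (congrFun (congrFun h j) k)

/-- Invertibility over `A` is not enough: the inverse must also have entries in `ℛ_z`, and is
therefore supplied explicitly. -/
theorem exists_isUnit_map_val {n : Type*} [Fintype n] [DecidableEq n] {z : Q} (h1 : ℛ.one z = 1)
    {X Y : Matrix n n A} (hX : ∀ j k, X j k ∈ ℛ.R z z) (hY : ∀ j k, Y j k ∈ ℛ.R z z)
    (hXY : X * Y = 1) (hYX : Y * X = 1) :
    ∃ T : Matrix n n (ℛ.Pt z), IsUnit T ∧ T.map Pt.val = X := by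
  have key : ∀ {X' Y' : Matrix n n A} (hX : ∀ j k, X' j k ∈ ℛ.R z z)
      (hY : ∀ j k, Y' j k ∈ ℛ.R z z), X' * Y' = 1 → (Matrix.of fun j k => Pt.mk (ℛ := ℛ) (X' j k) (hX j k)) *
        (Matrix.of fun j k => Pt.mk (Y' j k) (hY j k)) = 1 := fun hX hY h => by
    refine Pt.map_val_injective ?_
    refine (Matrix.map_mul (f := Pt.valHom h1)).trans (Eq.trans h ?_)
    exact ((Pt.valHom (ℛ := ℛ) h1).mapMatrix.map_one).symm
  exact ⟨_, ⟨⟨_, _, key hX hY hXY, key hY hX hYX⟩, rfl⟩, rfl⟩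

section

variable [OrderBot Q] {g : ℛ.Gens}

theorem Gens.val_phi (hv : ∀ z, g.v z = 1) (z : Q) (r : ℛ.Pt z) : (g.phi z r).val = r.val := by
  have h := g.phi_spec z r
  rwa [hv, _root_.mul_one, _root_.one_mul] at h

theorem Gens.val_chi [Fintype Q] (hv : ∀ z, g.v z = 1) (y z : Q) (r : ℛ.R y z) : (g.chi y z r).val = r := by
  have h := g.chi_spec y z r
  rwa [hv, hv, _root_.mul_one, _root_.one_mul] at h

open scoped Classical in
/-- The matrix equation over `ℛ_0`, rewritten as an equation over `A`. -/
theorem matrix_eq_iff [Fintype Q] (hv : ∀ z, g.v z = 1) (h1 : ℛ.one ⊥ = 1) {d : Q → ℕ} {z : Q}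
    (C : Matrix (Fin (d ⊥)) (Fin (d z)) (ℛ.Pt ⊥))
    (D : ∀ y, Matrix (Fin (d ⊥)) (Fin (d y)) (ℛ.Pt ⊥))
    (T₀ : Matrix (Fin (d ⊥)) (Fin (d ⊥)) (ℛ.Pt ⊥))
    (T : Matrix (Fin (d z)) (Fin (d z)) (ℛ.Pt z))
    (U : ∀ y, Matrix (Fin (d y)) (Fin (d z)) (ℛ.R y z)) :
    C = T₀ * D z * T.map (g.phi z) + ∑ y ∈ below z, T₀ * D y * (U y).map (g.chi y z) ↔
      C.map Pt.val = T₀.map Pt.val * (D z).map Pt.val * T.map Pt.val +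
        ∑ y ∈ below z, T₀.map Pt.val * (D y).map Pt.val * (U y).map Subtype.val := by
  have hm : ∀ {l m n : ℕ} (X : Matrix (Fin l) (Fin m) (ℛ.Pt ⊥))
      (Y : Matrix (Fin m) (Fin n) (ℛ.Pt ⊥)),
      (X * Y).map Pt.val = X.map Pt.val * Y.map Pt.val := fun X Y =>
    Matrix.map_mul (f := Pt.valHom h1)
  have hs : ∀ {m n : ℕ} (f : Q → Matrix (Fin m) (Fin n) (ℛ.Pt ⊥)),
      (∑ y ∈ below z, f y).map Pt.val = ∑ y ∈ below z, (f y).map Pt.val := fun f =>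
    map_sum (Pt.valHom h1 : ℛ.Pt ⊥ →+* A).toAddMonoidHom.mapMatrix f _
  have hT : (T.map (g.phi z)).map Pt.val = T.map Pt.val :=
    Matrix.ext fun j k => g.val_phi hv z _
  have hU : ∀ y, ((U y).map (g.chi y z)).map Pt.val = (U y).map Subtype.val := fun y =>
    Matrix.ext fun j k => g.val_chi hv y z _
  rw [← Pt.map_val_injective.eq_iff, Matrix.map_add _ fun _ _ => rfl, hs]
  simp only [hm, hT, hU]

end

end MultSystem

/-! ### The algebras at the points of a `p`-equipped poset -/

namespace PEquipped

variable {p : ℕ} {F : Type u} {G : Type v} {P : Type w} [Field F] [Field G] [Algebra F G]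
  [PartialOrder P] (E : PEquipped p P)

/-- Composing `z ≤^ℓ z` with itself gives `ℓ ≥ min (2ℓ - 1) p`, so `ℓ ≤ 1` or `ℓ ≥ p`. -/
theorem lev_self (z : P) : E.lev z z = 1 ∨ E.lev z z = p := by
  have h1 := E.one_le (le_refl z)
  have h2 := E.le_p (le_refl z)
  have h3 := E.comp (le_refl z) (le_refl z)
  omega

theorem mem_powSpan_one {ξ a : G} : a ∈ powSpan F ξ 1 ↔ ∃ c : F, algebraMap F G c = a := by
  have h : {a : G | ∃ i < 1, a = ξ ^ i} = {1} := by
    ext a; simp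
  rw [powSpan, h, Submodule.mem_span_singleton]
  simp only [Algebra.algebraMap_eq_smul_one]

variable (ξ : G) (hfin : Module.finrank F G = p) (hp : 1 ≤ p)
  (hξ : IntermediateField.adjoin F {ξ} = ⊤)

theorem mem_system_self (z : P) (a : G) : a ∈ (E.system ξ hfin hp hξ).R z z ↔
    E.lev z z = p ∨ ∃ c : F, algebraMap F G c = a := by
  rw [system_R _ _ _ _ _ le_rfl]
  by_cases h : E.lev z z = p
  · rw [h, powSpan_top ξ hfin hp hξ]; simp
  · rw [(E.lev_self z).resolve_right h, mem_powSpan_one]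
    exact ⟨Or.inr, fun h' => h'.resolve_left fun e => h ((E.lev_self z).resolve_right h ▸ e)⟩

/-- Each `𝒬_z` is all of `G` or the copy of `F` in it, and both are closed under inverses in `G`. -/
theorem isDivRing_system (z : P) : IsDivRing ((E.system ξ hfin hp hξ).Pt z) := by
  refine ⟨⟨0, 1, fun h => zero_ne_one (congrArg MultSystem.Pt.val h)⟩, fun a ha => ?_⟩
  have ha' : a.val ≠ 0 := fun h => ha (MultSystem.Pt.ext h)
  have hi : a.val⁻¹ ∈ (E.system ξ hfin hp hξ).R z z := by
    rw [mem_system_self]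
    refine ((E.mem_system_self ξ hfin hp hξ z a.val).mp a.val_mem).imp_right ?_
    rintro ⟨c, hc⟩
    exact ⟨c⁻¹, by rw [map_inv₀, hc]⟩
  exact ⟨⟨a, .mk _ hi, MultSystem.Pt.ext (mul_inv_cancel₀ ha'),
    MultSystem.Pt.ext (inv_mul_cancel₀ ha')⟩, rfl⟩

theorem isUnit_map_val {n : Type*} [Fintype n] [DecidableEq n] {z : P}
    {T : Matrix n n ((E.system ξ hfin hp hξ).Pt z)} (hT : IsUnit T) :
    IsUnit (T.map MultSystem.Pt.val) :=
  hT.map (MultSystem.Pt.valHom (ℛ := E.system ξ hfin hp hξ) (z := z) rfl).mapMatrix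

/-- Invertibility is decided by the determinant, which lies in `F` and is nonzero there exactly when
it is nonzero in `G`. -/
theorem isUnit_of_isUnit_map_algebraMap {n : Type*} [Fintype n] [DecidableEq n]
    {T : Matrix n n F} (hT : IsUnit (T.map (algebraMap F G))) : IsUnit T := by
  rw [Matrix.isUnit_iff_isUnit_det] at hT ⊢
  refine (isUnit_map_iff (algebraMap F G) _).mp ?_
  rwa [RingHom.map_det]

theorem exists_map_algebraMap {n : Type*} [Fintype n] [DecidableEq n] {z : P}
    (hz : E.lev z z = 1) (T : Matrix n n ((E.system ξ hfin hp hξ).Pt z)) :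
    ∃ T' : Matrix n n F, T.map MultSystem.Pt.val = T'.map (algebraMap F G) := by
  have h : ∀ a : (E.system ξ hfin hp hξ).Pt z, ∃ c : F, algebraMap F G c = a.val := fun a => by
    have := a.val_mem
    rwa [system_R _ _ _ _ _ le_rfl, hz, mem_powSpan_one] at this
  choose f hf using h
  exact ⟨T.map f, Matrix.ext fun j k => (hf _).symm⟩

/-- A nonsingular matrix over `𝒬_x = G`, for a strong point `x`. -/
theorem exists_isUnit_of_lev_eq_p {n : Type*} [Fintype n] [DecidableEq n] {z : P}
    (hz : E.lev z z = p) {X : Matrix n n G} (hX : IsUnit X) :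
    ∃ T : Matrix n n ((E.system ξ hfin hp hξ).Pt z), IsUnit T ∧ T.map MultSystem.Pt.val = X := by
  obtain ⟨X, rfl⟩ := hX
  exact MultSystem.exists_isUnit_map_val rfl
    (fun j k => (E.mem_system_self ξ hfin hp hξ z _).mpr (Or.inl hz))
    (fun j k => (E.mem_system_self ξ hfin hp hξ z _).mpr (Or.inl hz)) X.mul_inv X.inv_mul

/-- A nonsingular matrix over `F` as a matrix over `𝒬_x`. -/
theorem exists_isUnit_of_map {n : Type*} [Fintype n] [DecidableEq n] (z : P)
    {X : Matrix n n F} (hX : IsUnit X) :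
    ∃ T : Matrix n n ((E.system ξ hfin hp hξ).Pt z),
      IsUnit T ∧ T.map MultSystem.Pt.val = X.map (algebraMap F G) := by
  obtain ⟨X, rfl⟩ := hX
  refine MultSystem.exists_isUnit_map_val (Y := (↑X⁻¹ : Matrix n n F).map (algebraMap F G)) rfl
    (fun j k => (E.mem_system_self ξ hfin hp hξ z _).mpr (Or.inr ⟨_, rfl⟩))
    (fun j k => (E.mem_system_self ξ hfin hp hξ z _).mpr (Or.inr ⟨_, rfl⟩)) ?_ ?_
  · rw [← Matrix.map_mul, X.mul_inv]; exact (algebraMap F G).mapMatrix.map_one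
  · rw [← Matrix.map_mul, X.inv_mul]; exact (algebraMap F G).mapMatrix.map_one

end PEquipped

end Equipped

end EqPoset

/-! ### The theorem and its corollary -/

theorem mainTheorem10 :
    (∀ (K : Type u) (A : Type v) (Q : Type w) [Field K] [Ring A] [Algebra K A]
      [PartialOrder Q] [Fintype Q] [OrderBot Q]
      (ℛ : EqPoset.MultSystem K A Q) (_ : ∀ z, EqPoset.IsDivRing (ℛ.Pt z)) (g : ℛ.Gens)
      (B : ℛ.decomp.DualBasis) (M N : EqPoset.MultSystem.ModDe.{u, v, w, x} B)
      (bM : M.LocalBasis) (bN : N.LocalBasis),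
      M.Iso N ↔
        ∃ hd : ∀ z, bM.dim z = bN.dim z,
        ∃ T₀ : Matrix (Fin (bM.dim ⊥)) (Fin (bM.dim ⊥)) (ℛ.Pt ⊥),
        ∃ T : ∀ z, Matrix (Fin (bM.dim z)) (Fin (bM.dim z)) (ℛ.Pt z),
        ∃ U : ∀ y z, Matrix (Fin (bM.dim y)) (Fin (bM.dim z)) (ℛ.R y z),
          IsUnit T₀ ∧ (∀ z, ⊥ < z → IsUnit (T z)) ∧
          ∀ z, ⊥ < z →
            bM.matrix g z =
              T₀ * (bN.matrix g z).submatrix (Fin.cast (hd ⊥)) (Fin.cast (hd z)) *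
                (T z).map (g.phi z) +
              ∑ y ∈ EqPoset.below z,
                T₀ * (bN.matrix g y).submatrix (Fin.cast (hd ⊥)) (Fin.cast (hd y)) *
                  (U y z).map (g.chi y z)) ∧
    (∀ (F : Type u) (G : Type v) [Field F] [Field G] [Algebra F G] (p : ℕ) (hp : p.Prime)
      (hfin : Module.finrank F G = p) (ξ : G) (hξ : IntermediateField.adjoin F {ξ} = ⊤)
      (P₀ : Type w) [PartialOrder P₀] [Fintype P₀] (E : EqPoset.PEquipped p P₀)
      (B : ((E.extend hp.one_le).system ξ hfin hp.one_le hξ).decomp.DualBasis)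
      (M N : EqPoset.MultSystem.ModDe.{u, v, w, x} B)
      (bM : M.LocalBasis) (bN : N.LocalBasis),
      M.Iso N ↔
        ∃ hd : ∀ z, bM.dim z = bN.dim z,
        ∃ T₀ : Matrix (Fin (bM.dim ⊥)) (Fin (bM.dim ⊥)) G,
        ∃ T : ∀ z, Matrix (Fin (bM.dim z)) (Fin (bM.dim z)) G,
        ∃ U : ∀ y z, Matrix (Fin (bM.dim y)) (Fin (bM.dim z)) G,
          IsUnit T₀ ∧
          (∀ z, ⊥ < z → (E.extend hp.one_le).lev z z = p → IsUnit (T z)) ∧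
          (∀ z, ⊥ < z → (E.extend hp.one_le).lev z z = 1 →
            ∃ T' : Matrix (Fin (bM.dim z)) (Fin (bM.dim z)) F,
              IsUnit T' ∧ T z = T'.map (algebraMap F G)) ∧
          (∀ y z, ⊥ < y → y < z → ∀ i j,
            U y z i j ∈ EqPoset.PEquipped.powSpan F ξ ((E.extend hp.one_le).lev y z)) ∧
          ∀ z, ⊥ < z →
            (bM.matrix (E.gens ξ hfin hp.one_le hξ) z).map EqPoset.MultSystem.Pt.val =
              T₀ * ((bN.matrix (E.gens ξ hfin hp.one_le hξ) z).map
                EqPoset.MultSystem.Pt.val).submatrix (Fin.cast (hd ⊥)) (Fin.cast (hd z)) * T z +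
              ∑ y ∈ EqPoset.below z,
                T₀ * ((bN.matrix (E.gens ξ hfin hp.one_le hξ) y).map
                  EqPoset.MultSystem.Pt.val).submatrix (Fin.cast (hd ⊥)) (Fin.cast (hd y)) *
                  U y z) := by
  refine ⟨fun K A Q _ _ _ _ _ _ ℛ hD g B M N bM bN =>
    EqPoset.MultSystem.ModDe.iso_iff_matrices hD g bM bN, ?_⟩
  intro F G _ _ _ p hp hfin ξ hξ P₀ _ _ E B M N bM bN
  have hdiv := (E.extend hp.one_le).isDivRing_system ξ hfin hp.one_le hξ
  rw [EqPoset.MultSystem.ModDe.iso_iff_matrices hdiv (E.gens ξ hfin hp.one_le hξ) bM bN]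
  refine exists_congr fun hd => ?_
  -- With all `v_{0,x} = 1` the two matrix equations agree after embedding in `G`; what remains is
  -- to match the conditions on the entries and on invertibility.
  have key := fun z T₀ T U => EqPoset.MultSystem.matrix_eq_iff (g := E.gens ξ hfin hp.one_le hξ)
    (fun _ => rfl) rfl (z := z) (bM.matrix (E.gens ξ hfin hp.one_le hξ) z)
    (fun y => (bN.matrix (E.gens ξ hfin hp.one_le hξ) y).submatrix (Fin.cast (hd ⊥))
      (Fin.cast (hd y))) T₀ T U
  constructor
  · rintro ⟨T₀, T, U, h₀, hT, h⟩
    refine ⟨T₀.map EqPoset.MultSystem.Pt.val, fun z => (T z).map EqPoset.MultSystem.Pt.val,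
      fun y z => (U y z).map Subtype.val, EqPoset.PEquipped.isUnit_map_val _ ξ hfin hp.one_le hξ h₀,
      fun z hz _ => EqPoset.PEquipped.isUnit_map_val _ ξ hfin hp.one_le hξ (hT z hz),
      fun z hz h1 => ?_, fun y z _ hyz i j => ?_,
      fun z hz => (key z T₀ (T z) fun y => U y z).mp (h z hz)⟩
    · obtain ⟨T', hT'⟩ := (E.extend hp.one_le).exists_map_algebraMap ξ hfin hp.one_le hξ h1 (T z)
      refine ⟨T', ?_, hT'⟩
      apply EqPoset.PEquipped.isUnit_of_isUnit_map_algebraMap (G := G)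
      rw [← hT']
      exact EqPoset.PEquipped.isUnit_map_val _ ξ hfin hp.one_le hξ (hT z hz)
    · rw [← (E.extend hp.one_le).system_R ξ hfin hp.one_le hξ hyz.le]
      exact (U y z i j).2
  · rintro ⟨T₀, T, U, h₀, hs, hw, hU, h⟩
    -- The added point `0` is strong, so `𝒬_0 = G` and an invertible matrix over `G` is already one
    -- over `𝒬_0`.
    obtain ⟨T₀', h₀', rfl⟩ := (E.extend hp.one_le).exists_isUnit_of_lev_eq_p ξ hfin hp.one_le hξ
      (E.extend_lev_bot hp.one_le ⊥) h₀
    have hT : ∀ z, ∃ T' : Matrix (Fin (bM.dim z)) (Fin (bM.dim z))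
        (((E.extend hp.one_le).system ξ hfin hp.one_le hξ).Pt z),
        ⊥ < z → IsUnit T' ∧ T'.map EqPoset.MultSystem.Pt.val = T z := fun z => by
      by_cases hz : ⊥ < z
      · rcases (E.extend hp.one_le).lev_self z with h1 | h1
        · obtain ⟨X, hX, hX'⟩ := hw z hz h1
          obtain ⟨T', hT'⟩ :=
            (E.extend hp.one_le).exists_isUnit_of_map ξ hfin hp.one_le hξ z hX
          exact ⟨T', fun _ => hX' ▸ hT'⟩
        · obtain ⟨T', hT'⟩ := (E.extend hp.one_le).exists_isUnit_of_lev_eq_p ξ hfin hp.one_le hξ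
            h1 (hs z hz h1)
          exact ⟨T', fun _ => hT'⟩
      -- At `z = 0` no condition is imposed on `T`, and any matrix will do.
      · exact ⟨0, fun h => absurd h hz⟩
    have hU' : ∀ y z, ∃ U' : Matrix (Fin (bM.dim y)) (Fin (bM.dim z))
        (((E.extend hp.one_le).system ξ hfin hp.one_le hξ).R y z),
        ⊥ < y ∧ y < z → U'.map Subtype.val = U y z := fun y z => by
      by_cases hyz : ⊥ < y ∧ y < z
      · refine ⟨Matrix.of fun i j => ⟨U y z i j, ?_⟩, fun _ => rfl⟩
        rw [(E.extend hp.one_le).system_R ξ hfin hp.one_le hξ hyz.2.le]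
        exact hU y z hyz.1 hyz.2 i j
      · exact ⟨0, fun h => absurd h hyz⟩
    choose T' hT' using hT
    choose U' hU' using hU'
    refine ⟨T₀', T', U', h₀', fun z hz => (hT' z hz).1, fun z hz => ?_⟩
    refine (key z T₀' (T' z) fun y => U' y z).mpr ?_
    rw [(hT' z hz).2]
    refine (h z hz).trans (congrArg₂ (· + ·) rfl (Finset.sum_congr rfl fun y hy => ?_))
    rw [hU' y z (EqPoset.MultSystem.mem_below.mp hy)]
    rfl
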